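/- **Setting.** Let $t=(t_1,t_3,t_5,\dots)$ be a family of real numbers indexed by the odd positive integers, with $t_n\neq0$ for only finitely many $n$. *Correlation kernel.* Let $\phi_a$ $(a\in\mathbb Z)$ be the neutral fermions, $\phi_a\phi_b+\phi_b\phi_a=(-1)^a\delta_{a+b,0}$, acting on the Fock space with basis $e_{a_l}\wedge\cdots\wedge e_{a_1}$ $(a_1>\dots>a_l\ge 0)$, as follows: for $a>0$, $\phi_a(\bullet)=\bullet\wedge e_a$, while $\phi_{-a}(\bullet\wedge e_a)=(-1)^a\,\bullet$ and $\phi_{-a}$ kills the basis vectors without $e_a$; $\phi_0(\bullet)=\bullet\wedge e_0$ and $\phi_0(\bullet\wedge e_0)=\tfrac12\,\bullet$ for basis vectors $\bullet$ without $e_0$. Let $|0\rangle$ be the vacuum (the empty wedge) and $\langle0|v$ the coefficient of $|0\rangle$ in $v$. Put $H_n=\tfrac12\sum_{a\in\mathbb Z}(-1)^{a+1}\phi_a\phi_{-a-n}$ and $H_{\pm}(t)=\sum_{n\ge1\text{ odd}}t_nH_{\pm n}$. For $a,b\in\mathbb Z$ set $$K(a,b;t)=\langle 0|\,e^{H_+(2t)}e^{-H_-(2t)}\,\phi_a\phi_b\,e^{H_-(2t)}e^{-H_+(2t)}\,|0\rangle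 ,$$ where the exponentials are the exponential series, summed coefficientwise on formal (possibly infinite) linear combinations of the basis vectors. *Correlation matrix.* For integers $a_1,\dots,a_N$ let $M(a_1,\dots,a_N;t)$ be the skew-symmetric $2N\times2N$ matrix with the following entries for $i<j$: $$M_{ij}=\begin{cases}K(a_i,a_j;t)& i<j\le N,\\ (-1)^{a_{2N-j+1}}K(a_i,-a_{2N-j+1};t)& i\le N<j,\\ (-1)^{a_{2N-i+1}+a_{2N-j+1}}K(-a_{2N-i+1},-a_{2N-j+1};t)& N<i<j.\end{cases}$$ *Airy objects.* For even $p\ge2$ let $\mathrm{Ai}_p(x)=\frac1\pi\int_0^\infty\cos\!\big(\frac{s^{p+1}}{p+1}+xs\big)\,ds$ (improper integral) and $K_{p\text{-Airy}}(x,y)=\int_0^\infty\mathrm{Ai}_p(x+z)\,\mathrm{Ai}_p(y+z)\,dz$. **Theorem.** Let $p\ge2$ be even and let $a>0$. Assume that * ($p$-multicriticality) $\varphi(\theta)=4\sum_{n\text{ odd}}t_n\sin n\theta-a\theta$ satisfies $\varphi(\theta)=-\frac{\theta^{p+1}}{p+1}+O(\theta^{p+3})$ as $\theta\to0$; * (non-degeneracy)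 $4\sum_{n\text{ odd}}n^2t_n\sin n\theta>0$ for all $\theta\in(0,\pi)$. For $\varepsilon>0$ and $x\in\mathbb R$ put $A_\varepsilon(x)=\big\lfloor \frac{a}{\varepsilon^{p+1}}+\frac{x}{\varepsilon}\big\rfloor$ (so $A_\varepsilon(x)=\frac{a}{\varepsilon^{p+1}}+\frac{x}{\varepsilon}$ whenever this number is an integer) and $t_\varepsilon=t/\varepsilon^{p+1}$. Then the improper integral $\mathrm{Ai}_p(x)$ converges for every $x\in\mathbb R$, the function $z\mapsto \mathrm{Ai}_p(x+z)\mathrm{Ai}_p(y+z)$ is integrable on $(0,\infty)$ for all $x,y\in\mathbb R$, and for all $x,y\in\mathbb R$, as $\varepsilon\to0^+$, 1. $\frac1\varepsilon K(A_\varepsilon(x),A_\varepsilon(y);t_\varepsilon)\to0$, 2. $\frac1\varepsilon(-1)^{A_\varepsilon(y)}K(A_\varepsilon(x),-A_\varepsilon(y);t_\varepsilon)\to K_{p\text{-Airy}}(x,y)$, 3. $\frac1\varepsilon(-1)^{A_\varepsilon(x)+A_\varepsilon(y)}K(-A_\varepsilon(x),-A_\varepsilon(y);t_\varepsilon)\to0$.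 Consequently, for every $N\ge0$ and all $k_1,\dots,k_N\in\mathbb R$, $$\lim_{\varepsilon\to0^+}\frac{1}{\varepsilon^{N}}\,\mathrm{Pf}\,M\big(A_\varepsilon(k_1),\dots,A_\varepsilon(k_N);t_\varepsilon\big)=\det_{1\le i,j\le N}K_{p\text{-Airy}}(k_i,k_j).$$ -/

import Mathlib

open Real Filter Topology MeasureTheory Asymptotics

open scoped BigOperators Nat

noncomputable section

/-- The (completed) fermionic Fock space of neutral fermions.  The basis vector
`e_{a_l} ∧ ⋯ ∧ e_{a_1}` with `a_1 > ⋯ > a_l ≥ 0` is indexed by the finite set `{a_1, …, a_l} ⊆ ℕ`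
of occupied sites; an element `v` stands for the formal, possibly infinite, linear combination
`∑ v(S) e_S` (infinite combinations occur because the coherent state `e^{H_-}|0⟩` is one). -/
abbrev NeutralFock : Type := Finset ℕ → ℂ

/-- The sign picked up when `e_m` is moved to the last place past all the factors `e_s`, `s > m`. -/
def wedgeSign (m : ℕ) (S : Finset ℕ) : ℂ :=
  (-1) ^ (S.filter fun s => m < s).card

/-- Exterior multiplication from the right, `• ↦ • ∧ e_m`. -/
def wedgeRight (m : ℕ) : NeutralFock →ₗ[ℂ] NeutralFock where
  toFun v S := if m ∈ S then wedgeSign m S * v (S.erase m) else 0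
  map_add' v w := by
    funext S
    by_cases h : m ∈ S <;> simp [h, mul_add]
  map_smul' c v := by
    funext S
    by_cases h : m ∈ S <;> simp [h, mul_left_comm]

/-- Contraction from the right, `• ∧ e_m ↦ •`; it kills the basis vectors without `e_m`. -/
def wedgeContract (m : ℕ) : NeutralFock →ₗ[ℂ] NeutralFock where
  toFun v S := if m ∈ S then 0 else wedgeSign m S * v (insert m S)
  map_add' v w := by
    funext S
    by_cases h : m ∈ S <;> simp [h, mul_add]
  map_smul' c v := by
    funext S
    by_cases h : m ∈ S <;> simp [h, mul_left_comm]

/-- The neutral fermion `φ_a`, `a ∈ ℤ`: `φ_a` creates the site `a` for `a > 0`, `φ_{-a}` is `(-1)^a`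
times the annihilation of the site `a` for `a > 0`, and `φ_0` is the zero mode, normalised so that
`φ_0 ^ 2 = 1 / 2`.  Thus `φ_a φ_b + φ_b φ_a = (-1)^a δ_{a+b,0}`. -/
def neutralFermion (a : ℤ) : NeutralFock →ₗ[ℂ] NeutralFock :=
  if 0 < a then wedgeRight a.natAbs
  else if a < 0 then ((-1 : ℂ) ^ a) • wedgeContract a.natAbs
  else wedgeRight 0 + (1 / 2 : ℂ) • wedgeContract 0

/-- The vacuum vector `|0⟩`. -/
def fockVacuum : NeutralFock := Pi.single ∅ 1

/-- The pairing with the dual vacuum `⟨0|`: the coefficient of `|0⟩`. -/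
def vacuumPairing (v : NeutralFock) : ℂ := v ∅

/-- The bosonic modes `H_n = (1/2) ∑_{a ∈ ℤ} (-1)^(a+1) φ_a φ_{-a-n}`.
For `n ≠ 0` only finitely many `a` contribute to any given coefficient. -/
def bosonMode (n : ℤ) (v : NeutralFock) : NeutralFock := fun S =>
  (1 / 2 : ℂ) *
    ∑ᶠ a : ℤ, (-1 : ℂ) ^ (a + 1) * neutralFermion a (neutralFermion (-a - n) v) S

/-- `H_+(t) = ∑ t_n H_n`. -/
def hamiltonianPlus (t : ℕ →₀ ℝ) (v : NeutralFock) : NeutralFock :=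
  t.sum fun n c => (c : ℂ) • bosonMode (n : ℤ) v

/-- `H_-(t) = ∑ t_n H_{-n}`. -/
def hamiltonianMinus (t : ℕ →₀ ℝ) (v : NeutralFock) : NeutralFock :=
  t.sum fun n c => (c : ℂ) • bosonMode (-(n : ℤ)) v

/-- The exponential series `e^X v = ∑_k X^k v / k!`, summed coefficientwise. -/
def fockExp (X : NeutralFock → NeutralFock) (v : NeutralFock) : NeutralFock := fun S =>
  ∑' k : ℕ, ((k ! : ℕ) : ℂ)⁻¹ * (X^[k] v) S

/-- The correlation kernel of the shifted Schur measure with real Miwa variables `t`,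
`K(a,b;t) = ⟨0| e^{H_+(2t)} e^{-H_-(2t)} φ_a φ_b e^{H_-(2t)} e^{-H_+(2t)} |0⟩`. -/
def shiftedSchurKernel (t : ℕ →₀ ℝ) (a b : ℤ) : ℂ :=
  vacuumPairing <|
    fockExp (hamiltonianPlus ((2 : ℝ) • t)) <|
    fockExp (fun v => -hamiltonianMinus ((2 : ℝ) • t) v) <|
    neutralFermion a <| neutralFermion b <|
    fockExp (hamiltonianMinus ((2 : ℝ) • t)) <|
    fockExp (fun v => -hamiltonianPlus ((2 : ℝ) • t) v) fockVacuum

/-- The Pfaffian of a skew-symmetric matrix of order `2N`: the signed sum over the permutations `σ`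
with `σ(1) < σ(3) < ⋯ < σ(2N-1)` and `σ(2i-1) < σ(2i)` (here numbered from `0`). -/
def pfaffian {N : ℕ} (M : Matrix (Fin (2 * N)) (Fin (2 * N)) ℂ) : ℂ :=
  ∑ σ : Equiv.Perm (Fin (2 * N)) with
      (∀ i j : Fin N, i < j →
        σ ⟨2 * i.val, by omega⟩ < σ ⟨2 * j.val, by omega⟩) ∧
      (∀ i : Fin N, σ ⟨2 * i.val, by omega⟩ < σ ⟨2 * i.val + 1, by omega⟩),
    ((Equiv.Perm.sign σ : ℤ) : ℂ) *
      ∏ i : Fin N, M (σ ⟨2 * i.val, by omega⟩) (σ ⟨2 * i.val + 1, by omega⟩)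

/-- The entries above the diagonal of the correlation matrix of the sites `a_1, …, a_N`
(with `i < j`, both numbered from `0`; the index `2N - j + 1` of the formula with numbering
from `1` becomes `2N - 1 - j`). -/
def correlationEntry (t : ℕ →₀ ℝ) {N : ℕ} (a : Fin N → ℤ) (i j : Fin (2 * N)) : ℂ :=
  if hj : j.val < N then
    if hi : i.val < N then
      shiftedSchurKernel t (a ⟨i.val, hi⟩) (a ⟨j.val, hj⟩)
    else 0
  else
    if hi : i.val < N then
      (-1 : ℂ) ^ (a ⟨2 * N - 1 - j.val, by omega⟩) *
        shiftedSchurKernel t (a ⟨i.val, hi⟩) (-a ⟨2 * N - 1 - j.val, by omega⟩)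
    else
      (-1 : ℂ) ^ (a ⟨2 * N - 1 - i.val, by omega⟩ + a ⟨2 * N - 1 - j.val, by omega⟩) *
        shiftedSchurKernel t (-a ⟨2 * N - 1 - i.val, by omega⟩) (-a ⟨2 * N - 1 - j.val, by omega⟩)

/-- The skew-symmetric correlation matrix `M({a_1, …, a_N}; t)` of order `2N`. -/
def correlationMatrix (t : ℕ →₀ ℝ) {N : ℕ} (a : Fin N → ℤ) :
    Matrix (Fin (2 * N)) (Fin (2 * N)) ℂ :=
  fun i j =>
    if i < j then correlationEntry t a i j
    else if j < i then -correlationEntry t a j i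
    else 0

/-- The truncation `(1/π) ∫_0^R cos(s^(p+1)/(p+1) + x s) ds` of the integral defining `Ai_p`. -/
def higherAiryTruncated (p : ℕ) (x R : ℝ) : ℝ :=
  π⁻¹ * ∫ s in (0 : ℝ)..R, Real.cos (s ^ (p + 1) / ((p : ℝ) + 1) + x * s)

/-- The `p`-Airy function `Ai_p(x) = (1/π) ∫_0^∞ cos(s^(p+1)/(p+1) + x s) ds`, the integral being
improper (conditionally convergent). -/
def higherAiry (p : ℕ) (x : ℝ) : ℝ :=
  limUnder atTop (higherAiryTruncated p x)

/-- The `p`-Airy kernel `∫_0^∞ Ai_p(x+z) Ai_p(y+z) dz`. -/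
def higherAiryKernel (p : ℕ) (x y : ℝ) : ℝ :=
  ∫ z in Set.Ioi (0 : ℝ), higherAiry p (x + z) * higherAiry p (y + z)

/-- The phase `φ(θ) = 4 ∑ t_n sin(nθ) - aθ`. -/
def phase (t : ℕ →₀ ℝ) (a θ : ℝ) : ℝ :=
  4 * (t.sum fun n c => c * Real.sin (n * θ)) - a * θ

/-- The standing conditions on the Miwa variables `t = (t_1, t_3, …)`.  That they are real and
that all but finitely many vanish is part of the type of `t`. -/
structure IsMulticritical (p : ℕ) (a : ℝ) (t : ℕ →₀ ℝ) : Prop where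
  /-- only variables with odd index occur -/
  odd_of_ne_zero : ∀ n, t n ≠ 0 → Odd n
  order_pos : 0 < p
  order_even : Even p
  edge_pos : 0 < a
  /-- `p`-multicriticality: `φ(θ) = -θ^(p+1)/(p+1) + O(θ^(p+3))` at `θ = 0` -/
  multicritical :
    (fun θ : ℝ => phase t a θ + θ ^ (p + 1) / ((p : ℝ) + 1)) =O[𝓝 0] fun θ : ℝ => θ ^ (p + 3)
  /-- non-degeneracy -/
  nondegenerate :
    ∀ θ ∈ Set.Ioo (0 : ℝ) π, 0 < 4 * (t.sum fun n c => (n : ℝ) ^ 2 * c * Real.sin (n * θ))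

/-- The lattice site `a/ε^(p+1) + x/ε` near the edge, rounded down; no rounding takes place for
those `ε` for which this number is an integer. -/
def edgeSite (p : ℕ) (a ε x : ℝ) : ℤ :=
  ⌊a / ε ^ (p + 1) + x / ε⌋

/-- The rescaled Miwa variables `t / ε^(p+1)`. -/
def edgeMiwa (p : ℕ) (t : ℕ →₀ ℝ) (ε : ℝ) : ℕ →₀ ℝ :=
  (ε ^ (p + 1))⁻¹ • t

end

/-!
For odd `n` one has `[H_n, φ_b] = φ_{b-n}` (`bosonMode_neutralFermion`), so that conjugation by
`e^{H_+(2t)} e^{-H_-(2t)}` multiplies the Laurent polynomial of a fermion field by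
`exp (2 ∑ t_n (z^{-n} - z^n))` (`fockExp_fermionField`), which is `exp (-4 i ∑ t_n sin nθ)` at
`z = e^{iθ}`.  Together with `⟨0| φ_{-d} φ_d |0⟩ = ω_d`, where `ω_0 = 1/2` and `ω_d = (-1)^d` for
`d > 0`, this expands the kernel in the Fourier coefficients
`j_m = (1/π) ∫_0^π cos(mθ - 4 ∑ t_n sin nθ) dθ` (`waveCoeff`):
`K(a,b;t) = ∑_{d ≥ 0} ω_d j_{a+d} j_{b-d}` (`shiftedSchurKernel_eq`).
As only odd `n` occur, `j_{-m} = (-1)^m j_m`.  Three facts about these series give the limits.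

* *Edge scaling.*  At the site `m = a/ε^{p+1} + x/ε` the coefficient `j_m` is `ε` times an integral
  (`approxAiry`) whose phase is convex by non-degeneracy and tends to `s^{p+1}/(p+1) + xs` by
  multicriticality.  The first derivative test bounds this integral by a multiple of `1/(1+|x|)`,
  uniformly in `ε`, and shows that it converges to `Ai_p(x)`.
* *Diagonal block.*  `(-1)^b K(a,-b) = ∑_{d ≥ 0} j_{a+d} j_{b+d} - j_a j_b / 2` divided by `ε` is a
  Riemann sum for `∫_0^∞ Ai_p(x+z) Ai_p(y+z) dz`, up to a term which tends to zero, and the bound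
  just mentioned dominates it (`IsEdgePhase.tendsto_tsum_approxAiry`).
* *Off-diagonal blocks.*  The recurrence `m j_m = ∑ 2n t_n (j_{m-n} + j_{m+n})`, applied to
  `j_{a+d}` and to `j_{b-d}`, makes `(a+b) ∑ (-1)^d j_{a+d} j_{b-d}` telescope, because `n` is odd
  (`add_mul_alternatingSum`).  What remains are finitely many products of two coefficients of
  size `O(ε)`, with weights `t_n/ε^{p+1}` which the factor `a+b` compensates; hence `K(a,b)` is
  `O(ε^2)`, and so is the transposed block `K(-a,-b)`.

In the limit the correlation matrix is therefore block-antidiagonal.  Only the matchings that pair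
each of the first `N` indices with one of the last `N` contribute to its Pfaffian, which becomes the
determinant of the remaining block (`tendsto_pfaffian`).
-/

noncomputable section

/-! ### Neutral fermions in coordinates -/

open scoped symmDiff in
/-- The set of occupied sites after the occupation of the site `m` is reversed. -/
def toggleSite (m : ℕ) (S : Finset ℕ) : Finset ℕ := S ∆ {m}

lemma toggleSite_of_mem {m : ℕ} {S : Finset ℕ} (h : m ∈ S) : toggleSite m S = S.erase m := by
  ext x; by_cases hx : x = m <;> simp [toggleSite, Finset.mem_symmDiff, hx, h]

lemma toggleSite_of_notMem {m : ℕ} {S : Finset ℕ} (h : m ∉ S) :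
    toggleSite m S = insert m S := by
  ext x; by_cases hx : x = m <;> simp [toggleSite, Finset.mem_symmDiff, hx, h]

lemma mem_toggleSite {m k : ℕ} {S : Finset ℕ} :
    k ∈ toggleSite m S ↔ if k = m then k ∉ S else k ∈ S := by
  by_cases hx : k = m <;> simp [toggleSite, Finset.mem_symmDiff, hx]

lemma toggleSite_comm (m k : ℕ) (S : Finset ℕ) :
    toggleSite m (toggleSite k S) = toggleSite k (toggleSite m S) :=
  symmDiff_right_comm _ _ _

@[simp] lemma toggleSite_self (m : ℕ) (S : Finset ℕ) : toggleSite m (toggleSite m S) = S :=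
  symmDiff_symmDiff_cancel_right _ _

lemma wedgeSign_toggleSite (m k : ℕ) (S : Finset ℕ) :
    wedgeSign m (toggleSite k S) = (if m < k then -1 else 1) * wedgeSign m S := by
  unfold wedgeSign
  by_cases hk : k ∈ S
  · rw [toggleSite_of_mem hk, Finset.filter_erase]
    split_ifs with h
    · have hmem : k ∈ S.filter fun s => m < s := by simp [hk, h]
      rw [← Finset.card_erase_add_one hmem, pow_succ]; ring
    · rw [Finset.erase_eq_of_notMem (by simp [h]), one_mul]
  · rw [toggleSite_of_notMem hk, Finset.filter_insert]
    split_ifs with h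
    · rw [Finset.card_insert_of_notMem (by simp [hk]), pow_succ]; ring
    · rw [one_mul]

lemma wedgeSign_mul_self (m : ℕ) (S : Finset ℕ) : wedgeSign m S * wedgeSign m S = 1 := by
  unfold wedgeSign
  rw [← mul_pow]; norm_num

/-- The coefficient of `φ_a` without the wedge sign; `s` tells whether the site `|a|` is occupied
in the coordinate that is read off. -/
def occupationCoeff (a : ℤ) (s : Prop) [Decidable s] : ℂ :=
  if s then (if 0 ≤ a then 1 else 0) else if 0 < a then 0 else if a < 0 then (-1) ^ a else 1 / 2

/-- The coefficient in `(φ_a v)(S) = c_a(S) v(S ∆ {|a|})`. -/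
def fermionCoeff (a : ℤ) (S : Finset ℕ) : ℂ :=
  wedgeSign a.natAbs S * occupationCoeff a (a.natAbs ∈ S)

lemma neutralFermion_apply (a : ℤ) (v : NeutralFock) (S : Finset ℕ) :
    neutralFermion a v S = fermionCoeff a S * v (toggleSite a.natAbs S) := by
  unfold neutralFermion fermionCoeff occupationCoeff
  rcases lt_trichotomy a 0 with h | rfl | h
  · by_cases hm : a.natAbs ∈ S
    · simp [h, h.not_ge, not_lt.2 h.le, hm, wedgeContract]
    · simp [h, not_lt.2 h.le, hm, wedgeContract, toggleSite_of_notMem]; ring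
  · by_cases hm : 0 ∈ S
    · simp [hm, wedgeContract, wedgeRight, toggleSite_of_mem]
    · simp [hm, wedgeContract, wedgeRight, toggleSite_of_notMem]; ring
  · by_cases hm : a.natAbs ∈ S
    · simp [h, h.le, hm, wedgeRight, toggleSite_of_mem]
    · simp [h, hm, wedgeRight]

lemma neutralFermion_comp_apply (a b : ℤ) (v : NeutralFock) (S : Finset ℕ) :
    neutralFermion a (neutralFermion b v) S =
      fermionCoeff a S * fermionCoeff b (toggleSite a.natAbs S) *
        v (toggleSite b.natAbs (toggleSite a.natAbs S)) := by
  rw [neutralFermion_apply, neutralFermion_apply, mul_assoc]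

lemma occupationCoeff_congr (a : ℤ) {s s' : Prop} [Decidable s] [Decidable s'] (h : s ↔ s') :
    occupationCoeff a s = occupationCoeff a s' := by
  unfold occupationCoeff; simp only [h]

/-- The canonical anticommutation relations. -/
lemma neutralFermion_anticomm (a b : ℤ) (v : NeutralFock) :
    neutralFermion a (neutralFermion b v) + neutralFermion b (neutralFermion a v) =
      (if a + b = 0 then (-1 : ℂ) ^ a else 0) • v := by
  funext S
  rw [Pi.add_apply, neutralFermion_comp_apply, neutralFermion_comp_apply, Pi.smul_apply,
    smul_eq_mul, toggleSite_comm]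
  unfold fermionCoeff
  simp only [wedgeSign_toggleSite]
  by_cases hab : a.natAbs = b.natAbs
  · rw [hab, toggleSite_self, if_neg (lt_irrefl _)]
    have hs := wedgeSign_mul_self b.natAbs S
    have hm : b.natAbs ∈ toggleSite b.natAbs S ↔ ¬ b.natAbs ∈ S := by simp [mem_toggleSite]
    rw [occupationCoeff_congr _ hm, occupationCoeff_congr _ hm]
    have key : ∀ s : Prop, ∀ [Decidable s], occupationCoeff a s * occupationCoeff b (¬ s) +
        occupationCoeff b s * occupationCoeff a (¬ s) =
        if a + b = 0 then (-1 : ℂ) ^ a else 0 := by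
      intro s _
      have hpow : (-1 : ℂ) ^ (-a) = (-1) ^ a := by
        rw [zpow_neg, ← inv_zpow]; norm_num
      rcases Int.natAbs_eq_natAbs_iff.1 hab with rfl | h
      · rcases lt_trichotomy a 0 with h | rfl | h
        · have : a + a ≠ 0 := by omega
          by_cases hs : s <;> simp [occupationCoeff, hs, h, h.not_ge, not_lt.2 h.le, this]
        · by_cases hs : s <;> simp [occupationCoeff, hs] <;> norm_num
        · have : a + a ≠ 0 := by omega
          by_cases hs : s <;> simp [occupationCoeff, hs, h, h.le, this]
      · have hb : b = -a := by omega
        subst hb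
        rcases lt_trichotomy a 0 with h | rfl | h
        · by_cases hs : s <;> simp [occupationCoeff, hs, h, h.le, h.not_ge, not_lt.2 h.le]
        · by_cases hs : s <;> simp [occupationCoeff, hs] <;> norm_num
        · by_cases hs : s <;>
            simp [occupationCoeff, hs, h, h.le, h.not_ge, not_lt.2 h.le, hpow]
    rw [← key (b.natAbs ∈ S)]
    linear_combination (occupationCoeff a (b.natAbs ∈ S) * occupationCoeff b (¬ b.natAbs ∈ S) +
        occupationCoeff b (b.natAbs ∈ S) * occupationCoeff a (¬ b.natAbs ∈ S)) *
        v S * hs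
  · have h0 : a + b ≠ 0 := by omega
    have hm : b.natAbs ∈ toggleSite a.natAbs S ↔ b.natAbs ∈ S := by
      simp [mem_toggleSite, Ne.symm hab]
    have hm' : a.natAbs ∈ toggleSite b.natAbs S ↔ a.natAbs ∈ S := by
      simp [mem_toggleSite, hab]
    rw [occupationCoeff_congr _ hm, occupationCoeff_congr _ hm', if_neg h0]
    rcases lt_or_gt_of_ne hab with h | h <;> simp [h, h.not_gt] <;> ring

/-- The energy of a basis vector, the sum of its occupied sites; `φ_a` raises it by `a`. -/
def fockEnergy (S : Finset ℕ) : ℤ := ∑ s ∈ S, (s : ℤ)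

lemma fockEnergy_toggleSite {a : ℤ} {S : Finset ℕ} (h : fermionCoeff a S ≠ 0) :
    fockEnergy (toggleSite a.natAbs S) = fockEnergy S - a := by
  have h2 := right_ne_zero_of_mul h
  unfold occupationCoeff at h2
  unfold fockEnergy
  by_cases hm : a.natAbs ∈ S
  · have ha : 0 ≤ a := by
      by_contra hc; simp [hm, hc] at h2
    rw [toggleSite_of_mem hm, ← Finset.sum_erase_add _ _ hm]
    simp [abs_of_nonneg ha]
  · have ha : a ≤ 0 := by
      by_contra hc; simp [hm, not_le.1 hc] at h2
    rw [toggleSite_of_notMem hm, Finset.sum_insert hm]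
    simp [abs_of_nonpos ha]; ring

lemma fockEnergy_nonneg (S : Finset ℕ) : 0 ≤ fockEnergy S :=
  Finset.sum_nonneg fun _ _ => Int.natCast_nonneg _

lemma fermionCoeff_eq_zero_of_lt {a : ℤ} {S : Finset ℕ} (h : fockEnergy S < a) :
    fermionCoeff a S = 0 := by
  by_contra hc
  have := fockEnergy_toggleSite hc
  have := fockEnergy_nonneg (toggleSite a.natAbs S)
  omega

/-- The neutral fermion as a continuous operator for the topology of coefficientwise convergence. -/
def fermionCLM (a : ℤ) : NeutralFock →L[ℂ] NeutralFock where
  toLinearMap := neutralFermion a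
  cont := by
    refine continuous_pi fun S => ?_
    change Continuous fun v => neutralFermion a v S
    simp only [neutralFermion_apply]
    fun_prop

@[simp] lemma fermionCLM_apply (a : ℤ) (v : NeutralFock) :
    fermionCLM a v = neutralFermion a v := rfl

/-! ### Bosonic modes -/

/-- Only sites in a bounded window contribute to a coefficient of a bosonic mode. -/
lemma bosonMode_coeff_eq_zero {n a : ℤ} (hn : n ≠ 0) {S : Finset ℕ}
    (ha : a ∉ Finset.Icc (-(fockEnergy S + |n|)) (fockEnergy S)) :
    fermionCoeff a S * fermionCoeff (-a - n) (toggleSite a.natAbs S) = 0 := by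
  have h0 := fockEnergy_nonneg S
  by_cases h1 : fockEnergy S < a
  · rw [fermionCoeff_eq_zero_of_lt h1, zero_mul]
  have h2 : a < -(fockEnergy S + |n|) := by
    by_contra hc; exact ha (Finset.mem_Icc.2 ⟨not_lt.1 hc, not_lt.1 h1⟩)
  have hn' := neg_abs_le n
  have hn'' := le_abs_self n
  have h3 : 0 < -a - n := by omega
  have h4 : (-a - n).natAbs ∉ S := fun hm => by
    have : (((-a - n).natAbs : ℕ) : ℤ) ≤ fockEnergy S :=
      Finset.single_le_sum (f := fun s : ℕ => (s : ℤ)) (fun _ _ => Int.natCast_nonneg _) hm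
    omega
  have h5 : (-a - n).natAbs ∉ toggleSite a.natAbs S := by
    rw [mem_toggleSite, if_neg (by omega)]; exact h4
  have h6 : occupationCoeff (-a - n) ((-a - n).natAbs ∈ toggleSite a.natAbs S) = 0 := by
    rw [occupationCoeff, if_neg h5, if_pos h3]
  simp only [fermionCoeff, h6, mul_zero]

lemma bosonMode_apply {n : ℤ} (hn : n ≠ 0) (v : NeutralFock) (S : Finset ℕ) :
    bosonMode n v S = (1 / 2 : ℂ) *
      ∑ a ∈ Finset.Icc (-(fockEnergy S + |n|)) (fockEnergy S),
        (-1 : ℂ) ^ (a + 1) * neutralFermion a (neutralFermion (-a - n) v) S := by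
  unfold bosonMode
  congr 1
  refine finsum_eq_sum_of_support_subset _ fun a ha => ?_
  by_contra hc
  refine ha ?_
  change (-1 : ℂ) ^ (a + 1) * neutralFermion a (neutralFermion (-a - n) v) S = 0
  rw [neutralFermion_comp_apply, bosonMode_coeff_eq_zero hn (by simpa using hc), zero_mul, mul_zero]

/-- The bosonic mode `H_n`, `n ≠ 0`, as a continuous operator. -/
def bosonCLM (n : ℤ) : NeutralFock →L[ℂ] NeutralFock :=
  ContinuousLinearMap.pi fun S => (1 / 2 : ℂ) •
    ∑ a ∈ Finset.Icc (-(fockEnergy S + |n|)) (fockEnergy S), (-1 : ℂ) ^ (a + 1) •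
      ((ContinuousLinearMap.proj S : NeutralFock →L[ℂ] ℂ) ∘L
        fermionCLM a ∘L fermionCLM (-a - n))

lemma bosonCLM_apply {n : ℤ} (hn : n ≠ 0) (v : NeutralFock) : bosonCLM n v = bosonMode n v := by
  funext S
  rw [bosonMode_apply hn]
  simp [bosonCLM]

lemma bosonMode_eq_zero_of_energy {n : ℤ} {v : NeutralFock} {S : Finset ℕ}
    (h : ∀ S', fockEnergy S' = fockEnergy S + n → v S' = 0) : bosonMode n v S = 0 := by
  unfold bosonMode
  convert! mul_zero _
  refine (finsum_congr fun a => ?_).trans finsum_zero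
  rw [neutralFermion_comp_apply]
  by_cases h1 : fermionCoeff a S = 0
  · simp [h1]
  by_cases h2 : fermionCoeff (-a - n) (toggleSite a.natAbs S) = 0
  · simp [h2]
  rw [h, mul_zero, mul_zero]
  rw [fockEnergy_toggleSite h2, fockEnergy_toggleSite h1]; ring

/-- `[H_n, φ_b] = φ_{b-n}` for odd `n`. -/
lemma bosonMode_neutralFermion {n : ℤ} (hn : Odd n) (b : ℤ) (v : NeutralFock) :
    bosonMode n (neutralFermion b v) =
      neutralFermion b (bosonMode n v) + neutralFermion (b - n) v := by
  have hn0 : n ≠ 0 := by rintro rfl; exact absurd hn (by decide)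
  funext S
  -- a window large enough for both sides and for the two values of `a` that survive
  obtain ⟨A, hA⟩ : ∃ A : Finset ℤ, Finset.Icc (-(fockEnergy S + |n|)) (fockEnergy S) ⊆ A ∧
      Finset.Icc (-(fockEnergy (toggleSite b.natAbs S) + |n|))
        (fockEnergy (toggleSite b.natAbs S)) ⊆ A ∧ b - n ∈ A ∧ -b ∈ A := by
    refine ⟨_ ∪ (_ ∪ {b - n, -b}), Finset.subset_union_left,
      Finset.subset_union_left.trans Finset.subset_union_right, by simp, by simp⟩
  have expand : ∀ (w : NeutralFock) (R : Finset ℕ),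
      Finset.Icc (-(fockEnergy R + |n|)) (fockEnergy R) ⊆ A → bosonMode n w R = (1 / 2 : ℂ) *
      ∑ a ∈ A, (-1 : ℂ) ^ (a + 1) * neutralFermion a (neutralFermion (-a - n) w) R := by
    intro w R hR
    rw [bosonMode_apply hn0]
    congr 1
    refine Finset.sum_subset hR fun a _ ha => ?_
    rw [neutralFermion_comp_apply, bosonMode_coeff_eq_zero hn0 ha, zero_mul, mul_zero]
  rw [Pi.add_apply, expand _ _ hA.1, neutralFermion_apply b (bosonMode n v), expand _ _ hA.2.1]
  have comm : ∀ a, neutralFermion a (neutralFermion (-a - n) (neutralFermion b v)) S =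
      fermionCoeff b S * neutralFermion a (neutralFermion (-a - n) v) (toggleSite b.natAbs S) +
      ((if a = b - n then (-1 : ℂ) ^ b * neutralFermion (b - n) v S else 0) -
        (if a = -b then (-1 : ℂ) ^ b * neutralFermion (b - n) v S else 0)) := by
    intro a
    have h1 := neutralFermion_anticomm (-a - n) b v
    have h2 := neutralFermion_anticomm b a (neutralFermion (-a - n) v)
    rw [eq_sub_of_add_eq h1, map_sub, map_smul, eq_sub_of_add_eq' h2, ← neutralFermion_apply]
    simp only [Pi.sub_apply, Pi.smul_apply, smul_eq_mul]
    have e1 : -a - n + b = 0 ↔ a = b - n := by omega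
    have e2 : b + a = 0 ↔ a = -b := by omega
    simp only [e1, e2]
    obtain ⟨k, hk⟩ := hn
    by_cases c1 : a = b - n
    · have hp : (-1 : ℂ) ^ (-a - n) = (-1) ^ b := by
        rw [show -a - n = -b by omega, zpow_neg, ← inv_zpow]; norm_num
      have c2 : a ≠ -b := by omega
      rw [if_pos c1, if_pos c1, if_neg c2, if_neg c2, hp, c1]; ring
    · by_cases c2 : a = -b
      · rw [if_neg c1, if_neg c1, if_pos c2, if_pos c2, c2, show - -b - n = b - n by ring]; ring
      · rw [if_neg c1, if_neg c1, if_neg c2, if_neg c2]; ring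
  simp only [comm, mul_add, mul_sub, Finset.sum_add_distrib, Finset.sum_sub_distrib, mul_ite,
    mul_zero, Finset.sum_ite_eq', hA.2.2.1, hA.2.2.2, if_true]
  have s1 : (-1 : ℂ) ^ (b - n + 1) * (-1) ^ b = 1 := by
    rw [← zpow_add₀ (by norm_num)]
    refine Even.neg_one_zpow ?_
    obtain ⟨k, rfl⟩ := hn
    exact ⟨b - k, by ring⟩
  have s2 : (-1 : ℂ) ^ (-b + 1) * (-1) ^ b = -1 := by
    rw [← zpow_add₀ (by norm_num)]
    norm_num
  rw [Finset.mul_sum, Finset.mul_sum, Finset.mul_sum]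
  simp only [mul_left_comm (fermionCoeff b S)]
  linear_combination (1 / 2 * neutralFermion (b - n) v S) * (s1 - s2)

/-! ### Fermion fields and Hamiltonians -/

open LaurentPolynomial in
/-- The Laurent polynomial `∑ t_n z^(s n)`; multiplication by it is the adjoint action of a
Hamiltonian on fermion fields. -/
def miwaLaurent (s : ℤ) (t : ℕ →₀ ℝ) : LaurentPolynomial ℂ :=
  t.sum fun n c => (c : ℂ) • T (s * n)

lemma coeff_miwaLaurent_mul (s : ℤ) (t : ℕ →₀ ℝ) (F : LaurentPolynomial ℂ) (c : ℤ) :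
    (miwaLaurent s t * F).coeff c = t.sum fun n x => (x : ℂ) * F.coeff (c - s * n) := by
  simp only [miwaLaurent, Finsupp.sum, Finset.sum_mul, AddMonoidAlgebra.coeff_sum,
    Finset.sum_apply', smul_mul_assoc, AddMonoidAlgebra.coeff_smul, Finsupp.smul_apply, smul_eq_mul]
  refine Finset.sum_congr rfl fun n _ => ?_
  rw [LaurentPolynomial.T, AddMonoidAlgebra.coeff_single_mul_apply, one_mul, neg_add_eq_sub]

/-- The fermion field `∑_c F_c φ_c` of a Laurent polynomial `F = ∑_c F_c z^c`. -/
def fermionField : LaurentPolynomial ℂ →ₗ[ℂ] (NeutralFock →L[ℂ] NeutralFock) :=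
  Finsupp.linearCombination ℂ fermionCLM ∘ₗ (AddMonoidAlgebra.coeffLinearEquiv ℂ).toLinearMap

lemma fermionField_apply (F : LaurentPolynomial ℂ) (v : NeutralFock) (S : Finset ℕ) :
    fermionField F v S = F.coeff.sum fun c x => x * neutralFermion c v S := by
  have : fermionField F = F.coeff.sum fun c x => x • fermionCLM c :=
    Finsupp.linearCombination_apply ℂ F.coeff
  simp [this, Finsupp.sum]

lemma fermionField_T (b : ℤ) (v : NeutralFock) :
    fermionField (LaurentPolynomial.T b) v = neutralFermion b v := by
  funext S
  rw [fermionField_apply, LaurentPolynomial.T, AddMonoidAlgebra.coeff_single,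
    Finsupp.sum_single_index (zero_mul _), one_mul]

/-- `∑ t_n H_(s n)` as a continuous operator: `H_+(t)` for `s = 1` and `H_-(t)` for `s = -1`. -/
def hamiltonianCLM (s : ℤ) (t : ℕ →₀ ℝ) : NeutralFock →L[ℂ] NeutralFock :=
  t.sum fun n c => (c : ℂ) • bosonCLM (s * n)

lemma hamiltonianCLM_apply {s : ℤ} (hs : s ≠ 0) {t : ℕ →₀ ℝ} (ht : ∀ n, t n ≠ 0 → Odd n)
    (v : NeutralFock) :
    hamiltonianCLM s t v = t.sum fun n c => (c : ℂ) • bosonMode (s * n) v := by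
  simp only [hamiltonianCLM, Finsupp.sum, _root_.sum_apply,
    _root_.smul_apply]
  refine Finset.sum_congr rfl fun n hn => ?_
  rw [bosonCLM_apply (mul_ne_zero hs (Nat.cast_ne_zero.2 (ht n (by simpa using hn)).pos.ne'))]

lemma hamiltonianPlus_eq {t : ℕ →₀ ℝ} (ht : ∀ n, t n ≠ 0 → Odd n) :
    hamiltonianPlus t = hamiltonianCLM 1 t := by
  funext v
  simp only [hamiltonianCLM_apply one_ne_zero ht, one_mul]
  rfl

lemma hamiltonianMinus_eq {t : ℕ →₀ ℝ} (ht : ∀ n, t n ≠ 0 → Odd n) :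
    hamiltonianMinus t = hamiltonianCLM (-1) t := by
  funext v
  simp only [hamiltonianCLM_apply (show (-1 : ℤ) ≠ 0 by decide) ht, neg_one_mul]
  rfl

/-- The commutator of a Hamiltonian with a fermion field is multiplication of the field by a Laurent
polynomial. -/
lemma hamiltonianCLM_fermionField {s : ℤ} (hs : Odd s) {t : ℕ →₀ ℝ} (ht : ∀ n, t n ≠ 0 → Odd n)
    (F : LaurentPolynomial ℂ) (v : NeutralFock) :
    hamiltonianCLM s t (fermionField F v) =
      fermionField F (hamiltonianCLM s t v) + fermionField (miwaLaurent (-s) t * F) v := by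
  have hs0 : s ≠ 0 := by rintro rfl; exact absurd hs (by decide)
  induction F using LaurentPolynomial.induction_on' with
  | add p q hp hq =>
    simp only [map_add, _root_.add_apply, mul_add, hp, hq]; abel
  | C_mul_T b x =>
    rw [← LaurentPolynomial.smul_eq_C_mul, mul_smul_comm]
    simp only [map_smul, _root_.smul_apply, fermionField_T, ← smul_add]
    congr 1
    rw [hamiltonianCLM_apply hs0 ht, hamiltonianCLM_apply hs0 ht]
    simp only [miwaLaurent, Finsupp.sum, Finset.sum_mul, map_sum, _root_.sum_apply,
      smul_mul_assoc, map_smul, _root_.smul_apply, ← LaurentPolynomial.T_add,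
      fermionField_T, ← Finset.sum_add_distrib]
    refine Finset.sum_congr rfl fun n hn => ?_
    have hn' : Odd (n : ℤ) := by exact_mod_cast ht n (by simpa using hn)
    rw [bosonMode_neutralFermion (hs.mul hn'), smul_add, show -s * n + b = b - s * n by ring]

lemma hamiltonianCLM_eq_zero_of_energy {s : ℤ} (hs : s ≠ 0) {t : ℕ →₀ ℝ}
    (ht : ∀ n, t n ≠ 0 → Odd n) {v : NeutralFock} {S : Finset ℕ}
    (h : ∀ n, t n ≠ 0 → ∀ S', fockEnergy S' = fockEnergy S + s * n → v S' = 0) :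
    hamiltonianCLM s t v S = 0 := by
  rw [hamiltonianCLM_apply hs ht, Finsupp.sum, Finset.sum_apply]
  refine Finset.sum_eq_zero fun n hn => ?_
  rw [Pi.smul_apply, bosonMode_eq_zero_of_energy (h n (by simpa using hn)), smul_zero]

/-- `H_-` raises the energy, so that a power of it contributes only to high energies. -/
lemma hamiltonianCLM_neg_pow_eq_zero {t : ℕ →₀ ℝ} (ht : ∀ n, t n ≠ 0 → Odd n) (v : NeutralFock)
    (k : ℕ) {S : Finset ℕ} (hS : fockEnergy S < k) : (hamiltonianCLM (-1) t ^ k) v S = 0 := by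
  induction k generalizing S with
  | zero => exact absurd (fockEnergy_nonneg S) (by simpa using hS)
  | succ k ih =>
    rw [pow_succ']
    refine hamiltonianCLM_eq_zero_of_energy (by decide) ht fun n hn S' hS' => ih ?_
    have := (ht n hn).pos
    push_cast at hS
    omega

/-- `H_+` annihilates the vacuum. -/
lemma hamiltonianCLM_one_vacuum {t : ℕ →₀ ℝ} (ht : ∀ n, t n ≠ 0 → Odd n) :
    hamiltonianCLM 1 t fockVacuum = 0 := by
  funext S
  refine hamiltonianCLM_eq_zero_of_energy one_ne_zero ht fun n hn S' hS' => ?_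
  refine Pi.single_eq_of_ne ?_ _
  rintro rfl
  have := (ht n hn).pos
  have := fockEnergy_nonneg S
  simp only [fockEnergy, Finset.sum_empty] at hS' this
  omega

/-- A field without modes below `c` kills all coefficients of energy below `c`. -/
lemma fermionField_eq_zero_of_energy {F : LaurentPolynomial ℂ} {c : ℤ}
    (hF : ∀ a < c, F.coeff a = 0) (v : NeutralFock) {S : Finset ℕ} (hS : fockEnergy S < c) :
    fermionField F v S = 0 := by
  rw [fermionField_apply]
  refine Finset.sum_eq_zero fun a _ => ?_
  change F.coeff a * neutralFermion a v S = 0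
  rcases lt_or_ge a c with h | h
  · rw [hF a h, zero_mul]
  · rw [neutralFermion_apply, fermionCoeff_eq_zero_of_lt (hS.trans_le h), zero_mul, mul_zero]

lemma exists_coeff_eq_zero_below (F : LaurentPolynomial ℂ) : ∃ c : ℤ, ∀ a < c, F.coeff a = 0 := by
  obtain ⟨c, hc⟩ := F.coeff.support.bddBelow
  refine ⟨c, fun a ha => ?_⟩
  by_contra h
  exact absurd (hc (by simpa using h)) (not_le.2 ha)

lemma coeff_pow_mul_eq_zero {t : ℕ →₀ ℝ} (ht : ∀ n, t n ≠ 0 → Odd n) {F : LaurentPolynomial ℂ}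
    {c : ℤ} (hF : ∀ a < c, F.coeff a = 0) (i : ℕ) :
    ∀ a < c + i, ((-miwaLaurent 1 t) ^ i * F).coeff a = 0 := by
  induction i with
  | zero => simpa using hF
  | succ i ih =>
    intro a ha
    rw [pow_succ', mul_assoc, neg_mul, AddMonoidAlgebra.coeff_neg, Finsupp.neg_apply,
      coeff_miwaLaurent_mul, neg_eq_zero]
    refine Finset.sum_eq_zero fun n hn => ?_
    have := (ht n (by simpa using hn)).pos
    change (t n : ℂ) * ((-miwaLaurent 1 t) ^ i * F).coeff (a - 1 * n) = 0
    rw [ih _ (by push_cast at ha; omega), mul_zero]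

/-! ### Exponentials -/

/-- Rearrangement of a double series along its antidiagonals. -/
lemma HasSum.of_antidiagonal {E : Type*} [AddCommMonoid E] [TopologicalSpace E] [ContinuousAdd E]
    [T3Space E] {f : ℕ × ℕ → E} (hf : Summable f) {g : ℕ → E} {w : E}
    (hg : ∀ i, HasSum (fun j => f (i, j)) (g i))
    (hw : HasSum (fun m => ∑ ij ∈ Finset.HasAntidiagonal.antidiagonal m, f ij) w) : HasSum g w := by
  have h1 := hf.hasSum.prod_fiberwise hg
  have h2 : HasSum (fun m => ∑ ij ∈ Finset.HasAntidiagonal.antidiagonal m, f ij) (∑' x, f x) := by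
    have := (Finset.HasAntidiagonal.sigmaAntidiagonalEquivProd.hasSum_iff.2 hf.hasSum).sigma
      fun m => hasSum_fintype _
    convert! this using 2 with m
    rw [← Finset.sum_finset_coe]; rfl
  rwa [h2.unique hw] at h1

/-- The Leibniz rule for the powers of an operator acting on fermion fields by multiplication
by `P`. -/
lemma pow_fermionField {X : NeutralFock →L[ℂ] NeutralFock} {P : LaurentPolynomial ℂ}
    (hX : ∀ F v, X (fermionField F v) = fermionField F (X v) + fermionField (P * F) v)
    (F : LaurentPolynomial ℂ) (v : NeutralFock) (m : ℕ) :
    (X ^ m) (fermionField F v) = ∑ ij ∈ Finset.HasAntidiagonal.antidiagonal m,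
      m.choose ij.1 • fermionField (P ^ ij.1 * F) ((X ^ ij.2) v) := by
  induction m with
  | zero => simp
  | succ m ih =>
    rw [Finset.sum_antidiagonal_choose_succ_nsmul
      fun i j => fermionField (P ^ i * F) ((X ^ j) v), pow_succ', mul_apply_eq_comp, ih]
    simp only [map_sum, map_nsmul, hX, nsmul_add, Finset.sum_add_distrib]
    congr 1
    · simp only [pow_succ' X, mul_apply_eq_comp]
    · refine Finset.sum_congr rfl fun ij hij => ?_
      rw [Nat.choose_symm_of_eq_add (Finset.HasAntidiagonal.mem_antidiagonal.1 hij).symm,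
        pow_succ' P, mul_assoc]

lemma choose_smul_eq {E : Type*} [AddCommGroup E] [Module ℂ E] {m i j : ℕ} (h : i + j = m) (v : E) :
    ((m ! : ℕ) : ℂ)⁻¹ • m.choose i • v = ((i ! : ℕ) : ℂ)⁻¹ • ((j ! : ℕ) : ℂ)⁻¹ • v := by
  subst h
  rw [← Nat.cast_smul_eq_nsmul ℂ, smul_smul, smul_smul, Nat.cast_add_choose]
  congr 1
  have := Nat.cast_ne_zero (R := ℂ).2 (i + j).factorial_ne_zero
  field_simp

lemma fockExp_apply (X : NeutralFock →L[ℂ] NeutralFock) (v : NeutralFock) (S : Finset ℕ) :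
    fockExp X v S = ∑' k : ℕ, (((k ! : ℕ) : ℂ)⁻¹ • (X ^ k) v) S := by
  simp only [fockExp, FunLike.coe_pow_eq_iterate, Pi.smul_apply, smul_eq_mul]

/-- Local nilpotency: every coefficient of `X^k v` vanishes for large `k`, uniformly in `v`. -/
def IsLocallyNilpotent (X : NeutralFock →L[ℂ] NeutralFock) : Prop :=
  ∀ S, ∃ K : ℕ, ∀ k ≥ K, ∀ v, (X ^ k) v S = 0

lemma neg_pow_clm_apply (X : NeutralFock →L[ℂ] NeutralFock) (k : ℕ) (v : NeutralFock) :
    ((-X) ^ k) v = (-1 : ℂ) ^ k • (X ^ k) v := by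
  induction k with
  | zero => simp
  | succ k ih =>
    rw [pow_succ', mul_apply_eq_comp, ih, pow_succ', pow_succ' X, mul_apply_eq_comp, map_smul]
    simp

lemma IsLocallyNilpotent.neg {X : NeutralFock →L[ℂ] NeutralFock} (hX : IsLocallyNilpotent X) :
    IsLocallyNilpotent (-X) := fun S => by
  obtain ⟨K, hK⟩ := hX S
  refine ⟨K, fun k hk v => ?_⟩
  rw [neg_pow_clm_apply, Pi.smul_apply, hK k hk v, smul_zero]

lemma IsLocallyNilpotent.hasSum_fockExp {X : NeutralFock →L[ℂ] NeutralFock}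
    (hX : IsLocallyNilpotent X) (v : NeutralFock) :
    HasSum (fun k : ℕ => ((k ! : ℕ) : ℂ)⁻¹ • (X ^ k) v) (fockExp X v) := by
  refine Pi.hasSum.2 fun S => ?_
  rw [fockExp_apply]
  obtain ⟨K, hK⟩ := hX S
  refine (summable_of_ne_finset_zero (s := Finset.range K) fun k hk => ?_).hasSum
  rw [Pi.smul_apply, hK k (by simpa using hk), smul_zero]

/-- `e^X φ(F) = φ(e^P F) e^X` for an operator `X` acting on fermion fields by multiplication
by `P`; the nilpotency conditions make all coefficients finite sums. -/
lemma fockExp_fermionField {X : NeutralFock →L[ℂ] NeutralFock} {P : LaurentPolynomial ℂ}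
    (hX : ∀ F v, X (fermionField F v) = fermionField F (X v) + fermionField (P * F) v)
    (hnil : IsLocallyNilpotent X)
    (hP : ∀ F S, ∃ I : ℕ, ∀ i ≥ I, ∀ v, fermionField (P ^ i * F) v S = 0)
    (F : LaurentPolynomial ℂ) (v : NeutralFock) :
    HasSum (fun i : ℕ => ((i ! : ℕ) : ℂ)⁻¹ • fermionField (P ^ i * F) (fockExp X v))
      (fockExp X (fermionField F v)) := by
  refine HasSum.of_antidiagonal (f := fun ij : ℕ × ℕ => ((ij.1 ! : ℕ) : ℂ)⁻¹ •
    ((ij.2 ! : ℕ) : ℂ)⁻¹ • fermionField (P ^ ij.1 * F) ((X ^ ij.2) v)) ?_ (fun i => ?_) ?_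
  · refine Pi.summable.2 fun S => ?_
    obtain ⟨I, hI⟩ := hP F S
    -- coefficients of `X^j v` that enter the `S`-coefficient of the `i`-th term
    have hfin : ∀ i, ∃ J : ℕ, ∀ j ≥ J, fermionField (P ^ i * F) ((X ^ j) v) S = 0 := by
      intro i
      choose K hK using hnil
      refine ⟨(P ^ i * F).coeff.support.sup fun c => K (toggleSite c.natAbs S), fun j hj => ?_⟩
      rw [fermionField_apply]
      refine Finset.sum_eq_zero fun c hc => ?_
      change (P ^ i * F).coeff c * neutralFermion c ((X ^ j) v) S = 0
      rw [neutralFermion_apply, hK _ j ((Finset.le_sup (f := fun c : ℤ =>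
        K (toggleSite c.natAbs S)) hc).trans hj), mul_zero, mul_zero]
    choose J hJ using hfin
    refine summable_of_ne_finset_zero
      (s := Finset.range I ×ˢ Finset.range ((Finset.range I).sup J)) fun ij hij => ?_
    rw [Finset.mem_product, Finset.mem_range, Finset.mem_range, not_and_or] at hij
    rw [Pi.smul_apply, Pi.smul_apply]
    by_cases h : ij.1 < I
    · have h2 : (Finset.range I).sup J ≤ ij.2 := by simpa using hij.resolve_left (not_not.2 h)
      rw [hJ ij.1 ij.2 ((Finset.le_sup (f := J) (Finset.mem_range.2 h)).trans h2), smul_zero,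
        smul_zero]
    · rw [hI ij.1 (not_lt.1 h), smul_zero, smul_zero]
  · simpa only [map_smul] using ((hnil.hasSum_fockExp v).mapL
      (fermionField (P ^ i * F))).const_smul ((i ! : ℕ) : ℂ)⁻¹
  · convert! hnil.hasSum_fockExp (fermionField F v) using 2 with m
    rw [pow_fermionField hX, Finset.smul_sum]
    refine Finset.sum_congr rfl fun ij hij => ?_
    rw [choose_smul_eq (Finset.HasAntidiagonal.mem_antidiagonal.1 hij)]

lemma fockExp_neg_fockExp {X : NeutralFock →L[ℂ] NeutralFock} (hnil : IsLocallyNilpotent X)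
    (v : NeutralFock) : fockExp X (fockExp (-X : NeutralFock →L[ℂ] NeutralFock) v) = v := by
  have hsum : HasSum (fun i : ℕ => ((i ! : ℕ) : ℂ)⁻¹ •
      (X ^ i) (fockExp (-X : NeutralFock →L[ℂ] NeutralFock) v)) v := by
    refine HasSum.of_antidiagonal (f := fun ij : ℕ × ℕ => ((ij.1 ! : ℕ) : ℂ)⁻¹ •
      ((ij.2 ! : ℕ) : ℂ)⁻¹ • (X ^ ij.1) (((-X) ^ ij.2) v)) ?_ (fun i => ?_) ?_
    · refine Pi.summable.2 fun S => ?_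
      obtain ⟨K, hK⟩ := hnil S
      refine summable_of_ne_finset_zero
        (s := Finset.range K ×ˢ Finset.range K) fun ij hij => ?_
      have h0 : (X ^ ij.1) (((-X) ^ ij.2) v) S = 0 := by
        rw [neg_pow_clm_apply, map_smul, ← mul_apply_eq_comp, ← pow_add, Pi.smul_apply]
        refine smul_eq_zero_of_right _ (hK _ ?_ _)
        rw [Finset.mem_product, Finset.mem_range, Finset.mem_range, not_and_or] at hij
        omega
      rw [Pi.smul_apply, Pi.smul_apply, h0, smul_zero, smul_zero]
    · simpa only [map_smul] using ((hnil.neg.hasSum_fockExp v).mapL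
        (X ^ i)).const_smul ((i ! : ℕ) : ℂ)⁻¹
    · have h1 : (fun m => ∑ ij ∈ Finset.HasAntidiagonal.antidiagonal m, ((ij.1 ! : ℕ) : ℂ)⁻¹ •
          ((ij.2 ! : ℕ) : ℂ)⁻¹ • (X ^ ij.1) (((-X) ^ ij.2) v)) = Pi.single 0 v := by
        funext m
        have : (∑ ij ∈ Finset.HasAntidiagonal.antidiagonal m, ((ij.1 ! : ℕ) : ℂ)⁻¹ •
            ((ij.2 ! : ℕ) : ℂ)⁻¹ • (X ^ ij.1) (((-X) ^ ij.2) v)) =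
            ((m ! : ℕ) : ℂ)⁻¹ • ((X + -X) ^ m) v := by
          rw [(Commute.refl X).neg_right.add_pow', _root_.sum_apply, Finset.smul_sum]
          refine Finset.sum_congr rfl fun ij hij => ?_
          rw [← choose_smul_eq (Finset.HasAntidiagonal.mem_antidiagonal.1 hij)]
          rfl
        rw [this, add_neg_cancel]
        rcases m with _ | m
        · simp
        · simp
      rw [h1]
      simpa using hasSum_single (f := (Pi.single 0 v : ℕ → NeutralFock)) 0
        fun m hm => Pi.single_eq_of_ne hm _
  exact (hnil.hasSum_fockExp _).unique hsum

/-! ### Vacuum expectation values of two fields -/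

/-- The two-point function `⟨0|φ_{-d} φ_d|0⟩`, `d ≥ 0`. -/
def vacuumWeight (d : ℕ) : ℝ := if d = 0 then 1 / 2 else (-1) ^ d

lemma abs_vacuumWeight_le (d : ℕ) : |vacuumWeight d| ≤ 1 := by
  unfold vacuumWeight
  split_ifs
  · norm_num [abs_of_pos]
  · simp

lemma neutralFermion_neutralFermion_vacuum (c d : ℤ) :
    neutralFermion c (neutralFermion d fockVacuum) ∅ =
      if c = -d ∧ 0 ≤ d then (vacuumWeight d.natAbs : ℂ) else 0 := by
  rw [neutralFermion_comp_apply]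
  have hv : ∀ S, fockVacuum S = if S = ∅ then 1 else 0 := fun S => by
    simp [fockVacuum, Pi.single_apply]
  rw [hv]
  by_cases hcd : c.natAbs = d.natAbs
  · have hS : toggleSite d.natAbs ∅ = {d.natAbs} := by simp [toggleSite_of_notMem]
    rw [hcd, toggleSite_self, if_pos rfl, mul_one, hS]
    have hw1 : wedgeSign c.natAbs ∅ = 1 := by simp [wedgeSign]
    have hw2 : wedgeSign d.natAbs {d.natAbs} = 1 := by simp [wedgeSign, Finset.filter_singleton]
    simp only [fermionCoeff, hw1, hw2, one_mul, occupationCoeff, Finset.notMem_empty, if_false,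
      Finset.mem_singleton, if_true]
    rcases lt_trichotomy d 0 with hd | rfl | hd
    · simp [hd.not_ge]
    · have hc : c = 0 := by simpa using hcd
      subst hc
      simp [vacuumWeight]
    · rcases Int.natAbs_eq_natAbs_iff.1 hcd with rfl | hc
      · rw [if_pos hd, zero_mul, if_neg (by omega)]
      · subst hc
        have hne : d.natAbs ≠ 0 := by omega
        obtain ⟨n, rfl⟩ := Int.eq_ofNat_of_zero_le hd.le
        have hn : 0 < n := by exact_mod_cast hd
        have hn' : ¬ ((n : ℤ) < 0) := by omega
        simp [hn, hn.ne', hn', vacuumWeight, ← inv_pow, inv_neg]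
  · have hS : toggleSite d.natAbs (toggleSite c.natAbs ∅) ≠ ∅ := by
      intro h
      have : d.natAbs ∈ toggleSite d.natAbs (toggleSite c.natAbs ∅) := by
        simp [mem_toggleSite, Ne.symm hcd]
      simp [h] at this
    rw [if_neg hS, if_neg (by omega), mul_zero]

/-- The vacuum expectation value of two fields, a finite sum written as a series. -/
lemma hasSum_vacuum_fields (F G : LaurentPolynomial ℂ) :
    HasSum (fun d : ℕ => (vacuumWeight d : ℂ) * F.coeff (-d) * G.coeff d)
      (fermionField F (fermionField G fockVacuum) ∅) := by
  induction F using LaurentPolynomial.induction_on' with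
  | add p q hp hq =>
    convert! hp.add hq using 1
    · funext d
      simp only [AddMonoidAlgebra.coeff_add, Finsupp.add_apply]; ring
    · simp
  | C_mul_T c x =>
    induction G using LaurentPolynomial.induction_on' with
    | add p q hp hq =>
      convert! hp.add hq using 1
      · funext d
        simp only [AddMonoidAlgebra.coeff_add, Finsupp.add_apply]; ring
      · simp
    | C_mul_T e y =>
      rw [← LaurentPolynomial.smul_eq_C_mul, ← LaurentPolynomial.smul_eq_C_mul]
      simp only [map_smul, _root_.smul_apply, fermionField_T, AddMonoidAlgebra.coeff_smul,
        Finsupp.smul_apply, LaurentPolynomial.T_apply, Pi.smul_apply,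
        neutralFermion_neutralFermion_vacuum, smul_eq_mul]
      by_cases h : c = -e ∧ 0 ≤ e
      · obtain ⟨n, rfl⟩ := Int.eq_ofNat_of_zero_le h.2
        rw [if_pos h]
        convert! hasSum_ite_eq n (y * (x * (vacuumWeight n : ℂ))) using 1
        funext d
        by_cases hd : d = n
        · simp [h.1, hd]; ring
        · simp [h.1, hd, Ne.symm hd]
      · rw [if_neg h]
        convert! hasSum_zero using 1
        · funext d
          by_cases h1 : c = -d
          · have h2 : e ≠ d := fun h2 => h ⟨by omega, by omega⟩
            simp [h2]
          · simp [h1]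
        · simp

/-! ### Summability of the expansion of the kernel -/

/-- The `ℓ¹` norm of the coefficients. -/
def coeffNorm (F : LaurentPolynomial ℂ) : ℝ := ∑' c, ‖F.coeff c‖

lemma summable_norm_coeff (F : LaurentPolynomial ℂ) : Summable fun c => ‖F.coeff c‖ :=
  summable_of_ne_finset_zero (s := F.coeff.support) fun c hc => by simpa using hc

lemma coeffNorm_nonneg (F : LaurentPolynomial ℂ) : 0 ≤ coeffNorm F :=
  tsum_nonneg fun _ => norm_nonneg _

lemma coeffNorm_neg (F : LaurentPolynomial ℂ) : coeffNorm (-F) = coeffNorm F := by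
  simp [coeffNorm]

/-- The `ℓ¹` norm of the Miwa variables. -/
def miwaNorm (t : ℕ →₀ ℝ) : ℝ := t.sum fun _ c => |c|

lemma miwaNorm_nonneg (t : ℕ →₀ ℝ) : 0 ≤ miwaNorm t := Finset.sum_nonneg fun _ _ => abs_nonneg _

lemma coeffNorm_miwaLaurent_mul (s : ℤ) (t : ℕ →₀ ℝ) (F : LaurentPolynomial ℂ) :
    coeffNorm (miwaLaurent s t * F) ≤ miwaNorm t * coeffNorm F := by
  have hsh : ∀ n : ℕ, HasSum (fun c : ℤ => |t n| * ‖F.coeff (c - s * n)‖) (|t n| * coeffNorm F) := by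
    intro n
    exact ((Equiv.subRight (s * (n : ℤ))).hasSum_iff (f := fun c => ‖F.coeff c‖)).2
      (summable_norm_coeff F).hasSum |>.mul_left _
  have hsum := hasSum_sum fun n (_ : n ∈ t.support) => hsh n
  rw [← Finset.sum_mul] at hsum
  refine hasSum_le (fun c => ?_) (summable_norm_coeff _).hasSum hsum
  rw [coeff_miwaLaurent_mul]
  refine (norm_sum_le _ _).trans (Finset.sum_le_sum fun n _ => ?_)
  simp

lemma coeffNorm_pow_mul (t : ℕ →₀ ℝ) (F : LaurentPolynomial ℂ) (k i : ℕ) :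
    coeffNorm (miwaLaurent (-1) t ^ k * ((-miwaLaurent 1 t) ^ i * F)) ≤
      miwaNorm t ^ k * (miwaNorm t ^ i * coeffNorm F) := by
  have h0 := miwaNorm_nonneg t
  have h1 : ∀ i, coeffNorm ((-miwaLaurent 1 t) ^ i * F) ≤ miwaNorm t ^ i * coeffNorm F := by
    intro i
    induction i with
    | zero => simp
    | succ i ih =>
      rw [pow_succ', mul_assoc, neg_mul, coeffNorm_neg, pow_succ', mul_assoc]
      exact (coeffNorm_miwaLaurent_mul _ _ _).trans (by gcongr)
  induction k with
  | zero => simpa using h1 i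
  | succ k ih =>
    rw [pow_succ', mul_assoc, pow_succ', mul_assoc]
    exact (coeffNorm_miwaLaurent_mul _ _ _).trans (by gcongr)

/-- The `c`-th coefficient of the term of bidegree `(k, i)` in `e^Q e^{-P} F`, where `Q` and `P`
are the Laurent polynomials by which `H_+` and `H_-` act on fields. -/
def dressedCoeff (t : ℕ →₀ ℝ) (F : LaurentPolynomial ℂ) (x : ℕ × ℕ) (c : ℤ) : ℂ :=
  ((x.1 ! : ℕ) : ℂ)⁻¹ * ((x.2 ! : ℕ) : ℂ)⁻¹ *
    (miwaLaurent (-1) t ^ x.1 * ((-miwaLaurent 1 t) ^ x.2 * F)).coeff c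

/-- A summable majorant of the terms of `e^Q e^{-P} F`. -/
def dressedBound (t : ℕ →₀ ℝ) (F : LaurentPolynomial ℂ) (x : ℕ × ℕ) : ℝ :=
  miwaNorm t ^ x.1 / (x.1 ! : ℕ) * (miwaNorm t ^ x.2 / (x.2 ! : ℕ)) * coeffNorm F

lemma summable_dressedBound (t : ℕ →₀ ℝ) (F : LaurentPolynomial ℂ) :
    Summable (dressedBound t F) := by
  refine Summable.mul_right _ ?_
  have := Real.summable_pow_div_factorial (miwaNorm t)
  exact this.mul_of_nonneg this (fun k => by have := miwaNorm_nonneg t; positivity)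
    (fun k => by have := miwaNorm_nonneg t; positivity)

lemma dressedBound_nonneg (t : ℕ →₀ ℝ) (F : LaurentPolynomial ℂ) (x : ℕ × ℕ) :
    0 ≤ dressedBound t F x := by
  have := miwaNorm_nonneg t
  have := coeffNorm_nonneg F
  unfold dressedBound; positivity

lemma norm_dressedCoeff (t : ℕ →₀ ℝ) (F : LaurentPolynomial ℂ) (x : ℕ × ℕ) (c : ℤ) :
    ‖dressedCoeff t F x c‖ = (x.1 ! : ℝ)⁻¹ * (x.2 ! : ℝ)⁻¹ *
      ‖(miwaLaurent (-1) t ^ x.1 * ((-miwaLaurent 1 t) ^ x.2 * F)).coeff c‖ := by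
  simp [dressedCoeff]

lemma summable_norm_dressedCoeff_right (t : ℕ →₀ ℝ) (F : LaurentPolynomial ℂ) (x : ℕ × ℕ) :
    Summable fun c => ‖dressedCoeff t F x c‖ := by
  simp only [norm_dressedCoeff]
  exact (summable_norm_coeff _).mul_left _

lemma tsum_norm_dressedCoeff_le (t : ℕ →₀ ℝ) (F : LaurentPolynomial ℂ) (x : ℕ × ℕ) :
    ∑' c, ‖dressedCoeff t F x c‖ ≤ dressedBound t F x := by
  simp only [norm_dressedCoeff, tsum_mul_left]
  refine (mul_le_mul_of_nonneg_left (coeffNorm_pow_mul t F x.1 x.2) (by positivity)).trans_eq ?_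
  unfold dressedBound
  ring

lemma norm_dressedCoeff_le (t : ℕ →₀ ℝ) (F : LaurentPolynomial ℂ) (x : ℕ × ℕ) (c : ℤ) :
    ‖dressedCoeff t F x c‖ ≤ dressedBound t F x :=
  ((summable_norm_dressedCoeff_right t F x).le_tsum c fun _ _ => norm_nonneg _).trans
    (tsum_norm_dressedCoeff_le t F x)

lemma summable_dressedCoeff (t : ℕ →₀ ℝ) (F : LaurentPolynomial ℂ) (c : ℤ) :
    Summable fun x => ‖dressedCoeff t F x c‖ :=
  (summable_dressedBound t F).of_nonneg_of_le (fun _ => norm_nonneg _)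
    fun x => norm_dressedCoeff_le t F x c

lemma summable_dressedCoeff_prod (t : ℕ →₀ ℝ) (F : LaurentPolynomial ℂ) :
    Summable fun y : (ℕ × ℕ) × ℤ => ‖dressedCoeff t F y.1 y.2‖ := by
  refine (summable_prod_of_nonneg fun _ => norm_nonneg _).2
    ⟨fun x => summable_norm_dressedCoeff_right t F x, ?_⟩
  exact (summable_dressedBound t F).of_nonneg_of_le (fun x => tsum_nonneg fun _ => norm_nonneg _)
    fun x => tsum_norm_dressedCoeff_le t F x

/-- The summand of the fully expanded kernel. -/
def kernelSummand (t : ℕ →₀ ℝ) (F G : LaurentPolynomial ℂ) (y : ((ℕ × ℕ) × ℕ × ℕ) × ℕ) : ℂ :=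
  (vacuumWeight y.2 : ℂ) * dressedCoeff t F y.1.1 (-y.2) * dressedCoeff t G y.1.2 y.2

lemma summable_kernelSummand (t : ℕ →₀ ℝ) (F G : LaurentPolynomial ℂ) :
    Summable (kernelSummand t F G) := by
  have h1 : Summable fun y : (ℕ × ℕ) × ℕ => ‖dressedCoeff t F y.1 (-y.2)‖ :=
    (summable_dressedCoeff_prod t F).comp_injective
      (i := fun y : (ℕ × ℕ) × ℕ => (y.1, -(y.2 : ℤ))) fun a b h => by
        simp only [Prod.mk.injEq, neg_inj, Nat.cast_inj] at h
        exact Prod.ext h.1 h.2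
  have h2 := h1.mul_of_nonneg (summable_dressedBound t G) (fun _ => norm_nonneg _)
    (dressedBound_nonneg t G)
  have h3 := h2.comp_injective (i := fun y : ((ℕ × ℕ) × ℕ × ℕ) × ℕ => ((y.1.1, y.2), y.1.2))
    fun a b h => by
      simp only [Prod.mk.injEq] at h
      exact Prod.ext (Prod.ext h.1.1 h.2) h.1.2
  refine Summable.of_norm_bounded h3 fun y => ?_
  simp only [kernelSummand, norm_mul, Complex.norm_real, Real.norm_eq_abs, Function.comp_apply]
  refine mul_le_mul ?_ (norm_dressedCoeff_le _ _ _ _) (norm_nonneg _) (norm_nonneg _)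
  exact mul_le_of_le_one_left (norm_nonneg _) (abs_vacuumWeight_le _)

/-- The term of the fully expanded kernel with bidegree `x = (k, i)` in the first and `y = (l, j)`
in the second field. -/
def multidegreeTerm (t : ℕ →₀ ℝ) (F G : LaurentPolynomial ℂ) (x y : ℕ × ℕ) : ℂ :=
  ((x.1 ! : ℕ) : ℂ)⁻¹ * ((x.2 ! : ℕ) : ℂ)⁻¹ * (((y.1 ! : ℕ) : ℂ)⁻¹ * ((y.2 ! : ℕ) : ℂ)⁻¹) *
    fermionField (miwaLaurent (-1) t ^ x.1 * ((-miwaLaurent 1 t) ^ x.2 * F))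
      (fermionField (miwaLaurent (-1) t ^ y.1 * ((-miwaLaurent 1 t) ^ y.2 * G)) fockVacuum) ∅

lemma hasSum_multidegreeTerm (t : ℕ →₀ ℝ) (F G : LaurentPolynomial ℂ) (x y : ℕ × ℕ) :
    HasSum (fun d : ℕ => kernelSummand t F G ((x, y), d)) (multidegreeTerm t F G x y) := by
  refine ((hasSum_vacuum_fields _ _).mul_left _).congr_fun fun d => ?_
  simp only [kernelSummand, dressedCoeff]
  ring

lemma HasSum.mul_of_summable_norm {ι κ : Type*} {f : ι → ℂ} {g : κ → ℂ} {x y : ℂ}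
    (hf : HasSum f x) (hg : HasSum g y) (hf' : Summable fun i => ‖f i‖)
    (hg' : Summable fun i => ‖g i‖) : HasSum (fun z : ι × κ => f z.1 * g z.2) (x * y) :=
  hf.mul hg (summable_mul_of_summable_norm hf' hg')

/-- The `c`-th coefficient of `e^Q e^{-P} F`. -/
def dressedSum (t : ℕ →₀ ℝ) (F : LaurentPolynomial ℂ) (c : ℤ) : ℂ := ∑' x, dressedCoeff t F x c

lemma hasSum_dressedSum (t : ℕ →₀ ℝ) (F : LaurentPolynomial ℂ) (c : ℤ) :
    HasSum (fun x => dressedCoeff t F x c) (dressedSum t F c) :=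
  (summable_dressedCoeff t F c).of_norm.hasSum

lemma isLocallyNilpotent_neg_hamiltonianCLM {t : ℕ →₀ ℝ} (ht : ∀ n, t n ≠ 0 → Odd n) :
    IsLocallyNilpotent (-hamiltonianCLM (-1) t) :=
  IsLocallyNilpotent.neg fun S => ⟨(fockEnergy S).toNat + 1, fun k hk v =>
    hamiltonianCLM_neg_pow_eq_zero ht v k (by
      have := fockEnergy_nonneg S
      omega)⟩

/-- `e^{-H_-} φ(F) = φ(e^{-P} F) e^{-H_-}`. -/
lemma fockExp_neg_fermionField {t : ℕ →₀ ℝ} (ht : ∀ n, t n ≠ 0 → Odd n)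
    (F : LaurentPolynomial ℂ) (v : NeutralFock) :
    HasSum (fun i : ℕ => ((i ! : ℕ) : ℂ)⁻¹ • fermionField ((-miwaLaurent 1 t) ^ i * F)
        (fockExp (-hamiltonianCLM (-1) t : NeutralFock →L[ℂ] NeutralFock) v))
      (fockExp (-hamiltonianCLM (-1) t : NeutralFock →L[ℂ] NeutralFock) (fermionField F v)) := by
  refine fockExp_fermionField (fun F v => ?_) (isLocallyNilpotent_neg_hamiltonianCLM ht)
    (fun F S => ?_) F v
  · rw [neg_apply, neg_apply, hamiltonianCLM_fermionField (by decide) ht, neg_add, neg_neg, neg_mul,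
      map_neg, map_neg, neg_apply]
  · obtain ⟨c, hc⟩ := exists_coeff_eq_zero_below F
    refine ⟨(fockEnergy S - c).toNat + 1, fun i hi v =>
      fermionField_eq_zero_of_energy (coeff_pow_mul_eq_zero ht hc i) v ?_⟩
    omega

lemma pow_hamiltonianCLM_fermionField_vacuum {t : ℕ →₀ ℝ} (ht : ∀ n, t n ≠ 0 → Odd n)
    (G : LaurentPolynomial ℂ) (l : ℕ) :
    (hamiltonianCLM 1 t ^ l) (fermionField G fockVacuum) =
      fermionField (miwaLaurent (-1) t ^ l * G) fockVacuum := by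
  induction l with
  | zero => simp
  | succ l ih =>
    rw [pow_succ', mul_apply_eq_comp, ih, hamiltonianCLM_fermionField odd_one ht,
      hamiltonianCLM_one_vacuum ht, map_zero, zero_add, pow_succ', mul_assoc]

lemma tsum_kernelSummand (t : ℕ →₀ ℝ) (F G : LaurentPolynomial ℂ) :
    ∑' y, kernelSummand t F G y =
      ∑' d : ℕ, (vacuumWeight d : ℂ) * dressedSum t F (-d) * dressedSum t G d := by
  have h1 : HasSum (fun z : ℕ × (ℕ × ℕ) × ℕ × ℕ => kernelSummand t F G (z.2, z.1))
      (∑' y, kernelSummand t F G y) :=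
    (Equiv.prodComm _ _).hasSum_iff.2 (summable_kernelSummand t F G).hasSum
  have h2 : ∀ d : ℕ, HasSum (fun x : (ℕ × ℕ) × ℕ × ℕ => kernelSummand t F G (x, d))
      ((vacuumWeight d : ℂ) * dressedSum t F (-d) * dressedSum t G d) := by
    intro d
    have h3 := ((hasSum_dressedSum t F (-d)).mul_of_summable_norm (hasSum_dressedSum t G d)
      (summable_dressedCoeff t F (-d)) (summable_dressedCoeff t G d)).mul_left (vacuumWeight d : ℂ)
    rw [mul_assoc]
    refine h3.congr_fun fun x => ?_
    rw [kernelSummand, mul_assoc]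
  exact (h1.prod_fiberwise h2).tsum_eq.symm

lemma hasSum_multidegree (t : ℕ →₀ ℝ) (F G : LaurentPolynomial ℂ) :
    HasSum (fun z : (ℕ × ℕ) × ℕ × ℕ => multidegreeTerm t F G (z.1.1, z.2.1) (z.1.2, z.2.2))
      (∑' y, kernelSummand t F G y) := by
  have h0 : ∀ z : (ℕ × ℕ) × ℕ × ℕ, HasSum (fun d : ℕ => kernelSummand t F G (z, d))
      (multidegreeTerm t F G z.1 z.2) := fun ⟨x, y⟩ => hasSum_multidegreeTerm t F G x y
  have h1 := (summable_kernelSummand t F G).hasSum.prod_fiberwise h0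
  generalize ∑' y, kernelSummand t F G y = Z at h1
  generalize multidegreeTerm t F G = D at h1
  exact (Equiv.prodProdProdComm ℕ ℕ ℕ ℕ).hasSum_iff.2 h1

/-- The expansion of `⟨0| e^{H_+} e^{-H_-} φ(F) φ(G) e^{H_-} |0⟩`.  Unlike `H_-`, the operator `H_+`
is not locally nilpotent, so `e^{H_+}` is not moved past the fields as a whole: its series is expanded
together with those of `e^{-H_-}`, and the absolute summability of all terms justifies the
rearrangement. -/
lemma vacuum_fockExp_fields {t : ℕ →₀ ℝ} (ht : ∀ n, t n ≠ 0 → Odd n)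
    (F G : LaurentPolynomial ℂ) :
    fockExp (hamiltonianCLM 1 t)
        (fockExp (-hamiltonianCLM (-1) t : NeutralFock →L[ℂ] NeutralFock)
          (fermionField F (fermionField G (fockExp (hamiltonianCLM (-1) t) fockVacuum)))) ∅ =
      ∑' d : ℕ, (vacuumWeight d : ℂ) * dressedSum t F (-d) * dressedSum t G d := by
  set Y := hamiltonianCLM 1 t with hY
  set Xn : NeutralFock →L[ℂ] NeutralFock := -hamiltonianCLM (-1) t with hXn
  set Q := miwaLaurent (-1) t with hQ
  set P := -miwaLaurent 1 t with hP
  set W := fockExp Xn (fermionField G (fockExp (hamiltonianCLM (-1) t) fockVacuum)) with hW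
  set w := fockExp Xn (fermionField F (fermionField G
    (fockExp (hamiltonianCLM (-1) t) fockVacuum))) with hw
  have hvac : fockExp Xn (fockExp (hamiltonianCLM (-1) t) fockVacuum) = fockVacuum := by
    have := fockExp_neg_fockExp (isLocallyNilpotent_neg_hamiltonianCLM ht) fockVacuum
    rwa [neg_neg] at this
  have hWs : HasSum (fun j : ℕ => ((j ! : ℕ) : ℂ)⁻¹ • fermionField (P ^ j * G) fockVacuum) W := by
    have := fockExp_neg_fermionField ht G (fockExp (hamiltonianCLM (-1) t) fockVacuum)
    rwa [hvac] at this
  have hws : HasSum (fun i : ℕ => ((i ! : ℕ) : ℂ)⁻¹ • fermionField (P ^ i * F) W) w :=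
    fockExp_neg_fermionField ht F _
  -- the term of multidegree `((k, l), (i, j))`
  let D : (ℕ × ℕ) × ℕ × ℕ → ℂ := fun z => multidegreeTerm t F G (z.1.1, z.2.1) (z.1.2, z.2.2)
  obtain ⟨Z, hD, hZ1⟩ : ∃ Z, HasSum D Z ∧
      Z = ∑' d : ℕ, (vacuumWeight d : ℂ) * dressedSum t F (-d) * dressedSum t G d :=
    ⟨_, hasSum_multidegree t F G, tsum_kernelSummand t F G⟩
  have hDs := hD.summable
  -- the `m`-th term of the outer exponential series
  have hm : ∀ m : ℕ, HasSum (fun x : ℕ × ℕ =>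
      ∑ kl ∈ Finset.HasAntidiagonal.antidiagonal m, D (kl, x))
      ((((m ! : ℕ) : ℂ)⁻¹ • (Y ^ m) w) ∅) := by
    intro m
    have hsum : Summable (fun x : ℕ × ℕ =>
        ∑ kl ∈ Finset.HasAntidiagonal.antidiagonal m, D (kl, x)) :=
      summable_sum fun kl _ => hDs.comp_injective (Prod.mk_right_injective kl)
    let L : NeutralFock →L[ℂ] ℂ :=
      ((m ! : ℕ) : ℂ)⁻¹ • ((ContinuousLinearMap.proj ∅ : NeutralFock →L[ℂ] ℂ) ∘L (Y ^ m))
    have hL : ∀ v, L v = (((m ! : ℕ) : ℂ)⁻¹ • (Y ^ m) v) ∅ := fun v => rfl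
    have hterm : ∀ i j : ℕ, ∑ kl ∈ Finset.HasAntidiagonal.antidiagonal m, D (kl, (i, j)) =
        L (((i ! : ℕ) : ℂ)⁻¹ • fermionField (P ^ i * F)
          (((j ! : ℕ) : ℂ)⁻¹ • fermionField (P ^ j * G) fockVacuum)) := by
      intro i j
      rw [map_smul, map_smul, map_smul, hL, pow_fermionField (fun F v => by
        rw [hY, hamiltonianCLM_fermionField odd_one ht]), Finset.smul_sum, Finset.sum_apply,
        Finset.smul_sum, Finset.smul_sum]
      refine Finset.sum_congr rfl fun kl hkl => ?_
      rw [choose_smul_eq (Finset.HasAntidiagonal.mem_antidiagonal.1 hkl),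
        pow_hamiltonianCLM_fermionField_vacuum ht]
      simp only [D, multidegreeTerm, Pi.smul_apply, smul_eq_mul]
      ring
    rw [← hL]
    have h1 : HasSum (fun i : ℕ => L (((i ! : ℕ) : ℂ)⁻¹ • fermionField (P ^ i * F) W)) (L w) :=
      hws.mapL L
    have h2 := hsum.hasSum.prod_fiberwise
      (g := fun i : ℕ => L (((i ! : ℕ) : ℂ)⁻¹ • fermionField (P ^ i * F) W)) fun i => by
        simp only [hterm]
        exact hWs.mapL (L ∘L (((i ! : ℕ) : ℂ)⁻¹ • fermionField (P ^ i * F)))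
    rw [h1.unique h2]
    exact hsum.hasSum
  have hfinal : HasSum (fun m : ℕ => (((m ! : ℕ) : ℂ)⁻¹ • (Y ^ m) w) ∅) Z := by
    have h1 := (Finset.HasAntidiagonal.sigmaAntidiagonalEquivProd.hasSum_iff.2
      (hD.prod_fiberwise fun x => (hDs.prod_factor x).hasSum)).sigma fun m => hasSum_fintype _
    refine h1.congr_fun fun m => ?_
    rw [← (hm m).tsum_eq, Summable.tsum_finsetSum fun kl _ => hDs.prod_factor kl,
      ← Finset.sum_finset_coe]
    rfl
  rw [fockExp_apply, hfinal.tsum_eq, hZ1]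

/-! ### Fourier coefficients -/

/-- The phase `4 ∑ t_n sin nθ`. -/
def miwaPhase (t : ℕ →₀ ℝ) (θ : ℝ) : ℝ := 4 * t.sum fun n c => c * Real.sin (n * θ)

/-- The Fourier coefficients `(1/π) ∫_0^π cos(mθ - 4 ∑ t_n sin nθ) dθ` (integer-order Bessel
functions when only `t_1` is nonzero). -/
def waveCoeff (t : ℕ →₀ ℝ) (m : ℤ) : ℝ :=
  π⁻¹ * ∫ θ in (0 : ℝ)..π, Real.cos (m * θ - miwaPhase t θ)

/-- Evaluation of a Laurent polynomial at the point `e^{iθ}` of the unit circle. -/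
def circleEval (θ : ℝ) : LaurentPolynomial ℂ →ₐ[ℂ] ℂ :=
  AddMonoidAlgebra.lift ℂ ℂ ℤ
    { toFun := fun n => Complex.exp (n.toAdd * θ * Complex.I)
      map_one' := by simp
      map_mul' := fun a b => by rw [← Complex.exp_add]; congr 1; push_cast [toAdd_mul]; ring }

lemma circleEval_T (θ : ℝ) (n : ℤ) :
    circleEval θ (LaurentPolynomial.T n) = Complex.exp (n * θ * Complex.I) := by
  rw [circleEval, LaurentPolynomial.T, AddMonoidAlgebra.lift_single, one_smul]; rfl

lemma continuous_circleEval (F : LaurentPolynomial ℂ) : Continuous fun θ => circleEval θ F := by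
  induction F using LaurentPolynomial.induction_on' with
  | add p q hp hq => simp only [map_add]; exact hp.add hq
  | C_mul_T n a =>
    simp only [← LaurentPolynomial.smul_eq_C_mul, map_smul, circleEval_T]
    fun_prop

lemma norm_circleEval_le (θ : ℝ) (F : LaurentPolynomial ℂ) : ‖circleEval θ F‖ ≤ coeffNorm F := by
  have h : circleEval θ F = F.coeff.sum fun n c => c * Complex.exp (n * θ * Complex.I) := by
    rw [circleEval, AddMonoidAlgebra.lift_apply]; rfl
  rw [h, coeffNorm, tsum_eq_sum (s := F.coeff.support) fun c hc => by simpa using hc]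
  refine (norm_sum_le _ _).trans (Finset.sum_le_sum fun n _ => ?_)
  rw [norm_mul]
  have : (n * θ * Complex.I : ℂ) = ((n * θ : ℝ) : ℂ) * Complex.I := by push_cast; ring
  rw [this, Complex.norm_exp_ofReal_mul_I, mul_one]

/-- The coefficients of a Laurent polynomial as integrals over the circle. -/
lemma coeff_eq_integral (F : LaurentPolynomial ℂ) (c : ℤ) :
    F.coeff c = (2 * π : ℂ)⁻¹ * ∫ θ in (-π)..π,
      circleEval θ F * Complex.exp (-c * θ * Complex.I) := by
  have hint : ∀ F : LaurentPolynomial ℂ, IntervalIntegrable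
      (fun θ : ℝ => circleEval θ F * Complex.exp (-c * θ * Complex.I)) volume (-π) π := fun F =>
    ((continuous_circleEval F).mul (by fun_prop)).intervalIntegrable _ _
  induction F using LaurentPolynomial.induction_on' with
  | add p q hp hq =>
    simp only [map_add, add_mul]
    rw [intervalIntegral.integral_add (hint p) (hint q), mul_add, ← hp, ← hq]; rfl
  | C_mul_T n a =>
    simp only [← LaurentPolynomial.smul_eq_C_mul, map_smul, circleEval_T, smul_eq_mul, mul_assoc,
      ← Complex.exp_add, intervalIntegral.integral_const_mul]
    rw [AddMonoidAlgebra.coeff_smul, Finsupp.smul_apply, smul_eq_mul, LaurentPolynomial.T_apply]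
    have hpi : (π : ℂ) ≠ 0 := Complex.ofReal_ne_zero.2 Real.pi_ne_zero
    by_cases h : n = c
    · subst h
      have : ∀ x : ℝ, (n * (x * Complex.I) + -n * (x * Complex.I) : ℂ) = 0 := fun x => by ring
      simp only [this, Complex.exp_zero, if_true]
      rw [intervalIntegral.integral_const]
      simp only [sub_neg_eq_add, ← two_mul, Complex.real_smul]
      push_cast
      field_simp
    · have hne : ((n - c : ℤ) : ℂ) * Complex.I ≠ 0 :=
        mul_ne_zero (Int.cast_ne_zero.2 (sub_ne_zero.2 h)) Complex.I_ne_zero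
      have : ∀ x : ℝ, (n * (x * Complex.I) + -c * (x * Complex.I) : ℂ) =
          ((n - c : ℤ) : ℂ) * Complex.I * x := fun x => by push_cast; ring
      simp only [this]
      rw [integral_exp_mul_complex hne]
      have hper : Complex.exp (((n - c : ℤ) : ℂ) * Complex.I * (π : ℝ)) =
          Complex.exp (((n - c : ℤ) : ℂ) * Complex.I * ((-π : ℝ) : ℂ)) := by
        rw [show ((n - c : ℤ) : ℂ) * Complex.I * (π : ℝ) =
          ((n - c : ℤ) : ℂ) * Complex.I * ((-π : ℝ) : ℂ) + ((n - c : ℤ) : ℂ) *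
            (2 * π * Complex.I) by push_cast; ring, Complex.exp_add,
          Complex.exp_int_mul_two_pi_mul_I, mul_one]
      rw [hper, sub_self]
      simp [h]

lemma circleEval_miwaLaurent (θ : ℝ) (s : ℤ) (t : ℕ →₀ ℝ) :
    circleEval θ (miwaLaurent s t) =
      t.sum fun n c => (c : ℂ) * Complex.exp (s * (n * θ) * Complex.I) := by
  simp only [miwaLaurent, Finsupp.sum, map_sum, map_smul, circleEval_T, smul_eq_mul]
  refine Finset.sum_congr rfl fun n _ => ?_
  congr 2; push_cast; ring

lemma circleEval_dressing (t : ℕ →₀ ℝ) (θ : ℝ) :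
    circleEval θ (miwaLaurent (-1) ((2 : ℝ) • t)) +
      circleEval θ (-miwaLaurent 1 ((2 : ℝ) • t)) = -(miwaPhase t θ : ℂ) * Complex.I := by
  rw [map_neg, circleEval_miwaLaurent, circleEval_miwaLaurent, miwaPhase,
    Finsupp.sum_smul_index' (by simp), Finsupp.sum_smul_index' (by simp)]
  simp only [Finsupp.sum]
  push_cast
  rw [← sub_eq_add_neg, ← Finset.sum_sub_distrib, Finset.mul_sum, ← Finset.sum_neg_distrib,
    Finset.sum_mul]
  refine Finset.sum_congr rfl fun n _ => ?_
  rw [Complex.sin]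
  have h1 : (-1 * (n * θ) * Complex.I : ℂ) = -(n * θ * Complex.I) := by ring
  have h2 : (1 * (n * θ) * Complex.I : ℂ) = (n * θ * Complex.I) := by ring
  have h3 : (-(n * θ) * Complex.I : ℂ) = -(n * θ * Complex.I) := by ring
  rw [h1, h2, h3]
  simp only [smul_eq_mul, Complex.ofReal_mul, Complex.ofReal_ofNat]
  linear_combination (2 * (t n : ℂ) * (Complex.exp (-(n * θ * Complex.I)) -
    Complex.exp (n * θ * Complex.I))) * Complex.I_sq

lemma continuous_miwaPhase (t : ℕ →₀ ℝ) : Continuous (miwaPhase t) := by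
  unfold miwaPhase Finsupp.sum
  fun_prop

lemma miwaPhase_neg (t : ℕ →₀ ℝ) (θ : ℝ) : miwaPhase t (-θ) = -miwaPhase t θ := by
  simp only [miwaPhase, Finsupp.sum, mul_neg, Real.sin_neg, Finset.sum_neg_distrib]

/-- As the phase is odd, the complex Fourier coefficients are real. -/
lemma integral_exp_eq_waveCoeff (t : ℕ →₀ ℝ) (m : ℤ) :
    (2 * π : ℂ)⁻¹ * ∫ θ in (-π)..π, Complex.exp ((m * θ - miwaPhase t θ : ℝ) * Complex.I) =
      (waveCoeff t m : ℂ) := by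
  have hc := continuous_miwaPhase t
  have hcont : Continuous fun θ : ℝ =>
      Complex.exp ((m * θ - miwaPhase t θ : ℝ) * Complex.I) := by fun_prop
  rw [← intervalIntegral.integral_add_adjacent_intervals (b := 0)
    (hcont.intervalIntegrable _ _) (hcont.intervalIntegrable _ _)]
  have h1 : ∫ θ in (-π)..0, Complex.exp ((m * θ - miwaPhase t θ : ℝ) * Complex.I) =
      ∫ θ in (0 : ℝ)..π, Complex.exp (-(m * θ - miwaPhase t θ : ℝ) * Complex.I) := by
    rw [← neg_zero, ← intervalIntegral.integral_comp_neg]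
    simp only [neg_zero, miwaPhase_neg]
    refine intervalIntegral.integral_congr fun θ _ => ?_
    congr 2; push_cast; ring
  rw [h1, ← intervalIntegral.integral_add (by
    refine Continuous.intervalIntegrable ?_ _ _; fun_prop) (hcont.intervalIntegrable _ _)]
  have h2 : ∀ θ : ℝ, Complex.exp (-(m * θ - miwaPhase t θ : ℝ) * Complex.I) +
      Complex.exp ((m * θ - miwaPhase t θ : ℝ) * Complex.I) =
      ((2 * Real.cos (m * θ - miwaPhase t θ) : ℝ) : ℂ) := fun θ => by
    rw [Complex.ofReal_mul, Complex.ofReal_cos, Complex.cos]; push_cast; ring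
  simp only [h2]
  rw [intervalIntegral.integral_ofReal, intervalIntegral.integral_const_mul, waveCoeff]
  have hpi : (π : ℂ) ≠ 0 := Complex.ofReal_ne_zero.2 Real.pi_ne_zero
  push_cast
  field_simp

lemma hasSum_exp_mul (x y z : ℂ) : HasSum (fun k : ℕ × ℕ =>
    (((k.1 ! : ℕ) : ℂ)⁻¹ * ((k.2 ! : ℕ) : ℂ)⁻¹) * (x ^ k.1 * y ^ k.2 * z))
    (Complex.exp (x + y) * z) := by
  have hexp : ∀ z : ℂ, HasSum (fun k : ℕ => ((k ! : ℕ) : ℂ)⁻¹ * z ^ k) (Complex.exp z) := by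
    intro z
    rw [Complex.exp_eq_exp_ℂ]
    refine (NormedSpace.expSeries_div_hasSum_exp z).congr_fun fun k => ?_
    rw [div_eq_inv_mul]
  have hn : ∀ z : ℂ, Summable fun k : ℕ => ‖((k ! : ℕ) : ℂ)⁻¹ * z ^ k‖ := by
    intro z
    refine (Real.summable_pow_div_factorial ‖z‖).congr fun k => ?_
    rw [norm_mul, norm_inv, norm_pow, Complex.norm_natCast, div_eq_inv_mul]
  rw [Complex.exp_add]
  refine (((hexp x).mul_of_summable_norm (hexp y) (hn x) (hn y)).mul_right z).congr_fun fun k => ?_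
  ring

/-- The coefficients of `e^Q e^{-P} z^a` are Fourier coefficients; the variables are doubled as in
the definition of the kernel. -/
lemma dressedSum_T (t : ℕ →₀ ℝ) (a c : ℤ) :
    dressedSum ((2 : ℝ) • t) (LaurentPolynomial.T a) c = (waveCoeff t (a - c) : ℂ) := by
  set τ := (2 : ℝ) • t with hτ
  set F : LaurentPolynomial ℂ := LaurentPolynomial.T a with hF
  rw [← integral_exp_eq_waveCoeff]
  refine (hasSum_dressedSum τ F c).unique ?_
  have key : HasSum (fun x : ℕ × ℕ => ∫ θ in (-π)..π, (((x.1 ! : ℕ) : ℂ)⁻¹ *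
      ((x.2 ! : ℕ) : ℂ)⁻¹) * (circleEval θ (miwaLaurent (-1) τ ^ x.1 *
        ((-miwaLaurent 1 τ) ^ x.2 * F)) * Complex.exp (-c * θ * Complex.I)))
      (∫ θ in (-π)..π, Complex.exp (((a - c : ℤ) * θ - miwaPhase t θ : ℝ) * Complex.I)) := by
    refine intervalIntegral.hasSum_integral_of_dominated_convergence
      (fun x _ => dressedBound τ F x) (fun x => ?_) (fun x => ?_) ?_ ?_ ?_
    · exact (continuous_const.mul ((continuous_circleEval _).mul (by fun_prop))).aestronglyMeasurable
    · refine Filter.Eventually.of_forall fun θ _ => ?_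
      have he : ‖Complex.exp (-c * θ * Complex.I)‖ = 1 := by
        rw [show (-c * θ * Complex.I : ℂ) = ((-c * θ : ℝ) : ℂ) * Complex.I by push_cast; ring,
          Complex.norm_exp_ofReal_mul_I]
      rw [norm_mul, norm_mul _ (Complex.exp _), he, mul_one]
      refine (mul_le_mul_of_nonneg_left ((norm_circleEval_le _ _).trans
        (coeffNorm_pow_mul τ F x.1 x.2)) (norm_nonneg _)).trans_eq ?_
      simp only [dressedBound, norm_mul, norm_inv, Complex.norm_natCast]
      ring
    · exact Filter.Eventually.of_forall fun θ _ => summable_dressedBound τ F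
    · exact intervalIntegrable_const
    · refine Filter.Eventually.of_forall fun θ _ => ?_
      have h := hasSum_exp_mul (circleEval θ (miwaLaurent (-1) τ))
        (circleEval θ (-miwaLaurent 1 τ)) (circleEval θ F * Complex.exp (-c * θ * Complex.I))
      rw [circleEval_dressing, hF, circleEval_T, ← Complex.exp_add, ← Complex.exp_add] at h
      rw [show (((a - c : ℤ) * θ - miwaPhase t θ : ℝ) * Complex.I : ℂ) =
        -(miwaPhase t θ : ℂ) * Complex.I + (a * θ * Complex.I + -c * θ * Complex.I) by
          push_cast; ring]
      refine h.congr_fun fun x => ?_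
      rw [map_mul, map_mul, map_pow, map_pow, Complex.exp_add, hF, circleEval_T]
      ring
  refine (key.mul_left (2 * π : ℂ)⁻¹).congr_fun fun x => ?_
  rw [intervalIntegral.integral_const_mul, dressedCoeff, coeff_eq_integral]
  ring

/-! ### The kernel as a series of Fourier coefficients -/

/-- The kernel as a series of products of Fourier coefficients.  The rightmost factor
`e^{-H_+(2t)}` of its definition plays no role, since `H_+` annihilates the vacuum. -/
lemma shiftedSchurKernel_eq {t : ℕ →₀ ℝ} (ht : ∀ n, t n ≠ 0 → Odd n) (a b : ℤ) :
    shiftedSchurKernel t a b =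
      ∑' d : ℕ, ((vacuumWeight d * waveCoeff t (a + d) * waveCoeff t (b - d) : ℝ) : ℂ) := by
  have ht2 : ∀ n, ((2 : ℝ) • t) n ≠ 0 → Odd n := fun n hn => ht n fun h => hn (by simp [h])
  have h := vacuum_fockExp_fields ht2 (LaurentPolynomial.T a) (LaurentPolynomial.T b)
  have hplus : fockExp (fun v => -hamiltonianPlus ((2 : ℝ) • t) v) fockVacuum = fockVacuum := by
    have h1 : (fun v => -hamiltonianPlus ((2 : ℝ) • t) v) =
        (-hamiltonianCLM 1 ((2 : ℝ) • t) : NeutralFock →L[ℂ] NeutralFock) := by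
      rw [hamiltonianPlus_eq ht2]; rfl
    funext S
    rw [h1, fockExp_apply, tsum_eq_single 0]
    · simp
    · intro k hk
      obtain ⟨k, rfl⟩ := Nat.exists_eq_succ_of_ne_zero hk
      rw [pow_succ, mul_apply_eq_comp, neg_apply, hamiltonianCLM_one_vacuum ht2,
        neg_zero, map_zero, smul_zero]
      rfl
  unfold shiftedSchurKernel vacuumPairing
  rw [hplus, hamiltonianPlus_eq ht2, hamiltonianMinus_eq ht2, ← fermionField_T, ← fermionField_T]
  refine Eq.trans h (tsum_congr fun d => ?_)
  rw [dressedSum_T, dressedSum_T]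
  push_cast
  rw [sub_neg_eq_add]

/-! ### The recurrence of the Fourier coefficients and its consequence for the kernel -/

lemma summable_abs_waveCoeff (t : ℕ →₀ ℝ) : Summable fun m : ℤ => |waveCoeff t m| := by
  have h : Summable fun c : ℤ => ‖dressedSum ((2 : ℝ) • t) (LaurentPolynomial.T 0) c‖ := by
    have h1 := summable_dressedCoeff_prod ((2 : ℝ) • t) (LaurentPolynomial.T 0)
    have h2 := ((Equiv.prodComm ℤ (ℕ × ℕ)).summable_iff.2 h1).prod
    refine h2.of_nonneg_of_le (fun _ => norm_nonneg _) fun c => ?_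
    exact norm_tsum_le_tsum_norm (summable_dressedCoeff ((2 : ℝ) • t) (LaurentPolynomial.T 0) c)
  refine ((Equiv.neg ℤ).summable_iff.1 ?_)
  refine h.congr fun c => ?_
  rw [dressedSum_T, zero_sub, Complex.norm_real, Real.norm_eq_abs]; rfl

lemma abs_waveCoeff_le (t : ℕ →₀ ℝ) (m : ℤ) : |waveCoeff t m| ≤ 1 := by
  unfold waveCoeff
  have h := intervalIntegral.norm_integral_le_of_norm_le_const (a := 0) (b := π) (C := 1)
    (f := fun θ => Real.cos (m * θ - miwaPhase t θ)) fun θ _ => Real.abs_cos_le_one _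
  rw [Real.norm_eq_abs, one_mul, sub_zero, abs_of_pos Real.pi_pos] at h
  rw [abs_mul, abs_inv, abs_of_pos Real.pi_pos, inv_mul_le_iff₀ Real.pi_pos, mul_one]
  exact h

lemma summable_waveCoeff_mul (t : ℕ →₀ ℝ) (a b : ℤ) :
    Summable fun d : ℕ => (-1) ^ d * waveCoeff t (a + d) * waveCoeff t (b - d) := by
  have hw := summable_abs_waveCoeff t
  have hle := abs_waveCoeff_le t
  generalize waveCoeff t = w at hw hle
  have h1 : Summable fun d : ℕ => |w (a + d)| :=
    hw.comp_injective (i := fun d : ℕ => a + (d : ℤ)) fun x y h => by simpa using h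
  refine Summable.of_norm_bounded h1 fun d => ?_
  rw [norm_mul, norm_mul, norm_pow, norm_neg, norm_one, one_pow, one_mul]
  exact mul_le_of_le_one_right (norm_nonneg _) (hle _)

lemma sin_odd_mul_pi_sub {n : ℕ} (hn : Odd n) (θ : ℝ) :
    Real.sin (n * (π - θ)) = Real.sin (n * θ) := by
  rw [mul_sub, Real.sin_sub, Real.sin_nat_mul_pi, Real.cos_nat_mul_pi, hn.neg_one_pow]
  ring

lemma miwaPhase_pi_sub {t : ℕ →₀ ℝ} (ht : ∀ n, t n ≠ 0 → Odd n) (θ : ℝ) :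
    miwaPhase t (π - θ) = miwaPhase t θ := by
  unfold miwaPhase Finsupp.sum
  congr 1
  refine Finset.sum_congr rfl fun n hn => ?_
  exact congrArg (t n * ·) (sin_odd_mul_pi_sub (ht n (by simpa using hn)) θ)

lemma miwaPhase_zero (t : ℕ →₀ ℝ) : miwaPhase t 0 = 0 := by
  simp [miwaPhase]

/-- `j_{-m} = (-1)^m j_m`, by the substitution `θ ↦ π - θ`, under which `sin nθ` is invariant for
odd `n`. -/
lemma waveCoeff_neg {t : ℕ →₀ ℝ} (ht : ∀ n, t n ≠ 0 → Odd n) (m : ℤ) :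
    waveCoeff t (-m) = (-1) ^ m * waveCoeff t m := by
  unfold waveCoeff
  have h := intervalIntegral.integral_comp_sub_left (a := 0) (b := π)
    (fun θ => Real.cos (((-m : ℤ) : ℝ) * θ - miwaPhase t θ)) π
  rw [sub_self, sub_zero] at h
  have h2 : ∀ θ : ℝ, Real.cos (((-m : ℤ) : ℝ) * (π - θ) - miwaPhase t (π - θ)) =
      (-1) ^ m * Real.cos (m * θ - miwaPhase t θ) := ?_
  · simp only [h2, intervalIntegral.integral_const_mul] at h
    rw [← h]; ring
  intro θ
  rw [miwaPhase_pi_sub ht, show (((-m : ℤ) : ℝ) * (π - θ) - miwaPhase t θ) =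
    (m * θ - miwaPhase t θ) + ((-m : ℤ) : ℝ) * π by push_cast; ring, Real.cos_add_int_mul_pi]
  congr 1
  rw [zpow_neg, ← inv_zpow]; norm_num

/-- The derivative of the phase. -/
def miwaPhaseDeriv (t : ℕ →₀ ℝ) (θ : ℝ) : ℝ := 4 * t.sum fun n c => c * (n * Real.cos (n * θ))

lemma hasDerivAt_miwaPhase (t : ℕ →₀ ℝ) (θ : ℝ) :
    HasDerivAt (miwaPhase t) (miwaPhaseDeriv t θ) θ := by
  unfold miwaPhaseDeriv
  have h : HasDerivAt (fun θ => t.sum fun n c => c * Real.sin (n * θ))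
      (t.sum fun n c => c * (n * Real.cos (n * θ))) θ := by
    simp only [Finsupp.sum]
    refine HasDerivAt.fun_sum fun n _ => ?_
    have h1 : HasDerivAt (fun θ : ℝ => (n : ℝ) * θ) n θ := by
      simpa using (hasDerivAt_id θ).const_mul (n : ℝ)
    exact (h1.sin.congr_deriv (mul_comm _ _)).const_mul _
  exact h.const_mul 4

lemma continuous_miwaPhaseDeriv (t : ℕ →₀ ℝ) : Continuous (miwaPhaseDeriv t) := by
  unfold miwaPhaseDeriv Finsupp.sum
  fun_prop

/-- `m j_m = ∑ 2n t_n (j_{m-n} + j_{m+n})`. -/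
lemma waveCoeff_recurrence {t : ℕ →₀ ℝ} (ht : ∀ n, t n ≠ 0 → Odd n) (m : ℤ) :
    m * waveCoeff t m =
      t.sum fun n c => 2 * n * c * (waveCoeff t (m - n) + waveCoeff t (m + n)) := by
  have hc := continuous_miwaPhase t
  have hcd := continuous_miwaPhaseDeriv t
  have hint : ∫ θ in (0 : ℝ)..π,
      Real.cos (m * θ - miwaPhase t θ) * (m - miwaPhaseDeriv t θ) = 0 := by
    rw [intervalIntegral.integral_eq_sub_of_hasDerivAt
      (f := fun θ => Real.sin (m * θ - miwaPhase t θ))]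
    · have := miwaPhase_pi_sub ht 0
      rw [sub_zero, miwaPhase_zero] at this
      rw [this, miwaPhase_zero]; simp [Real.sin_int_mul_pi]
    · intro θ _
      have h1 : HasDerivAt (fun θ : ℝ => (m : ℝ) * θ) m θ := by
        simpa using (hasDerivAt_id θ).const_mul (m : ℝ)
      exact (h1.sub (hasDerivAt_miwaPhase t θ)).sin
    · exact Continuous.intervalIntegrable (by fun_prop) _ _
  have hexp : ∀ θ : ℝ, Real.cos (m * θ - miwaPhase t θ) * (m - miwaPhaseDeriv t θ) =
      m * Real.cos (m * θ - miwaPhase t θ) - ∑ n ∈ t.support, 2 * n * t n *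
        (Real.cos (((m - n : ℤ) : ℝ) * θ - miwaPhase t θ) +
          Real.cos (((m + n : ℤ) : ℝ) * θ - miwaPhase t θ)) := by
    intro θ
    rw [miwaPhaseDeriv, Finsupp.sum, mul_sub, Finset.mul_sum, Finset.mul_sum, mul_comm]
    congr 1
    refine Finset.sum_congr rfl fun n _ => ?_
    rw [show (((m - n : ℤ) : ℝ) * θ - miwaPhase t θ) = (m * θ - miwaPhase t θ) - n * θ by
      push_cast; ring, show (((m + n : ℤ) : ℝ) * θ - miwaPhase t θ) =
      (m * θ - miwaPhase t θ) + n * θ by push_cast; ring]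
    generalize (m : ℝ) * θ - miwaPhase t θ = u
    rw [Real.cos_sub, Real.cos_add]
    ring
  simp only [hexp] at hint
  have hi : ∀ k : ℤ, IntervalIntegrable (fun θ => Real.cos ((k : ℝ) * θ - miwaPhase t θ))
      volume 0 π := fun k => Continuous.intervalIntegrable (by fun_prop) _ _
  rw [intervalIntegral.integral_sub ((hi m).const_mul _)
    (Continuous.intervalIntegrable (by fun_prop) _ _),
    intervalIntegral.integral_const_mul,
    intervalIntegral.integral_finsetSum fun n _ => ((hi _).add (hi _)).const_mul _] at hint
  simp only [intervalIntegral.integral_const_mul, intervalIntegral.integral_add (hi _) (hi _)]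
    at hint
  simp only [waveCoeff, Finsupp.sum]
  rw [mul_left_comm, sub_eq_zero.1 hint, Finset.mul_sum]
  refine Finset.sum_congr rfl fun n _ => ?_
  ring

/-- The alternating series `∑_{d ≥ 0} (-1)^d j_{a+d} j_{b-d}`. -/
def alternatingSum (t : ℕ →₀ ℝ) (a b : ℤ) : ℝ :=
  ∑' d : ℕ, (-1) ^ d * waveCoeff t (a + d) * waveCoeff t (b - d)

lemma sum_range_eq_tsum_sub {f : ℕ → ℝ} (hf : Summable f) (n : ℕ) :
    ∑' d, f d - ∑' d, f (d + n) = ∑ i ∈ Finset.range n, f i := by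
  rw [← hf.sum_add_tsum_nat_add n]; ring

/-- Since `(a+d) + (b-d)` does not depend on `d` and only odd `n` occur, the recurrence makes
`(a+b) ∑ (-1)^d j_{a+d} j_{b-d}` telescope. -/
lemma add_mul_alternatingSum {t : ℕ →₀ ℝ} (ht : ∀ n, t n ≠ 0 → Odd n) (a b : ℤ) :
    (a + b) * alternatingSum t a b = t.sum fun n c => 2 * n * c * ∑ i ∈ Finset.range n,
      ((-1) ^ i * waveCoeff t (a - n + i) * waveCoeff t (b - i) +
        (-1) ^ i * waveCoeff t (a + i) * waveCoeff t (b + n - i)) := by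
  have hterm : ∀ d : ℕ, ((a : ℝ) + b) * ((-1) ^ d * waveCoeff t (a + d) * waveCoeff t (b - d)) =
      ∑ n ∈ t.support, 2 * n * t n *
        (((-1) ^ d * waveCoeff t (a - n + d) * waveCoeff t (b - d) -
          (-1) ^ (d + n) * waveCoeff t (a - n + (d + n : ℕ)) * waveCoeff t (b - (d + n : ℕ))) +
        ((-1) ^ d * waveCoeff t (a + d) * waveCoeff t (b + n - d) -
          (-1) ^ (d + n) * waveCoeff t (a + (d + n : ℕ)) * waveCoeff t (b + n - (d + n : ℕ)))) := by
    intro d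
    have h1 := waveCoeff_recurrence ht (a + d)
    have h2 := waveCoeff_recurrence ht (b - d)
    have h3 : ((a : ℝ) + b) * ((-1) ^ d * waveCoeff t (a + d) * waveCoeff t (b - d)) =
        (-1) ^ d * ((((a + d : ℤ) : ℝ) * waveCoeff t (a + d)) * waveCoeff t (b - d) +
          waveCoeff t (a + d) * (((b - d : ℤ) : ℝ) * waveCoeff t (b - d))) := by
      push_cast; ring
    rw [h3, h1, h2]
    simp only [Finsupp.sum]
    rw [Finset.sum_mul, Finset.mul_sum (a := waveCoeff t (a + d)), ← Finset.sum_add_distrib,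
      Finset.mul_sum]
    refine Finset.sum_congr rfl fun n hn => ?_
    have hodd : ((-1 : ℝ)) ^ n = -1 := (ht n (by simpa using hn)).neg_one_pow
    rw [pow_add, hodd]
    push_cast
    rw [show a - n + d = a + d - n by ring, show a - n + (d + n) = a + (d : ℤ) by ring,
      show b + n - d = b - d + n by ring, show b + n - (d + n) = b - (d : ℤ) by ring,
      show b - (d + n) = b - d - (n : ℤ) by ring, show a + (d + n) = a + d + (n : ℤ) by ring]
    ring
  rw [alternatingSum, ← tsum_mul_left, tsum_congr hterm]
  have hs1 : ∀ n : ℕ, Summable fun d : ℕ =>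
      (-1) ^ d * waveCoeff t (a - n + d) * waveCoeff t (b - d) := fun n =>
    summable_waveCoeff_mul t (a - n) b
  have hs2 : ∀ n : ℕ, Summable fun d : ℕ =>
      (-1) ^ d * waveCoeff t (a + d) * waveCoeff t (b + n - d) := fun n =>
    summable_waveCoeff_mul t a (b + n)
  have hs1' := fun n : ℕ => (summable_nat_add_iff n).2 (hs1 n)
  have hs2' := fun n : ℕ => (summable_nat_add_iff n).2 (hs2 n)
  rw [Summable.tsum_finsetSum fun n _ =>
    (((hs1 n).sub (hs1' n)).add ((hs2 n).sub (hs2' n))).mul_left _]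
  refine Finset.sum_congr rfl fun n _ => ?_
  rw [tsum_mul_left, Summable.tsum_add ((hs1 n).sub (hs1' n)) ((hs2 n).sub (hs2' n)),
    Summable.tsum_sub (hs1 n) (hs1' n), Summable.tsum_sub (hs2 n) (hs2' n),
    sum_range_eq_tsum_sub (hs1 n), sum_range_eq_tsum_sub (hs2 n)]
  simp only [Finset.sum_add_distrib]

/-- The moment `∑ n^2 |t_n|`. -/
def miwaMoment (t : ℕ →₀ ℝ) : ℝ := t.sum fun n c => (n : ℝ) ^ 2 * |c|

/-- The alternating series is quadratically small if the Fourier coefficients near `a` and `b` are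
small. -/
lemma abs_add_mul_alternatingSum_le {t : ℕ →₀ ℝ} (ht : ∀ n, t n ≠ 0 → Odd n) {a b : ℤ} {η : ℝ}
    {N : ℕ} (hN : ∀ n, t n ≠ 0 → n ≤ N)
    (hη : ∀ i : ℤ, |i| ≤ N → |waveCoeff t (a + i)| ≤ η ∧ |waveCoeff t (b + i)| ≤ η) :
    |(a : ℝ) + b| * |alternatingSum t a b| ≤ 4 * miwaMoment t * η ^ 2 := by
  have hη0 : 0 ≤ η := (abs_nonneg _).trans (hη 0 (by simp)).1
  rw [← abs_mul, add_mul_alternatingSum ht, miwaMoment, Finsupp.sum, Finsupp.sum, Finset.mul_sum,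
    Finset.sum_mul]
  refine (Finset.abs_sum_le_sum_abs _ _).trans (Finset.sum_le_sum fun n hn => ?_)
  have hnN := hN n (by simpa using hn)
  rw [abs_mul, abs_mul, abs_mul, abs_of_nonneg (by positivity : (0 : ℝ) ≤ 2),
    abs_of_nonneg (by positivity : (0 : ℝ) ≤ n)]
  have hsum : |∑ i ∈ Finset.range n,
      ((-1) ^ i * waveCoeff t (a - n + i) * waveCoeff t (b - i) +
        (-1) ^ i * waveCoeff t (a + i) * waveCoeff t (b + n - i))| ≤ n * (2 * η ^ 2) := by
    refine (Finset.abs_sum_le_sum_abs _ _).trans ?_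
    refine (Finset.sum_le_card_nsmul _ _ (2 * η ^ 2) fun i hi => ?_).trans_eq (by simp)
    have hi' := Finset.mem_range.1 hi
    have e1 := (hη (i - n) (abs_le.2 ⟨by omega, by omega⟩)).1
    have e2 := (hη (-i) (abs_le.2 ⟨by omega, by omega⟩)).2
    have e3 := (hη i (abs_le.2 ⟨by omega, by omega⟩)).1
    have e4 := (hη (n - i) (abs_le.2 ⟨by omega, by omega⟩)).2
    rw [show a + (i - n) = a - n + (i : ℤ) by ring] at e1
    rw [show b + (n - i) = b + n - (i : ℤ) by ring] at e4
    refine (abs_add_le _ _).trans ?_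
    simp only [abs_mul, abs_pow, abs_neg, abs_one, one_pow, one_mul]
    have f1 := mul_le_mul e1 e2 (abs_nonneg _) hη0
    have f2 := mul_le_mul e3 e4 (abs_nonneg _) hη0
    rw [← sub_eq_add_neg] at f1
    linarith [sq η]
  refine (mul_le_mul_of_nonneg_left hsum (by positivity)).trans_eq ?_
  ring

lemma shiftedSchurKernel_eq_alternatingSum {t : ℕ →₀ ℝ} (ht : ∀ n, t n ≠ 0 → Odd n) (a b : ℤ) :
    shiftedSchurKernel t a b =
      ((alternatingSum t a b - 1 / 2 * (waveCoeff t a * waveCoeff t b) : ℝ) : ℂ) := by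
  rw [shiftedSchurKernel_eq ht, ← Complex.ofReal_tsum]
  congr 1
  have hs := summable_waveCoeff_mul t a b
  have h1 : HasSum (fun d : ℕ => if d = 0 then 1 / 2 * (waveCoeff t a * waveCoeff t b) else 0)
      (1 / 2 * (waveCoeff t a * waveCoeff t b)) := hasSum_ite_eq 0 _
  refine ((hs.hasSum.sub h1).congr_fun fun d => ?_).tsum_eq
  unfold vacuumWeight
  split_ifs with hd
  · subst hd; simp; ring
  · ring

lemma zpow_neg_one_mul_self (a : ℤ) : (-1 : ℝ) ^ a * (-1) ^ a = 1 := by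
  rw [← mul_zpow]; norm_num

/-- The diagonal block of the kernel. -/
lemma zpow_mul_shiftedSchurKernel_neg {t : ℕ →₀ ℝ} (ht : ∀ n, t n ≠ 0 → Odd n) (a b : ℤ) :
    (-1 : ℂ) ^ b * shiftedSchurKernel t a (-b) =
      ((∑' d : ℕ, waveCoeff t (a + d) * waveCoeff t (b + d) -
        1 / 2 * (waveCoeff t a * waveCoeff t b) : ℝ) : ℂ) := by
  rw [shiftedSchurKernel_eq_alternatingSum ht, waveCoeff_neg ht, alternatingSum]
  rw [show (-1 : ℂ) ^ b = (((-1 : ℝ) ^ b : ℝ) : ℂ) by push_cast; rfl, ← Complex.ofReal_mul, mul_sub,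
    ← tsum_mul_left]
  have h := zpow_neg_one_mul_self b
  congr 2
  · refine tsum_congr fun d => ?_
    rw [show -b - (d : ℤ) = -(b + d) by ring, waveCoeff_neg ht, zpow_add₀ (by norm_num),
      zpow_natCast]
    have h2 : (-1 : ℝ) ^ d * (-1) ^ d = 1 := by rw [← mul_pow]; norm_num
    linear_combination (waveCoeff t (a + d) * waveCoeff t (b + d)) *
      ((-1 : ℝ) ^ d * (-1) ^ d * h + h2)
  · linear_combination (1 / 2 * waveCoeff t a * waveCoeff t b) * h

/-- The two off-diagonal blocks of the kernel are transposes of each other. -/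
lemma zpow_mul_shiftedSchurKernel_neg_neg {t : ℕ →₀ ℝ} (ht : ∀ n, t n ≠ 0 → Odd n) (a b : ℤ) :
    (-1 : ℂ) ^ (a + b) * shiftedSchurKernel t (-a) (-b) = shiftedSchurKernel t b a := by
  rw [shiftedSchurKernel_eq_alternatingSum ht, shiftedSchurKernel_eq_alternatingSum ht,
    waveCoeff_neg ht, waveCoeff_neg ht, alternatingSum, alternatingSum]
  rw [show (-1 : ℂ) ^ (a + b) = (((-1 : ℝ) ^ (a + b) : ℝ) : ℂ) by push_cast; rfl,
    ← Complex.ofReal_mul, mul_sub, ← tsum_mul_left, zpow_add₀ (by norm_num)]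
  have h := zpow_neg_one_mul_self b
  have h' := zpow_neg_one_mul_self a
  congr 2
  · refine tsum_congr fun d => ?_
    rw [show -b - (d : ℤ) = -(b + d) by ring, show -a + (d : ℤ) = -(a - d) by ring,
      waveCoeff_neg ht, waveCoeff_neg ht, zpow_add₀ (by norm_num), zpow_sub₀ (by norm_num),
      zpow_natCast]
    have h3 : (-1 : ℝ) ^ d ≠ 0 := pow_ne_zero _ (by norm_num)
    field_simp
    linear_combination (waveCoeff t (a - d) * waveCoeff t (b + d)) *
      ((-1 : ℝ) ^ a * (-1) ^ a * h + h')
  · linear_combination (1 / 2 * waveCoeff t a * waveCoeff t b) *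
      ((-1 : ℝ) ^ a * (-1) ^ a * h + h')

/-! ### Oscillatory integrals -/

/-- The first derivative test for `∫ cos ψ` with `ψ' ≥ L > 0` increasing. -/
lemma abs_integral_cos_le {ψ ψ' ψ'' : ℝ → ℝ} {α β L : ℝ} (hαβ : α ≤ β) (hL : 0 < L)
    (h1 : ∀ s ∈ Set.Icc α β, HasDerivAt ψ (ψ' s) s)
    (h2 : ∀ s ∈ Set.Icc α β, HasDerivAt ψ' (ψ'' s) s)
    (hψ' : ∀ s ∈ Set.Icc α β, L ≤ ψ' s) (hψ'' : ∀ s ∈ Set.Icc α β, 0 ≤ ψ'' s) :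
    |∫ s in α..β, Real.cos (ψ s)| ≤ 2 / L := by
  have hpos : ∀ s ∈ Set.Icc α β, 0 < ψ' s := fun s hs => hL.trans_le (hψ' s hs)
  have hψc : ContinuousOn ψ (Set.Icc α β) := fun s hs => (h1 s hs).continuousAt.continuousWithinAt
  have hint : IntegrableOn (fun s => Real.cos (ψ s)) (Set.Icc α β) :=
    (Real.continuous_cos.comp_continuousOn hψc).integrableOn_Icc
  -- comparison of `cos ψ` with the derivative of `(sin ψ + e) / ψ'`, `e = ±1`
  have hder : ∀ e : ℝ, ∀ s ∈ Set.Icc α β, HasDerivAt (fun s => (Real.sin (ψ s) + e) / ψ' s)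
      (Real.cos (ψ s) - (Real.sin (ψ s) + e) * ψ'' s / ψ' s ^ 2) s := by
    intro e s hs
    have hne := (hpos s hs).ne'
    refine (((h1 s hs).sin.add_const e).div (h2 s hs) hne).congr_deriv ?_
    field_simp
  have hcont : ∀ e : ℝ, ContinuousOn (fun s => (Real.sin (ψ s) + e) / ψ' s) (Set.Icc α β) :=
    fun e s hs => (hder e s hs).continuousAt.continuousWithinAt
  have hα : α ∈ Set.Icc α β := ⟨le_rfl, hαβ⟩
  have hβ : β ∈ Set.Icc α β := ⟨hαβ, le_rfl⟩
  have hsub : ∀ s ∈ Set.Ioo α β, s ∈ Set.Icc α β := fun s hs => ⟨hs.1.le, hs.2.le⟩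
  have upper := intervalIntegral.integral_le_sub_of_hasDeriv_right_of_le hαβ (hcont (-1))
    (fun s hs => (hder (-1) s (hsub s hs)).hasDerivWithinAt) hint fun s hs => by
      have h0 := hψ'' s (hsub s hs)
      have h3 : 0 ≤ (1 - Real.sin (ψ s)) * ψ'' s / ψ' s ^ 2 :=
        div_nonneg (mul_nonneg (by linarith [Real.sin_le_one (ψ s)]) h0) (sq_nonneg _)
      have h4 : (Real.sin (ψ s) + -1) * ψ'' s / ψ' s ^ 2 =
        -((1 - Real.sin (ψ s)) * ψ'' s / ψ' s ^ 2) := by ring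
      linarith
  have lower := intervalIntegral.sub_le_integral_of_hasDeriv_right_of_le hαβ (hcont 1)
    (fun s hs => (hder 1 s (hsub s hs)).hasDerivWithinAt) hint fun s hs => by
      have h0 := hψ'' s (hsub s hs)
      have h3 : 0 ≤ (Real.sin (ψ s) + 1) * ψ'' s / ψ' s ^ 2 :=
        div_nonneg (mul_nonneg (by linarith [Real.neg_one_le_sin (ψ s)]) h0) (sq_nonneg _)
      linarith
  have hquot : ∀ s ∈ Set.Icc α β, ∀ c : ℝ, 0 ≤ c → c ≤ 2 → 0 ≤ c / ψ' s ∧ c / ψ' s ≤ 2 / L := by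
    intro s hs c hc hc2
    exact ⟨div_nonneg hc (hpos s hs).le, div_le_div₀ (by norm_num) hc2 hL (hψ' s hs)⟩
  have q1 := hquot β hβ (1 - Real.sin (ψ β)) (by linarith [Real.sin_le_one (ψ β)])
    (by linarith [Real.neg_one_le_sin (ψ β)])
  have q2 := hquot α hα (1 - Real.sin (ψ α)) (by linarith [Real.sin_le_one (ψ α)])
    (by linarith [Real.neg_one_le_sin (ψ α)])
  have q3 := hquot β hβ (Real.sin (ψ β) + 1) (by linarith [Real.neg_one_le_sin (ψ β)])
    (by linarith [Real.sin_le_one (ψ β)])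
  have q4 := hquot α hα (Real.sin (ψ α) + 1) (by linarith [Real.neg_one_le_sin (ψ α)])
    (by linarith [Real.sin_le_one (ψ α)])
  have e1 : (Real.sin (ψ β) + -1) / ψ' β = -((1 - Real.sin (ψ β)) / ψ' β) := by ring
  have e2 : (Real.sin (ψ α) + -1) / ψ' α = -((1 - Real.sin (ψ α)) / ψ' α) := by ring
  rw [e1, e2] at upper
  rw [abs_le]
  exact ⟨by linarith [q3.1, q4.2], by linarith [q1.1, q2.2]⟩

/-! ### The higher Airy function -/

/-- The phase `s^(p+1)/(p+1) + xs` of the higher Airy function. -/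
def airyPhase (p : ℕ) (x s : ℝ) : ℝ := s ^ (p + 1) / ((p : ℝ) + 1) + x * s

lemma continuous_airyPhase (p : ℕ) (x : ℝ) : Continuous (airyPhase p x) := by
  unfold airyPhase; fun_prop

lemma higherAiryTruncated_eq (p : ℕ) (x R : ℝ) :
    higherAiryTruncated p x R = π⁻¹ * ∫ s in (0 : ℝ)..R, Real.cos (airyPhase p x s) := rfl

lemma abs_integral_airyPhase_le {p : ℕ} {x R R' : ℝ} (hR : 0 ≤ R) (hRR' : R ≤ R')
    (hpos : 0 < R ^ p + x) : |∫ s in R..R', Real.cos (airyPhase p x s)| ≤ 2 / (R ^ p + x) := by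
  refine abs_integral_cos_le (ψ' := fun s => s ^ p + x) (ψ'' := fun s => p * s ^ (p - 1)) hRR' hpos
    (fun s _ => ?_) (fun s _ => ?_) (fun s hs => ?_) (fun s hs => ?_)
  · unfold airyPhase
    refine (((hasDerivAt_pow (p + 1) s).div_const ((p : ℝ) + 1)).add
      ((hasDerivAt_id s).const_mul x)).congr_deriv ?_
    have : (p : ℝ) + 1 ≠ 0 := by positivity
    push_cast
    field_simp
  · exact (hasDerivAt_pow p s).add_const x
  · have := pow_le_pow_left₀ hR hs.1 p
    linarith
  · have : 0 ≤ s := hR.trans hs.1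
    positivity

lemma abs_higherAiryTruncated_sub_le {p : ℕ} {x R R' : ℝ} (hR : 0 ≤ R) (hRR' : R ≤ R')
    (hpos : 0 < R ^ p + x) :
    |higherAiryTruncated p x R' - higherAiryTruncated p x R| ≤ 2 / (R ^ p + x) := by
  have hc := continuous_airyPhase p x
  have hi : ∀ a b : ℝ, IntervalIntegrable (fun s => Real.cos (airyPhase p x s)) volume a b :=
    fun a b => Continuous.intervalIntegrable (by fun_prop) _ _
  rw [higherAiryTruncated_eq, higherAiryTruncated_eq, ← mul_sub,
    intervalIntegral.integral_interval_sub_left (hi _ _) (hi _ _), abs_mul, abs_inv,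
    abs_of_pos Real.pi_pos]
  refine (mul_le_of_le_one_left (abs_nonneg _) ?_).trans (abs_integral_airyPhase_le hR hRR' hpos)
  exact inv_le_one_of_one_le₀ (by linarith [Real.pi_gt_three])

lemma tendsto_pow_add_const {p : ℕ} (hp : 0 < p) (x : ℝ) :
    Tendsto (fun R : ℝ => R ^ p + x) atTop atTop :=
  tendsto_atTop_add_const_right _ _ (tendsto_pow_atTop hp.ne')

/-- The improper integral defining `Ai_p` converges. -/
lemma tendsto_higherAiryTruncated {p : ℕ} (hp : 0 < p) (x : ℝ) :
    Tendsto (higherAiryTruncated p x) atTop (𝓝 (higherAiry p x)) := by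
  refine tendsto_nhds_limUnder ?_
  refine cauchy_map_iff_exists_tendsto.1 (Metric.cauchy_iff.2 ⟨inferInstance, fun δ hδ => ?_⟩)
  obtain ⟨R, hR0, hR⟩ := ((eventually_ge_atTop (0 : ℝ)).and
    ((tendsto_pow_add_const hp x).eventually_gt_atTop (4 / δ))).exists
  have h4 : 0 < 4 / δ := by positivity
  have hb : 2 / (R ^ p + x) < δ / 2 := by
    rw [div_lt_iff₀ (h4.trans hR)]
    rw [div_lt_iff₀ hδ] at hR
    linarith
  refine ⟨_, image_mem_map (Ici_mem_atTop R), ?_⟩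
  rintro _ ⟨u, hu, rfl⟩ _ ⟨v, hv, rfl⟩
  have hu' := abs_higherAiryTruncated_sub_le hR0 hu (h4.trans hR)
  have hv' := abs_higherAiryTruncated_sub_le hR0 hv (h4.trans hR)
  rw [Real.dist_eq]
  calc _ = |(higherAiryTruncated p x u - higherAiryTruncated p x R) -
        (higherAiryTruncated p x v - higherAiryTruncated p x R)| := by congr 1; ring
    _ ≤ _ := abs_sub _ _
    _ < δ := by linarith

lemma abs_higherAiry_sub_le {p : ℕ} (hp : 0 < p) {x R : ℝ} (hR : 0 ≤ R) (hpos : 0 < R ^ p + x) :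
    |higherAiry p x - higherAiryTruncated p x R| ≤ 2 / (R ^ p + x) := by
  refine le_of_tendsto ((tendsto_higherAiryTruncated hp x).sub_const _).abs ?_
  filter_upwards [eventually_ge_atTop R] with R' hR'
  exact abs_higherAiryTruncated_sub_le hR hR' hpos

lemma measurable_higherAiry {p : ℕ} (hp : 0 < p) : Measurable (higherAiry p) := by
  refine measurable_of_tendsto_metrizable (f := fun (n : ℕ) x => higherAiryTruncated p x n)
    (fun n => ?_) (tendsto_pi_nhds.2 fun x =>
      (tendsto_higherAiryTruncated hp x).comp tendsto_natCast_atTop_atTop)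
  refine Continuous.measurable ?_
  unfold higherAiryTruncated
  exact continuous_const.mul
    (intervalIntegral.continuous_parametric_intervalIntegral_of_continuous' (by fun_prop) _ _)

/-! ### Convergence of the rescaled Fourier coefficients -/

/-- The properties of the phase function `f = -φ` that enter the asymptotic analysis: convexity on
`[0, π]` and the behaviour `f(θ) ∼ θ^(p+1)/(p+1)` at the origin. -/
structure IsEdgePhase (p : ℕ) (f f' f'' : ℝ → ℝ) : Prop where
  p_pos : 0 < p
  hasDerivAt : ∀ θ, HasDerivAt f (f' θ) θ
  hasDerivAt' : ∀ θ, HasDerivAt f' (f'' θ) θ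
  zero : f 0 = 0
  deriv_zero : f' 0 = 0
  convex : ∀ θ ∈ Set.Icc 0 π, 0 ≤ f'' θ
  tendsto_zero : Tendsto (fun θ => f θ / θ ^ (p + 1)) (𝓝[>] 0) (𝓝 (1 / ((p : ℝ) + 1)))

/-- The phase `ε^{-(p+1)} f(εs) + xs`. -/
def scaledPhase (p : ℕ) (f : ℝ → ℝ) (ε x s : ℝ) : ℝ := (ε ^ (p + 1))⁻¹ * f (ε * s) + x * s

/-- The finite-`ε` approximation of the higher Airy function. -/
def approxAiry (p : ℕ) (f : ℝ → ℝ) (ε x : ℝ) : ℝ :=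
  π⁻¹ * ∫ s in (0 : ℝ)..π / ε, Real.cos (scaledPhase p f ε x s)

namespace IsEdgePhase

variable {p : ℕ} {f f' f'' : ℝ → ℝ}

lemma continuous (hf : IsEdgePhase p f f' f'') : Continuous f :=
  continuous_iff_continuousAt.2 fun θ => (hf.hasDerivAt θ).continuousAt

lemma continuous_scaledPhase (hf : IsEdgePhase p f f' f'') (ε x : ℝ) :
    Continuous (scaledPhase p f ε x) := by
  have := hf.continuous
  unfold scaledPhase; fun_prop

lemma monotoneOn_deriv (hf : IsEdgePhase p f f' f'') : MonotoneOn f' (Set.Icc 0 π) := by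
  refine monotoneOn_of_deriv_nonneg (convex_Icc _ _)
    (fun θ _ => (hf.hasDerivAt' θ).continuousAt.continuousWithinAt)
    (fun θ _ => (hf.hasDerivAt' θ).differentiableAt.differentiableWithinAt) fun θ hθ => ?_
  rw [(hf.hasDerivAt' θ).deriv]
  exact hf.convex θ (interior_subset hθ)

/-- The tangent inequality `f(θ) ≤ θ f'(θ)` of the convex function `f`. -/
lemma le_mul_deriv (hf : IsEdgePhase p f f' f'') {θ : ℝ} (hθ : θ ∈ Set.Icc 0 π) :
    f θ ≤ θ * f' θ := by
  have h : MonotoneOn (fun θ => θ * f' θ - f θ) (Set.Icc 0 π) := by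
    have hd : ∀ θ, HasDerivAt (fun θ => θ * f' θ - f θ) (θ * f'' θ) θ := fun θ =>
      (((hasDerivAt_id θ).mul (hf.hasDerivAt' θ)).sub (hf.hasDerivAt θ)).congr_deriv (by simp)
    refine monotoneOn_of_deriv_nonneg (convex_Icc _ _)
      (fun θ _ => (hd θ).continuousAt.continuousWithinAt)
      (fun θ _ => (hd θ).differentiableAt.differentiableWithinAt) fun θ hθ => ?_
    rw [(hd θ).deriv]
    exact mul_nonneg (interior_subset hθ).1 (hf.convex θ (interior_subset hθ))
  have := h ⟨le_rfl, Real.pi_pos.le⟩ hθ hθ.1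
  simp only [zero_mul, hf.zero] at this
  linarith

lemma abs_integral_scaledPhase_le (hf : IsEdgePhase p f f' f'') {ε x R L : ℝ} (hε : 0 < ε)
    (hR : 0 ≤ R) (hRε : ε * R ≤ π) (hL : 0 < L)
    (h : L ≤ (ε ^ (p + 1))⁻¹ * (f' (ε * R) * ε) + x) :
    |∫ s in R..π / ε, Real.cos (scaledPhase p f ε x s)| ≤ 2 / L := by
  have hmem : ∀ s ∈ Set.Icc R (π / ε), ε * s ∈ Set.Icc 0 π := fun s hs =>
    ⟨mul_nonneg hε.le (hR.trans hs.1), by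
      have := hs.2
      rw [le_div_iff₀ hε] at this
      linarith⟩
  have hmul : ∀ s, HasDerivAt (fun s => ε * s) ε s := fun s => by
    simpa using (hasDerivAt_id s).const_mul ε
  have hRle : R ≤ π / ε := by rw [le_div_iff₀ hε]; linarith
  refine abs_integral_cos_le (ψ' := fun s => (ε ^ (p + 1))⁻¹ * (f' (ε * s) * ε) + x)
    (ψ'' := fun s => (ε ^ (p + 1))⁻¹ * (f'' (ε * s) * ε * ε)) hRle hL
    (fun s _ => ?_) (fun s _ => ?_) (fun s hs => ?_) (fun s hs => ?_)
  · unfold scaledPhase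
    have h1 := (hf.hasDerivAt (ε * s)).comp s (hmul s)
    exact ((h1.const_mul _).add ((hasDerivAt_id s).const_mul x)).congr_deriv (by simp)
  · have h1 := (hf.hasDerivAt' (ε * s)).comp s (hmul s)
    exact ((h1.mul_const ε).const_mul _).add_const x
  · have h1 := hf.monotoneOn_deriv (hmem R ⟨le_rfl, hRle⟩) (hmem s hs)
      (mul_le_mul_of_nonneg_left hs.1 hε.le)
    have h2 : (ε ^ (p + 1))⁻¹ * (f' (ε * R) * ε) ≤ (ε ^ (p + 1))⁻¹ * (f' (ε * s) * ε) := by gcongr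
    linarith
  · have h1 := hf.convex _ (hmem s hs)
    positivity

lemma tendsto_scaled (hf : IsEdgePhase p f f' f'') {s : ℝ} (hs : 0 < s) :
    Tendsto (fun ε => (ε ^ (p + 1))⁻¹ * f (ε * s)) (𝓝[>] 0) (𝓝 (s ^ (p + 1) / ((p : ℝ) + 1))) := by
  have h1 : Tendsto (fun ε : ℝ => ε * s) (𝓝[>] 0) (𝓝[>] 0) := by
    refine tendsto_nhdsWithin_iff.2 ⟨?_, ?_⟩
    · have : Tendsto (fun ε : ℝ => ε * s) (𝓝 0) (𝓝 (0 * s)) := tendsto_id.mul_const s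
      rw [zero_mul] at this
      exact this.mono_left nhdsWithin_le_nhds
    · filter_upwards [self_mem_nhdsWithin] with ε hε
      exact mul_pos hε hs
  have h2 := (hf.tendsto_zero.comp h1).const_mul (s ^ (p + 1))
  rw [mul_one_div] at h2
  refine h2.congr' ?_
  filter_upwards [self_mem_nhdsWithin] with ε hε
  have : ε ≠ 0 := ne_of_gt hε
  simp only [Function.comp_apply]
  rw [mul_pow]
  field_simp

/-- A lower bound for the derivative of the rescaled phase at a fixed point, from the limit of the
phase itself and the tangent inequality. -/
lemma eventually_deriv_ge (hf : IsEdgePhase p f f' f'') {R L : ℝ} (hR : 0 < R)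
    (h : L < R ^ p / ((p : ℝ) + 1)) :
    ∀ᶠ ε in 𝓝[>] (0 : ℝ), 0 < ε ∧ ε * R ≤ π ∧ L ≤ (ε ^ (p + 1))⁻¹ * (f' (ε * R) * ε) := by
  have h1 := (hf.tendsto_scaled hR).eventually_const_lt (u := L * R) (by
    rw [pow_succ, mul_div_right_comm]
    exact mul_lt_mul_of_pos_right h hR)
  have h2 : ∀ᶠ ε in 𝓝[>] (0 : ℝ), ε < π / R :=
    eventually_nhdsWithin_of_eventually_nhds (eventually_lt_nhds (div_pos Real.pi_pos hR))
  filter_upwards [h1, h2, self_mem_nhdsWithin] with ε hε1 hε2 hε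
  have hε0 : 0 < ε := hε
  have hle : ε * R ≤ π := ((lt_div_iff₀ hR).1 hε2).le
  refine ⟨hε0, hle, ?_⟩
  have h3 := hf.le_mul_deriv (θ := ε * R) ⟨by positivity, hle⟩
  have h4 : L * R ≤ (ε ^ (p + 1))⁻¹ * (f' (ε * R) * ε) * R := by
    refine hε1.le.trans ?_
    calc (ε ^ (p + 1))⁻¹ * f (ε * R) ≤ (ε ^ (p + 1))⁻¹ * (ε * R * f' (ε * R)) := by gcongr
      _ = _ := by ring
  exact le_of_mul_le_mul_right h4 hR

lemma exists_pow_div_gt (hf : IsEdgePhase p f f' f'') (L : ℝ) :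
    ∃ R : ℝ, 0 < R ∧ L < R ^ p / ((p : ℝ) + 1) := by
  have hp : (0 : ℝ) < (p : ℝ) + 1 := by positivity
  obtain ⟨R, h0, hR⟩ := ((eventually_gt_atTop (0 : ℝ)).and
    ((tendsto_pow_atTop (α := ℝ) hf.p_pos.ne').eventually_gt_atTop (L * (p + 1)))).exists
  exact ⟨R, h0, (lt_div_iff₀ hp).2 hR⟩

/-- Uniform boundedness and decay of the approximations on half-lines: near the origin of the
integral the integrand is bounded by `1`, elsewhere the first derivative test applies. -/
lemma abs_approxAiry_le (hf : IsEdgePhase p f f' f'') (M : ℝ) :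
    ∃ C : ℝ, 0 ≤ C ∧ ∀ᶠ ε in 𝓝[>] (0 : ℝ), ∀ x, -M ≤ x → |approxAiry p f ε x| ≤ C / (1 + |x|) := by
  obtain ⟨R, hR0, hR⟩ := hf.exists_pow_div_gt (|M| + 1)
  refine ⟨(R + 2) * (1 + |M|) + 2, by positivity, ?_⟩
  filter_upwards [hf.eventually_deriv_ge hR0 hR] with ε hε x hx
  obtain ⟨hε0, hεR, hL⟩ := hε
  have hpi : π⁻¹ ≤ 1 := inv_le_one_of_one_le₀ (by linarith [Real.pi_gt_three])
  have habs : |approxAiry p f ε x| ≤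
      |∫ s in (0 : ℝ)..π / ε, Real.cos (scaledPhase p f ε x s)| := by
    rw [approxAiry, abs_mul, abs_inv, abs_of_pos Real.pi_pos]
    exact mul_le_of_le_one_left (abs_nonneg _) hpi
  have hb1 : |approxAiry p f ε x| ≤ R + 2 := by
    refine habs.trans ?_
    have hc := hf.continuous_scaledPhase ε x
    have hi : ∀ a b : ℝ, IntervalIntegrable (fun s => Real.cos (scaledPhase p f ε x s)) volume a b :=
      fun a b => Continuous.intervalIntegrable (by fun_prop) _ _
    rw [← intervalIntegral.integral_add_adjacent_intervals (hi 0 R) (hi R (π / ε))]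
    refine (abs_add_le _ _).trans (add_le_add ?_ ?_)
    · have h := intervalIntegral.norm_integral_le_of_norm_le_const (a := 0) (b := R) (C := 1)
        (f := fun s => Real.cos (scaledPhase p f ε x s)) fun θ _ => Real.abs_cos_le_one _
      rwa [Real.norm_eq_abs, one_mul, sub_zero, abs_of_pos hR0] at h
    · have h := hf.abs_integral_scaledPhase_le (x := x) (L := 1) hε0 hR0.le hεR one_pos
        (by linarith [le_abs_self M])
      simpa using h
  rw [le_div_iff₀ (by positivity)]
  rcases le_or_gt x 0 with hx0 | hx0
  · have h1 : |x| ≤ |M| := by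
      rw [abs_of_nonpos hx0]; linarith [le_abs_self M]
    have h2 : |approxAiry p f ε x| * (1 + |x|) ≤ (R + 2) * (1 + |M|) := by gcongr
    linarith
  · have hb2 : |approxAiry p f ε x| ≤ 2 / x := by
      refine habs.trans (hf.abs_integral_scaledPhase_le hε0 le_rfl (by simp [Real.pi_pos.le]) hx0 ?_)
      simp [hf.deriv_zero]
    rw [le_div_iff₀ hx0] at hb2
    rw [abs_of_pos hx0, mul_add, mul_one]
    have : R + 2 ≤ (R + 2) * (1 + |M|) := le_mul_of_one_le_right (by positivity) (by
      linarith [abs_nonneg M])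
    linarith

lemma tendsto_integral_scaledPhase (hf : IsEdgePhase p f f' f'') {x : ℝ} {ξ : ℝ → ℝ}
    (hξ : Tendsto ξ (𝓝[>] 0) (𝓝 x)) {R : ℝ} (hR : 0 ≤ R) :
    Tendsto (fun ε => ∫ s in (0 : ℝ)..R, Real.cos (scaledPhase p f ε (ξ ε) s)) (𝓝[>] 0)
      (𝓝 (∫ s in (0 : ℝ)..R, Real.cos (airyPhase p x s))) := by
  refine intervalIntegral.tendsto_integral_filter_of_dominated_convergence (fun _ => 1)
    (Eventually.of_forall fun ε => ?_) (Eventually.of_forall fun ε => Eventually.of_forall fun s _ =>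
      Real.abs_cos_le_one _) intervalIntegrable_const (Eventually.of_forall fun s hs => ?_)
  · have := hf.continuous_scaledPhase ε (ξ ε)
    exact Continuous.aestronglyMeasurable (by fun_prop)
  · rw [Set.uIoc_of_le hR] at hs
    exact (Real.continuous_cos.tendsto _).comp
      ((hf.tendsto_scaled hs.1).add (hξ.mul_const s))

/-- The approximations converge to the higher Airy function, also along moving points. -/
lemma tendsto_approxAiry (hf : IsEdgePhase p f f' f'') {x : ℝ} {ξ : ℝ → ℝ}
    (hξ : Tendsto ξ (𝓝[>] 0) (𝓝 x)) :
    Tendsto (fun ε => approxAiry p f ε (ξ ε)) (𝓝[>] 0) (𝓝 (higherAiry p x)) := by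
  refine Metric.tendsto_nhds.2 fun δ hδ => ?_
  obtain ⟨R, hR0, hR⟩ := hf.exists_pow_div_gt (|x| + 1 + 6 / δ)
  have h6 : 0 < 6 / δ := by positivity
  have hpi : π⁻¹ ≤ 1 := inv_le_one_of_one_le₀ (by linarith [Real.pi_gt_three])
  have h2 : 2 / (6 / δ) = δ / 3 := by field_simp; norm_num
  -- the tail of the limit integral
  have hRp : R ^ p / ((p : ℝ) + 1) ≤ R ^ p := div_le_self (by positivity) (by simp)
  have htail : |higherAiry p x - higherAiryTruncated p x R| ≤ δ / 3 := by
    have h3 : 6 / δ ≤ R ^ p + x := by linarith [neg_abs_le x]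
    refine (abs_higherAiry_sub_le hf.p_pos hR0.le (h6.trans_le h3)).trans ?_
    rw [← h2]
    exact div_le_div_of_nonneg_left (by norm_num) h6 h3
  have hclose := Metric.tendsto_nhds.1 (hf.tendsto_integral_scaledPhase hξ hR0.le) (δ / 3)
    (by positivity)
  have hξ1 := Metric.tendsto_nhds.1 hξ 1 one_pos
  filter_upwards [hclose, hξ1, hf.eventually_deriv_ge hR0 hR] with ε h3 h4 h5
  obtain ⟨hε0, hεR, hL⟩ := h5
  rw [Real.dist_eq] at h3 h4 ⊢
  have hc := hf.continuous_scaledPhase ε (ξ ε)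
  have hi : ∀ a b : ℝ, IntervalIntegrable (fun s => Real.cos (scaledPhase p f ε (ξ ε) s))
      volume a b := fun a b => Continuous.intervalIntegrable (by fun_prop) _ _
  have htail' : |∫ s in R..π / ε, Real.cos (scaledPhase p f ε (ξ ε) s)| ≤ δ / 3 := by
    rw [← h2]
    refine hf.abs_integral_scaledPhase_le hε0 hR0.le hεR h6 ?_
    have := (abs_lt.1 h4).1
    linarith [neg_abs_le x]
  rw [approxAiry, ← intervalIntegral.integral_add_adjacent_intervals (hi 0 R) (hi R (π / ε))]
  rw [higherAiryTruncated_eq] at htail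
  set I1 := ∫ s in (0 : ℝ)..R, Real.cos (scaledPhase p f ε (ξ ε) s)
  set I2 := ∫ s in R..π / ε, Real.cos (scaledPhase p f ε (ξ ε) s)
  set I3 := ∫ s in (0 : ℝ)..R, Real.cos (airyPhase p x s)
  have hpi0 : 0 < π⁻¹ := by positivity
  have e : π⁻¹ * (I1 + I2) - higherAiry p x =
      π⁻¹ * (I1 - I3) + π⁻¹ * I2 - (higherAiry p x - π⁻¹ * I3) := by ring
  rw [e]
  have b1 : |π⁻¹ * (I1 - I3)| < δ / 3 := by
    rw [abs_mul, abs_of_pos hpi0]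
    exact (mul_le_of_le_one_left (abs_nonneg _) hpi).trans_lt h3
  have b2 : |π⁻¹ * I2| ≤ δ / 3 := by
    rw [abs_mul, abs_of_pos hpi0]
    exact (mul_le_of_le_one_left (abs_nonneg _) hpi).trans htail'
  refine (abs_sub _ _).trans_lt ?_
  have := abs_add_le (π⁻¹ * (I1 - I3)) (π⁻¹ * I2)
  linarith

lemma abs_higherAiry_le (hf : IsEdgePhase p f f' f'') (M : ℝ) :
    ∃ C : ℝ, 0 ≤ C ∧ ∀ x, -M ≤ x → |higherAiry p x| ≤ C / (1 + |x|) := by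
  obtain ⟨C, hC0, hC⟩ := hf.abs_approxAiry_le M
  refine ⟨C, hC0, fun x hx => ?_⟩
  refine le_of_tendsto (hf.tendsto_approxAiry (tendsto_const_nhds (x := x))).abs ?_
  filter_upwards [hC] with ε h using h x hx

end IsEdgePhase

/-! ### Pfaffians of block-antidiagonal matrices -/

/-- The numbering of `Fin (2 * N)` by pairs: the first copy of `i` is `2i`, the second `2i + 1`. -/
def pairEquiv (N : ℕ) : Fin N ⊕ Fin N ≃ Fin (2 * N) where
  toFun := Sum.elim (fun i => ⟨2 * i.val, by omega⟩) (fun i => ⟨2 * i.val + 1, by omega⟩)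
  invFun j := if j.val % 2 = 0 then .inl ⟨j.val / 2, by omega⟩ else .inr ⟨j.val / 2, by omega⟩
  left_inv x := by
    rcases x with i | i
    · simp
    · have h1 : (2 * i.val + 1) % 2 ≠ 0 := by omega
      have h2 : (2 * i.val + 1) / 2 = i.val := by omega
      simp [h2]
  right_inv j := by
    by_cases h : j.val % 2 = 0
    · simp only [h, if_true, Sum.elim_inl]; ext; simp; omega
    · simp only [h, if_false, Sum.elim_inr]; ext; simp; omega

/-- The numbering of `Fin (2 * N)` by halves: the first copy of `i` is `i`, the second its mirror
image `2N - 1 - i`. -/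
def mirrorEquiv (N : ℕ) : Fin N ⊕ Fin N ≃ Fin (2 * N) where
  toFun := Sum.elim (fun i => ⟨i.val, by omega⟩) (fun i => ⟨2 * N - 1 - i.val, by omega⟩)
  invFun j := if h : j.val < N then .inl ⟨j.val, h⟩ else .inr ⟨2 * N - 1 - j.val, by omega⟩
  left_inv x := by
    rcases x with i | i
    · simp
    · have h1 : ¬ (2 * N - 1 - i.val < N) := by omega
      have h2 : 2 * N - 1 - (2 * N - 1 - i.val) = i.val := by omega
      simp [h1, h2]
  right_inv j := by
    by_cases h : j.val < N
    · simp [h]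
    · simp only [h, dif_neg, not_false_eq_true, Sum.elim_inr]; ext; simp; omega

/-- The permutation `2i ↦ i`, `2i + 1 ↦ 2N - 1 - τ(i)`, which encodes the perfect matching
`i ∼ 2N - 1 - τ(i)`. -/
def matchingPerm {N : ℕ} (τ : Equiv.Perm (Fin N)) : Equiv.Perm (Fin (2 * N)) :=
  (pairEquiv N).symm.trans ((Equiv.Perm.sumCongr 1 τ).trans (mirrorEquiv N))

lemma matchingPerm_even {N : ℕ} (τ : Equiv.Perm (Fin N)) (i : Fin N) :
    matchingPerm τ ⟨2 * i.val, by omega⟩ = ⟨i.val, by omega⟩ := by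
  have h : (⟨2 * i.val, by omega⟩ : Fin (2 * N)) = pairEquiv N (.inl i) := rfl
  rw [h]
  simp only [matchingPerm, Equiv.trans_apply, Equiv.symm_apply_apply]
  rfl

lemma matchingPerm_odd {N : ℕ} (τ : Equiv.Perm (Fin N)) (i : Fin N) :
    matchingPerm τ ⟨2 * i.val + 1, by omega⟩ = ⟨2 * N - 1 - (τ i).val, by omega⟩ := by
  have h : (⟨2 * i.val + 1, by omega⟩ : Fin (2 * N)) = pairEquiv N (.inr i) := rfl
  rw [h]
  simp only [matchingPerm, Equiv.trans_apply, Equiv.symm_apply_apply]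
  rfl

lemma sign_matchingPerm_one (N : ℕ) : Equiv.Perm.sign (matchingPerm (1 : Equiv.Perm (Fin N))) = 1 := by
  rw [Equiv.Perm.sign_eq_prod_prod_Ioi]
  refine Finset.prod_eq_one fun j _ => ?_
  obtain ⟨x, rfl⟩ := (pairEquiv N).surjective j
  have hval : ∀ y, matchingPerm 1 (pairEquiv N y) = mirrorEquiv N y := fun y => by
    simp only [matchingPerm, Equiv.trans_apply, Equiv.symm_apply_apply, Equiv.Perm.sumCongr_one]
    rfl
  rcases x with i | i
  · -- `i` is smaller than all later values
    refine Finset.prod_eq_one fun k hk => ?_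
    obtain ⟨y, rfl⟩ := (pairEquiv N).surjective k
    rw [hval, hval, if_pos]
    rw [Finset.mem_Ioi] at hk
    rcases y with l | l <;>
    · simp only [pairEquiv, mirrorEquiv, Equiv.coe_fn_mk, Sum.elim_inl, Sum.elim_inr,
        Fin.mk_lt_mk] at hk ⊢
      omega
  · -- `2N - 1 - i` is larger than all later values, of which there is an even number
    have hlt : ∀ k ∈ Finset.Ioi (pairEquiv N (.inr i)),
        (if matchingPerm 1 (pairEquiv N (.inr i)) < matchingPerm 1 k then (1 : ℤˣ) else -1) = -1 := by
      intro k hk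
      obtain ⟨y, rfl⟩ := (pairEquiv N).surjective k
      rw [hval, hval, if_neg]
      rw [Finset.mem_Ioi] at hk
      rcases y with l | l <;>
      · simp only [pairEquiv, mirrorEquiv, Equiv.coe_fn_mk, Sum.elim_inl, Sum.elim_inr,
          Fin.mk_lt_mk] at hk ⊢
        omega
    rw [Finset.prod_congr rfl hlt, Finset.prod_const, Fin.card_Ioi]
    refine Even.neg_one_pow ?_
    simp only [pairEquiv, Equiv.coe_fn_mk, Sum.elim_inr]
    exact ⟨N - 1 - i.val, by omega⟩

lemma sign_matchingPerm {N : ℕ} (τ : Equiv.Perm (Fin N)) :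
    Equiv.Perm.sign (matchingPerm τ) = Equiv.Perm.sign τ := by
  have h : matchingPerm τ = matchingPerm 1 *
      (((pairEquiv N).symm.trans (Equiv.Perm.sumCongr 1 τ)).trans (pairEquiv N)) := by
    ext j
    simp only [matchingPerm, Equiv.Perm.mul_apply, Equiv.trans_apply, Equiv.symm_apply_apply,
      Equiv.Perm.sumCongr_one]
    rfl
  rw [h, Equiv.Perm.sign_mul, sign_matchingPerm_one, one_mul,
    Equiv.Perm.sign_symm_trans_trans, Equiv.Perm.sign_sumCongr, Equiv.Perm.sign_one, one_mul]

/-- The permutations over which the Pfaffian is summed. -/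
def IsMatching {N : ℕ} (σ : Equiv.Perm (Fin (2 * N))) : Prop :=
  (∀ i j : Fin N, i < j → σ ⟨2 * i.val, by omega⟩ < σ ⟨2 * j.val, by omega⟩) ∧
    (∀ i : Fin N, σ ⟨2 * i.val, by omega⟩ < σ ⟨2 * i.val + 1, by omega⟩)

instance {N : ℕ} : DecidablePred (IsMatching (N := N)) := fun _ => by
  unfold IsMatching; infer_instance

lemma pfaffian_eq {N : ℕ} (M : Matrix (Fin (2 * N)) (Fin (2 * N)) ℂ) :
    pfaffian M = ∑ σ : Equiv.Perm (Fin (2 * N)) with IsMatching σ,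
      ((Equiv.Perm.sign σ : ℤ) : ℂ) *
        ∏ i : Fin N, M (σ ⟨2 * i.val, by omega⟩) (σ ⟨2 * i.val + 1, by omega⟩) := by
  unfold pfaffian
  refine Finset.sum_congr ?_ fun _ _ => rfl
  ext σ
  simp only [Finset.mem_filter]
  rfl

lemma isMatching_matchingPerm {N : ℕ} (τ : Equiv.Perm (Fin N)) : IsMatching (matchingPerm τ) := by
  refine ⟨fun i j hij => ?_, fun i => ?_⟩
  · rw [matchingPerm_even, matchingPerm_even]; exact hij
  · rw [matchingPerm_even, matchingPerm_odd, Fin.mk_lt_mk]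
    omega

/-- A matching in which every pair joins the first half to the second comes from a permutation. -/
lemma IsMatching.exists_eq_matchingPerm {N : ℕ} {σ : Equiv.Perm (Fin (2 * N))} (hσ : IsMatching σ)
    (h : ∀ i : Fin N, (σ ⟨2 * i.val, by omega⟩).val < N ∧
      N ≤ (σ ⟨2 * i.val + 1, by omega⟩).val) : ∃ τ, matchingPerm τ = σ := by
  let u : Fin N → Fin N := fun i => ⟨(σ ⟨2 * i.val, by omega⟩).val, (h i).1⟩
  have hu : StrictMono u := fun i j hij => hσ.1 i j hij
  have hid : ∀ i, u i = i := fun i => le_antisymm hu.apply_le hu.le_apply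
  let w : Fin N → Fin N := fun i => ⟨2 * N - 1 - (σ ⟨2 * i.val + 1, by omega⟩).val, by
    have := (h i).2; omega⟩
  have hw : Function.Injective w := by
    intro i j hij
    have h1 : 2 * N - 1 - (σ ⟨2 * i.val + 1, by omega⟩).val =
      2 * N - 1 - (σ ⟨2 * j.val + 1, by omega⟩).val := congrArg Fin.val hij
    have h2 : σ ⟨2 * i.val + 1, by omega⟩ = σ ⟨2 * j.val + 1, by omega⟩ := by
      ext; omega
    have h3 := congrArg Fin.val (σ.injective h2)
    simp only at h3
    ext; omega
  refine ⟨Equiv.ofBijective w (Finite.injective_iff_bijective.1 hw), ?_⟩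
  ext j
  obtain ⟨x, rfl⟩ := (pairEquiv N).surjective j
  rcases x with i | i
  · have h1 := matchingPerm_even (Equiv.ofBijective w (Finite.injective_iff_bijective.1 hw)) i
    exact (congrArg Fin.val h1).trans (congrArg Fin.val (hid i)).symm
  · have h1 := matchingPerm_odd (Equiv.ofBijective w (Finite.injective_iff_bijective.1 hw)) i
    refine (congrArg Fin.val h1).trans ?_
    simp only [Equiv.ofBijective_apply, w]
    change _ = (σ ⟨2 * i.val + 1, by omega⟩).val
    omega

/-- Only the pairings of the first half of the indices with the second half contribute to the
Pfaffian of a matrix whose diagonal blocks vanish. -/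
lemma sum_matching_eq_det {N : ℕ} (H : Matrix (Fin N) (Fin N) ℂ)
    (L : Fin (2 * N) → Fin (2 * N) → ℂ)
    (hL : ∀ i j : Fin N, L ⟨i.val, by omega⟩ ⟨2 * N - 1 - j.val, by omega⟩ = H i j)
    (hL0 : ∀ i j : Fin (2 * N), ¬ (i.val < N ∧ N ≤ j.val) → L i j = 0) :
    ∑ σ : Equiv.Perm (Fin (2 * N)) with IsMatching σ, ((Equiv.Perm.sign σ : ℤ) : ℂ) *
      ∏ i : Fin N, L (σ ⟨2 * i.val, by omega⟩) (σ ⟨2 * i.val + 1, by omega⟩) = H.det := by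
  rw [← Matrix.det_transpose, Matrix.det_apply']
  symm
  refine Finset.sum_of_injOn matchingPerm ?_ ?_ ?_ ?_
  · intro τ _ τ' _ hττ
    ext i
    have h1 := congrArg (fun σ : Equiv.Perm (Fin (2 * N)) => (σ ⟨2 * i.val + 1, by omega⟩).val) hττ
    simp only [matchingPerm_odd] at h1
    omega
  · intro τ _
    simpa using isMatching_matchingPerm τ
  · intro σ hσ hnot
    rw [Finset.mem_filter] at hσ
    refine mul_eq_zero_of_right _ ?_
    by_contra hne
    replace hne := Finset.prod_ne_zero_iff.1 hne
    refine hnot ?_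
    obtain ⟨τ, hτ⟩ := hσ.2.exists_eq_matchingPerm fun i => by
      by_contra hc
      exact hne i (Finset.mem_univ _) (hL0 _ _ hc)
    exact ⟨τ, by simp, hτ⟩
  · intro τ _
    rw [sign_matchingPerm]
    congr 1
    refine Finset.prod_congr rfl fun i _ => ?_
    rw [matchingPerm_even, matchingPerm_odd, hL, Matrix.transpose_apply]

/-- Scaling limits of Pfaffians whose diagonal blocks are negligible. -/
lemma tendsto_pfaffian {N : ℕ} {l : Filter ℝ} (M : ℝ → Matrix (Fin (2 * N)) (Fin (2 * N)) ℂ)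
    (H : Matrix (Fin N) (Fin N) ℂ)
    (hdiag : ∀ i j : Fin N, Tendsto (fun ε : ℝ => (ε : ℂ)⁻¹ *
      M ε ⟨i.val, by omega⟩ ⟨2 * N - 1 - j.val, by omega⟩) l (𝓝 (H i j)))
    (hoff : ∀ i j : Fin (2 * N), i < j → ¬ (i.val < N ∧ N ≤ j.val) →
      Tendsto (fun ε : ℝ => (ε : ℂ)⁻¹ * M ε i j) l (𝓝 0)) :
    Tendsto (fun ε : ℝ => ((ε : ℂ) ^ N)⁻¹ * pfaffian (M ε)) l (𝓝 H.det) := by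
  let L : Fin (2 * N) → Fin (2 * N) → ℂ := fun i j =>
    if h : i.val < N ∧ N ≤ j.val then H ⟨i.val, h.1⟩ ⟨2 * N - 1 - j.val, by omega⟩ else 0
  have hLim : ∀ i j : Fin (2 * N), i < j →
      Tendsto (fun ε : ℝ => (ε : ℂ)⁻¹ * M ε i j) l (𝓝 (L i j)) := by
    intro i j hij
    by_cases h : i.val < N ∧ N ≤ j.val
    · simp only [L, dif_pos h]
      convert! hdiag ⟨i.val, h.1⟩ ⟨2 * N - 1 - j.val, by omega⟩ using 4
      ext; simp only; omega
    · simp only [L, dif_neg h]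
      exact hoff i j hij h
  rw [← sum_matching_eq_det H L (fun i j => ?_) fun i j h => dif_neg h]
  · have hscale : ∀ ε : ℝ, ((ε : ℂ) ^ N)⁻¹ * pfaffian (M ε) =
        ∑ σ : Equiv.Perm (Fin (2 * N)) with IsMatching σ, ((Equiv.Perm.sign σ : ℤ) : ℂ) *
          ∏ i : Fin N, ((ε : ℂ)⁻¹ *
            M ε (σ ⟨2 * i.val, by omega⟩) (σ ⟨2 * i.val + 1, by omega⟩)) := by
      intro ε
      rw [pfaffian_eq, Finset.mul_sum]
      refine Finset.sum_congr rfl fun σ _ => ?_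
      rw [Finset.prod_mul_distrib, Finset.prod_const, Finset.card_univ, Fintype.card_fin, inv_pow]
      ring
    simp only [hscale]
    refine tendsto_finsetSum _ fun σ hσ => ?_
    refine Tendsto.const_mul _ (tendsto_finsetProd _ fun i _ => hLim _ _ ?_)
    exact (Finset.mem_filter.1 hσ).2.2 i
  · have h : i.val < N ∧ N ≤ 2 * N - 1 - j.val := ⟨i.2, by omega⟩
    have h2 : 2 * N - 1 - (2 * N - 1 - j.val) = j.val := by omega
    simp only [L, dif_pos h, h2]

/-! ### Riemann sums -/

/-- The series of the values of a step function is its integral. -/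
lemma integral_step_eq {G : ℕ → ℝ} {ε : ℝ} (hε : 0 < ε)
    (hG : IntegrableOn (fun z : ℝ => G ⌊z / ε⌋₊) (Set.Ioi 0)) :
    ∫ z in Set.Ioi (0 : ℝ), G ⌊z / ε⌋₊ = ε * ∑' d : ℕ, G d := by
  have hunion : ⋃ d : ℕ, Set.Ico (d * ε) ((d + 1 : ℝ) * ε) = Set.Ici (0 : ℝ) := by
    ext z
    simp only [Set.mem_iUnion, Set.mem_Ico, Set.mem_Ici]
    constructor
    · rintro ⟨d, h, -⟩
      exact (by positivity : (0 : ℝ) ≤ d * ε).trans h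
    · intro hz
      refine ⟨⌊z / ε⌋₊, ?_, ?_⟩
      · rw [← le_div_iff₀ hε]; exact Nat.floor_le (by positivity)
      · rw [← div_lt_iff₀ hε]; exact Nat.lt_floor_add_one _
  have hfloor : ∀ d : ℕ, ∀ z ∈ Set.Ico (d * ε) ((d + 1 : ℝ) * ε), ⌊z / ε⌋₊ = d := by
    intro d z hz
    have h0 : 0 ≤ z / ε := div_nonneg ((by positivity : (0 : ℝ) ≤ d * ε).trans hz.1) hε.le
    exact (Nat.floor_eq_iff h0).2 ⟨(le_div_iff₀ hε).2 hz.1, (div_lt_iff₀ hε).2 hz.2⟩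
  have hdisj : Pairwise (Function.onFun Disjoint
      fun d : ℕ => Set.Ico (d * ε) ((d + 1 : ℝ) * ε)) := by
    intro d e hde
    refine Set.disjoint_left.2 fun z hd he => hde ?_
    rw [← hfloor d z hd, hfloor e z he]
  rw [← integral_Ici_eq_integral_Ioi, ← hunion]
  rw [integral_iUnion (fun d => measurableSet_Ico) hdisj (by
    rw [hunion, integrableOn_Ici_iff_integrableOn_Ioi]; exact hG), ← tsum_mul_left]
  refine tsum_congr fun d => ?_
  rw [setIntegral_congr_fun measurableSet_Ico fun z hz => by rw [hfloor d z hz],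
    setIntegral_const]
  have h1 : (d + 1 : ℝ) * ε - d * ε = ε := by ring
  rw [Measure.real, Real.volume_Ico, h1, ENNReal.toReal_ofReal hε.le, smul_eq_mul]

lemma integrableOn_inv_one_add_sq (C : ℝ) :
    IntegrableOn (fun z : ℝ => C / (1 + z) ^ 2) (Set.Ioi 0) := by
  have h1 : IntegrableOn (fun z : ℝ => |C| * (1 + z ^ 2)⁻¹) (Set.Ioi 0) :=
    (integrable_inv_one_add_sq.const_mul _).integrableOn
  refine Integrable.mono' h1 ?_ ?_
  · exact Measurable.aestronglyMeasurable (by fun_prop)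
  · refine (ae_restrict_iff' measurableSet_Ioi).2 (Eventually.of_forall fun z hz => ?_)
    have hz0 : 0 < z := hz
    rw [Real.norm_eq_abs, abs_div, abs_of_nonneg (sq_nonneg (1 + z)), div_eq_mul_inv]
    gcongr
    nlinarith

/-- Shifted form of the decay estimate. -/
lemma div_one_add_abs_le {C M w z : ℝ} (hC : 0 ≤ C) (hM : 0 ≤ M) (hz : 0 ≤ z) (hw : z - M ≤ w) :
    C / (1 + |w|) ≤ C * (1 + M) / (1 + z) := by
  rw [div_le_div_iff₀ (by positivity) (by positivity), mul_assoc]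
  refine mul_le_mul_of_nonneg_left ?_ hC
  nlinarith [le_abs_self w, abs_nonneg w]

namespace IsEdgePhase

variable {p : ℕ} {f f' f'' : ℝ → ℝ}

lemma integrableOn_higherAiry_mul (hf : IsEdgePhase p f f' f'') (x y : ℝ) :
    IntegrableOn (fun z => higherAiry p (x + z) * higherAiry p (y + z)) (Set.Ioi (0 : ℝ)) := by
  set M := |x| + |y| with hM
  obtain ⟨C, hC0, hC⟩ := hf.abs_higherAiry_le M
  have hm := measurable_higherAiry hf.p_pos
  refine Integrable.mono' (integrableOn_inv_one_add_sq ((C * (1 + M)) ^ 2))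
    (Measurable.aestronglyMeasurable (by fun_prop))
    ((ae_restrict_iff' measurableSet_Ioi).2 (Eventually.of_forall fun z hz => ?_))
  have hz0 : 0 < z := hz
  have hx := neg_abs_le x
  have hy := neg_abs_le y
  have hx' := abs_nonneg x
  have hy' := abs_nonneg y
  have hM0 : 0 ≤ M := by positivity
  have b1 := (hC (x + z) (by linarith)).trans (div_one_add_abs_le hC0 hM0 hz0.le (by linarith))
  have b2 := (hC (y + z) (by linarith)).trans (div_one_add_abs_le hC0 hM0 hz0.le (by linarith))
  rw [norm_mul, ← div_pow, sq]
  exact mul_le_mul b1 b2 (abs_nonneg _) ((abs_nonneg _).trans b1)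

/-- Convergence of the Riemann sums to the higher Airy kernel. -/
lemma tendsto_tsum_approxAiry (hf : IsEdgePhase p f f' f'') {x y : ℝ} {ξ υ : ℝ → ℝ}
    (hξ : Tendsto ξ (𝓝[>] 0) (𝓝 x)) (hυ : Tendsto υ (𝓝[>] 0) (𝓝 y)) :
    Tendsto (fun ε => ε * ∑' d : ℕ,
      approxAiry p f ε (ξ ε + ε * d) * approxAiry p f ε (υ ε + ε * d)) (𝓝[>] 0)
      (𝓝 (higherAiryKernel p x y)) := by
  set M := |x| + |y| + 2 with hM
  obtain ⟨C, hC0, hC⟩ := hf.abs_approxAiry_le M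
  have hM0 : 0 ≤ M := by positivity
  let S : ℝ → ℝ → ℝ := fun ε z => approxAiry p f ε (ξ ε + ε * ⌊z / ε⌋₊) *
    approxAiry p f ε (υ ε + ε * ⌊z / ε⌋₊)
  have hmeas : ∀ ε, Measurable (S ε) := by
    intro ε
    exact (measurable_from_nat (f := fun d : ℕ => approxAiry p f ε (ξ ε + ε * d) *
      approxAiry p f ε (υ ε + ε * d))).comp (Nat.measurable_floor.comp (measurable_id.div_const ε))
  have hξ1 := Metric.tendsto_nhds.1 hξ 1 one_pos
  have hυ1 := Metric.tendsto_nhds.1 hυ 1 one_pos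
  have hε1 : ∀ᶠ ε in 𝓝[>] (0 : ℝ), ε < 1 :=
    eventually_nhdsWithin_of_eventually_nhds (eventually_lt_nhds one_pos)
  have hbound : ∀ᶠ ε in 𝓝[>] (0 : ℝ), ∀ z ∈ Set.Ioi (0 : ℝ),
      ‖S ε z‖ ≤ (C * (1 + M)) ^ 2 / (1 + z) ^ 2 := by
    filter_upwards [hC, hξ1, hυ1, hε1, self_mem_nhdsWithin] with ε hCε hξε hυε hε1 hε z hz
    have hε0 : 0 < ε := hε
    have hz0 : 0 < z := hz
    rw [Real.dist_eq] at hξε hυε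
    have hx := neg_abs_le x
    have hy := neg_abs_le y
    have hx' := abs_nonneg x
    have hy' := abs_nonneg y
    have hfl : z - ε ≤ ε * ⌊z / ε⌋₊ := by
      have := (Nat.lt_floor_add_one (z / ε)).le
      rw [div_le_iff₀ hε0] at this
      linarith
    have h1 := (abs_lt.1 hξε).1
    have h2 := (abs_lt.1 hυε).1
    have b1 := (hCε (ξ ε + ε * ⌊z / ε⌋₊) (by linarith)).trans
      (div_one_add_abs_le hC0 hM0 hz0.le (by linarith))
    have b2 := (hCε (υ ε + ε * ⌊z / ε⌋₊) (by linarith)).trans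
      (div_one_add_abs_le hC0 hM0 hz0.le (by linarith))
    rw [norm_mul, ← div_pow, sq]
    exact mul_le_mul b1 b2 (abs_nonneg _) ((abs_nonneg _).trans b1)
  have hstep : ∀ z ∈ Set.Ioi (0 : ℝ),
      Tendsto (fun ε : ℝ => ε * (⌊z / ε⌋₊ : ℝ)) (𝓝[>] 0) (𝓝 z) := by
    intro z hz
    have hz0 : 0 < z := hz
    have hlow : Tendsto (fun ε : ℝ => z - ε) (𝓝[>] 0) (𝓝 z) := by
      have : Tendsto (fun ε : ℝ => z - ε) (𝓝 0) (𝓝 (z - 0)) := tendsto_const_nhds.sub tendsto_id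
      rw [sub_zero] at this
      exact this.mono_left nhdsWithin_le_nhds
    refine tendsto_of_tendsto_of_tendsto_of_le_of_le' hlow tendsto_const_nhds ?_ ?_
    · filter_upwards [self_mem_nhdsWithin] with ε hε
      have hε0 : 0 < ε := hε
      have := (Nat.lt_floor_add_one (z / ε)).le
      rw [div_le_iff₀ hε0] at this
      linarith
    · filter_upwards [self_mem_nhdsWithin] with ε hε
      have hε0 : 0 < ε := hε
      have := Nat.floor_le (div_nonneg hz0.le hε0.le)
      rw [le_div_iff₀ hε0] at this
      linarith
  have hlim : Tendsto (fun ε => ∫ z in Set.Ioi (0 : ℝ), S ε z) (𝓝[>] 0)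
      (𝓝 (higherAiryKernel p x y)) := by
    refine tendsto_integral_filter_of_dominated_convergence
      (fun z => (C * (1 + M)) ^ 2 / (1 + z) ^ 2)
      (Eventually.of_forall fun ε => (hmeas ε).aestronglyMeasurable) ?_
      (integrableOn_inv_one_add_sq _) ?_
    · filter_upwards [hbound] with ε h
      exact (ae_restrict_iff' measurableSet_Ioi).2 (Eventually.of_forall h)
    · refine (ae_restrict_iff' measurableSet_Ioi).2 (Eventually.of_forall fun z hz => ?_)
      exact (hf.tendsto_approxAiry (hξ.add (hstep z hz))).mul
        (hf.tendsto_approxAiry (hυ.add (hstep z hz)))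
  refine hlim.congr' ?_
  filter_upwards [hbound, self_mem_nhdsWithin] with ε hb hε
  refine integral_step_eq (G := fun d : ℕ => approxAiry p f ε (ξ ε + ε * d) *
    approxAiry p f ε (υ ε + ε * d)) hε ?_
  exact Integrable.mono' (integrableOn_inv_one_add_sq _) (hmeas ε).aestronglyMeasurable
    ((ae_restrict_iff' measurableSet_Ioi).2 (Eventually.of_forall hb))

end IsEdgePhase

/-! ### The edge scaling of the Fourier coefficients -/

/-- The phase `f(θ) = aθ - 4 ∑ t_n sin nθ`. -/
def edgePhase (t : ℕ →₀ ℝ) (a θ : ℝ) : ℝ := a * θ - miwaPhase t θ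

/-- The second derivative of `edgePhase`. -/
def edgePhaseDeriv₂ (t : ℕ →₀ ℝ) (θ : ℝ) : ℝ :=
  4 * t.sum fun n c => (n : ℝ) ^ 2 * c * Real.sin (n * θ)

lemma hasDerivAt_miwaPhaseDeriv (t : ℕ →₀ ℝ) (θ : ℝ) :
    HasDerivAt (miwaPhaseDeriv t) (-edgePhaseDeriv₂ t θ) θ := by
  unfold edgePhaseDeriv₂
  rw [neg_mul_eq_mul_neg]
  have h : HasDerivAt (fun θ => t.sum fun n c => c * (n * Real.cos (n * θ)))
      (-(t.sum fun n c => (n : ℝ) ^ 2 * c * Real.sin (n * θ))) θ := by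
    simp only [Finsupp.sum, ← Finset.sum_neg_distrib]
    refine HasDerivAt.fun_sum fun n _ => ?_
    have h1 : HasDerivAt (fun θ : ℝ => (n : ℝ) * θ) n θ := by
      simpa using (hasDerivAt_id θ).const_mul (n : ℝ)
    exact ((h1.cos.const_mul (n : ℝ)).const_mul (t n)).congr_deriv (by ring)
  exact h.const_mul 4

lemma IsMulticritical.tendsto_edgePhase {p : ℕ} {a : ℝ} {t : ℕ →₀ ℝ} (ht : IsMulticritical p a t) :
    Tendsto (fun θ => edgePhase t a θ / θ ^ (p + 1)) (𝓝[>] 0) (𝓝 (1 / ((p : ℝ) + 1))) := by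
  have h1 : Tendsto (fun θ : ℝ => (phase t a θ + θ ^ (p + 1) / ((p : ℝ) + 1)) / θ ^ (p + 1))
      (𝓝[>] 0) (𝓝 0) := by
    have hlo : (fun θ : ℝ => θ ^ (p + 3)) =o[𝓝 0] fun θ : ℝ => θ ^ (p + 1) :=
      isLittleO_pow_pow (by omega)
    exact ((ht.multicritical.trans_isLittleO hlo).tendsto_div_nhds_zero).mono_left
      nhdsWithin_le_nhds
  have h2 := (tendsto_const_nhds (x := 1 / ((p : ℝ) + 1))).sub h1
  rw [sub_zero] at h2
  refine h2.congr' ?_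
  filter_upwards [self_mem_nhdsWithin] with θ hθ
  have hθ0 : θ ≠ 0 := ne_of_gt hθ
  have hp : (p : ℝ) + 1 ≠ 0 := by positivity
  have h3 : phase t a θ = -edgePhase t a θ := by
    unfold phase edgePhase miwaPhase; ring
  rw [h3]
  field_simp
  ring

lemma IsMulticritical.isEdgePhase {p : ℕ} {a : ℝ} {t : ℕ →₀ ℝ} (ht : IsMulticritical p a t) :
    IsEdgePhase p (edgePhase t a) (fun θ => a - miwaPhaseDeriv t θ) (edgePhaseDeriv₂ t) where
  p_pos := ht.order_pos
  hasDerivAt θ := by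
    have h1 : HasDerivAt (fun θ : ℝ => a * θ) a θ := by
      simpa using (hasDerivAt_id θ).const_mul a
    exact h1.sub (hasDerivAt_miwaPhase t θ)
  hasDerivAt' θ := ((hasDerivAt_miwaPhaseDeriv t θ).const_sub a).congr_deriv (neg_neg _)
  zero := by simp [edgePhase, miwaPhase_zero]
  deriv_zero := by
    have h1 : HasDerivAt (fun θ : ℝ => a * θ) a 0 := by
      simpa using (hasDerivAt_id (0 : ℝ)).const_mul a
    have hsub : 𝓝[>] (0 : ℝ) ≤ 𝓝[≠] 0 :=
      nhdsWithin_mono 0 fun θ (hθ : 0 < θ) => ne_of_gt hθ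
    have h2 := (hasDerivAt_iff_tendsto_slope.1 (h1.sub (hasDerivAt_miwaPhase t 0))).mono_left hsub
    have h3 : Tendsto (fun θ : ℝ => edgePhase t a θ / θ ^ (p + 1) * θ ^ p) (𝓝[>] 0)
        (𝓝 (1 / ((p : ℝ) + 1) * 0 ^ p)) :=
      ht.tendsto_edgePhase.mul (((continuous_pow p).tendsto 0).mono_left nhdsWithin_le_nhds)
    rw [zero_pow ht.order_pos.ne', mul_zero] at h3
    refine tendsto_nhds_unique h2 (h3.congr' ?_)
    filter_upwards [self_mem_nhdsWithin] with θ hθ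
    have hθ0 : θ ≠ 0 := ne_of_gt hθ
    rw [slope_def_field]
    simp only [Pi.sub_apply, miwaPhase_zero, mul_zero, sub_zero, edgePhase, pow_succ]
    field_simp
  convex θ hθ := by
    rcases eq_or_lt_of_le hθ.1 with h0 | h0
    · simp [edgePhaseDeriv₂, ← h0]
    rcases eq_or_lt_of_le hθ.2 with h1 | h1
    · simp [edgePhaseDeriv₂, h1, Real.sin_nat_mul_pi]
    · exact (ht.nondegenerate θ ⟨h0, h1⟩).le
  tendsto_zero := ht.tendsto_edgePhase

/-- The rescaled distance of the site `m` from the edge. -/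
def edgeCoord (p : ℕ) (a ε : ℝ) (m : ℤ) : ℝ := ε * m - a / ε ^ p

lemma edgeCoord_add (p : ℕ) (a ε : ℝ) (m i : ℤ) :
    edgeCoord p a ε (m + i) = edgeCoord p a ε m + ε * i := by
  unfold edgeCoord; push_cast; ring

lemma miwaPhase_edgeMiwa (p : ℕ) (t : ℕ →₀ ℝ) (ε θ : ℝ) :
    miwaPhase (edgeMiwa p t ε) θ = (ε ^ (p + 1))⁻¹ * miwaPhase t θ := by
  unfold miwaPhase edgeMiwa
  rw [Finsupp.sum_smul_index' (by simp), Finsupp.mul_sum, Finsupp.mul_sum, Finsupp.mul_sum]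
  exact Finset.sum_congr rfl fun n _ => by simp only [smul_eq_mul]; ring

/-- The Fourier coefficients near the edge are the approximations of the higher Airy function. -/
lemma waveCoeff_edgeMiwa (p : ℕ) (t : ℕ →₀ ℝ) (a : ℝ) {ε : ℝ} (hε : 0 < ε) (m : ℤ) :
    waveCoeff (edgeMiwa p t ε) m =
      ε * approxAiry p (edgePhase t a) ε (edgeCoord p a ε m) := by
  unfold waveCoeff approxAiry
  have h := intervalIntegral.integral_comp_mul_left (a := 0) (b := π / ε)
    (fun θ => Real.cos (m * θ - miwaPhase (edgeMiwa p t ε) θ)) hε.ne'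
  rw [mul_zero, mul_div_cancel₀ _ hε.ne', smul_eq_mul] at h
  have h2 : ∀ s, Real.cos (m * (ε * s) - miwaPhase (edgeMiwa p t ε) (ε * s)) =
      Real.cos (scaledPhase p (edgePhase t a) ε (edgeCoord p a ε m) s) := by
    intro s
    congr 1
    rw [miwaPhase_edgeMiwa, scaledPhase, edgePhase, edgeCoord, pow_succ]
    field_simp
    ring
  simp only [h2] at h
  rw [h]
  field_simp

lemma tendsto_edgeCoord (p : ℕ) (a x : ℝ) :
    Tendsto (fun ε => edgeCoord p a ε (edgeSite p a ε x)) (𝓝[>] 0) (𝓝 x) := by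
  have hlow : Tendsto (fun ε : ℝ => x - ε) (𝓝[>] 0) (𝓝 x) := by
    have : Tendsto (fun ε : ℝ => x - ε) (𝓝 0) (𝓝 (x - 0)) := tendsto_const_nhds.sub tendsto_id
    rw [sub_zero] at this
    exact this.mono_left nhdsWithin_le_nhds
  have hid : ∀ ε : ℝ, 0 < ε → ε * (a / ε ^ (p + 1) + x / ε) - a / ε ^ p = x := by
    intro ε hε
    rw [pow_succ]
    field_simp
    ring
  refine tendsto_of_tendsto_of_tendsto_of_le_of_le' hlow tendsto_const_nhds ?_ ?_
  · filter_upwards [self_mem_nhdsWithin] with ε hε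
    have hε0 : 0 < ε := hε
    have h1 := mul_le_mul_of_nonneg_left (Int.lt_floor_add_one (a / ε ^ (p + 1) + x / ε)).le hε0.le
    have h2 := hid ε hε0
    unfold edgeCoord edgeSite
    linarith
  · filter_upwards [self_mem_nhdsWithin] with ε hε
    have hε0 : 0 < ε := hε
    have h1 := mul_le_mul_of_nonneg_left (Int.floor_le (a / ε ^ (p + 1) + x / ε)) hε0.le
    have h2 := hid ε hε0
    unfold edgeCoord edgeSite
    linarith

/-- The site itself, on its natural scale, tends to the edge. -/
lemma tendsto_pow_mul_edgeSite {p : ℕ} (hp : 0 < p) (a x : ℝ) :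
    Tendsto (fun ε : ℝ => ε ^ (p + 1) * (edgeSite p a ε x : ℝ)) (𝓝[>] 0) (𝓝 a) := by
  have h1 : Tendsto (fun ε : ℝ => ε ^ p) (𝓝[>] 0) (𝓝 0) := by
    have := (continuous_pow (M := ℝ) p).tendsto 0
    rw [zero_pow hp.ne'] at this
    exact this.mono_left nhdsWithin_le_nhds
  have h2 := (h1.mul (tendsto_edgeCoord p a x)).add_const a
  rw [zero_mul, zero_add] at h2
  refine h2.congr' ?_
  filter_upwards [self_mem_nhdsWithin] with ε hε
  have hε0 : ε ≠ 0 := ne_of_gt hε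
  unfold edgeCoord
  rw [pow_succ]
  field_simp
  ring

lemma edgeMiwa_odd {p : ℕ} {t : ℕ →₀ ℝ} (ht : ∀ n, t n ≠ 0 → Odd n) (ε : ℝ) :
    ∀ n, edgeMiwa p t ε n ≠ 0 → Odd n := fun n hn => ht n fun h => hn (by simp [edgeMiwa, h])

lemma miwaMoment_edgeMiwa (p : ℕ) (t : ℕ →₀ ℝ) {ε : ℝ} (hε : 0 < ε) :
    miwaMoment (edgeMiwa p t ε) = (ε ^ (p + 1))⁻¹ * miwaMoment t := by
  unfold miwaMoment edgeMiwa
  rw [Finsupp.sum_smul_index' (by simp), Finsupp.mul_sum]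
  refine Finset.sum_congr rfl fun n _ => ?_
  simp only [smul_eq_mul, abs_mul, abs_inv, abs_of_pos (pow_pos hε (p + 1))]
  ring

/-! ### Scaling limits of the blocks of the kernel -/

/-- The Fourier coefficients are `O(ε)` on windows of fixed size around sites near the edge. -/
lemma IsMulticritical.abs_waveCoeff_le {p : ℕ} {a : ℝ} {t : ℕ →₀ ℝ} (ht : IsMulticritical p a t)
    (x : ℝ) (N : ℕ) : ∃ C : ℝ, 0 ≤ C ∧ ∀ᶠ ε in 𝓝[>] (0 : ℝ), ∀ i : ℤ, |i| ≤ N →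
      |waveCoeff (edgeMiwa p t ε) (edgeSite p a ε x + i)| ≤ ε * C := by
  obtain ⟨C, hC0, hC⟩ := ht.isEdgePhase.abs_approxAiry_le (|x| + 1 + N)
  refine ⟨C, hC0, ?_⟩
  have hξ := Metric.tendsto_nhds.1 (tendsto_edgeCoord p a x) 1 one_pos
  have hε1 : ∀ᶠ ε in 𝓝[>] (0 : ℝ), ε < 1 :=
    eventually_nhdsWithin_of_eventually_nhds (eventually_lt_nhds one_pos)
  filter_upwards [hC, hξ, hε1, self_mem_nhdsWithin] with ε h1 h2 h3 hε i hi
  have hε0 : 0 < ε := hε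
  rw [waveCoeff_edgeMiwa p t a hε0, abs_mul, abs_of_pos hε0, edgeCoord_add]
  refine mul_le_mul_of_nonneg_left ?_ hε0.le
  rw [Real.dist_eq] at h2
  have hi' : -(N : ℝ) ≤ i := by exact_mod_cast (abs_le.1 hi).1
  have hεi : -(N : ℝ) ≤ ε * i := by
    have hN : (0 : ℝ) ≤ N := Nat.cast_nonneg N
    nlinarith
  refine (h1 _ ?_).trans (div_le_self hC0 (by linarith [abs_nonneg (edgeCoord p a ε
    (edgeSite p a ε x) + ε * i)]))
  linarith [(abs_lt.1 h2).1, neg_abs_le x]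

/-- The off-diagonal blocks are negligible. -/
lemma IsMulticritical.tendsto_kernel {p : ℕ} {a : ℝ} {t : ℕ →₀ ℝ} (ht : IsMulticritical p a t)
    (x y : ℝ) :
    Tendsto (fun ε : ℝ => (ε : ℂ)⁻¹ *
      shiftedSchurKernel (edgeMiwa p t ε) (edgeSite p a ε x) (edgeSite p a ε y))
      (𝓝[>] 0) (𝓝 0) := by
  obtain ⟨N, hN⟩ : ∃ N : ℕ, ∀ n, t n ≠ 0 → n ≤ N :=
    ⟨t.support.sup id, fun n hn => Finset.le_sup (f := id) (by simpa using hn)⟩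
  obtain ⟨C₁, hC₁0, hC₁⟩ := ht.abs_waveCoeff_le x N
  obtain ⟨C₂, hC₂0, hC₂⟩ := ht.abs_waveCoeff_le y N
  set C := max C₁ C₂ with hC
  have hC0 : 0 ≤ C := hC₁0.trans (le_max_left _ _)
  have ha := ht.edge_pos
  have hsum := (tendsto_pow_mul_edgeSite ht.order_pos a x).add
    (tendsto_pow_mul_edgeSite ht.order_pos a y)
  have hlow := hsum.eventually_const_lt (u := a) (by linarith)
  set D := 4 * miwaMoment t * C ^ 2 / a + 1 / 2 * C ^ 2 with hD
  have hlim : Tendsto (fun ε : ℝ => ε * D) (𝓝[>] 0) (𝓝 0) := by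
    have : Tendsto (fun ε : ℝ => ε * D) (𝓝 0) (𝓝 (0 * D)) := tendsto_id.mul_const D
    rw [zero_mul] at this
    exact this.mono_left nhdsWithin_le_nhds
  refine squeeze_zero_norm' ?_ hlim
  filter_upwards [hC₁, hC₂, hlow, self_mem_nhdsWithin] with ε h1 h2 h3 hε
  have hε0 : 0 < ε := hε
  have hodd := edgeMiwa_odd (p := p) ht.odd_of_ne_zero ε
  rw [shiftedSchurKernel_eq_alternatingSum hodd]
  set A := edgeSite p a ε x
  set B := edgeSite p a ε y
  set τ := edgeMiwa p t ε
  have e1 : ∀ i : ℤ, |i| ≤ N → |waveCoeff τ (A + i)| ≤ ε * C := fun i hi =>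
    (h1 i hi).trans (mul_le_mul_of_nonneg_left (le_max_left _ _) hε0.le)
  have e2 : ∀ i : ℤ, |i| ≤ N → |waveCoeff τ (B + i)| ≤ ε * C := fun i hi =>
    (h2 i hi).trans (mul_le_mul_of_nonneg_left (le_max_right _ _) hε0.le)
  have hmain := abs_add_mul_alternatingSum_le (a := A) (b := B) (η := ε * C) (N := N) hodd
    (fun n hn => hN n fun h => hn (by simp [τ, edgeMiwa, h])) fun i hi => ⟨e1 i hi, e2 i hi⟩
  have hεp : 0 < ε ^ (p + 1) := by positivity
  have halt : |alternatingSum τ A B| ≤ 4 * miwaMoment t * (ε * C) ^ 2 / a := by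
    rw [le_div_iff₀ ha]
    rw [miwaMoment_edgeMiwa p t hε0] at hmain
    have h5 : a * |alternatingSum τ A B| ≤
        ε ^ (p + 1) * (|(A : ℝ) + B| * |alternatingSum τ A B|) := by
      rw [← mul_assoc]
      refine mul_le_mul_of_nonneg_right ?_ (abs_nonneg _)
      have := mul_le_mul_of_nonneg_left (le_abs_self ((A : ℝ) + B)) hεp.le
      linarith
    have h6 := mul_le_mul_of_nonneg_left hmain hεp.le
    have h7 : ε ^ (p + 1) * (4 * ((ε ^ (p + 1))⁻¹ * miwaMoment t) * (ε * C) ^ 2) =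
        4 * miwaMoment t * (ε * C) ^ 2 := by field_simp
    linarith
  have hj : |waveCoeff τ A * waveCoeff τ B| ≤ (ε * C) ^ 2 := by
    have f1 := e1 0 (by simp)
    have f2 := e2 0 (by simp)
    rw [add_zero] at f1 f2
    rw [abs_mul, sq]
    exact mul_le_mul f1 f2 (abs_nonneg _) (by positivity)
  rw [norm_mul, norm_inv, Complex.norm_real, Complex.norm_real, Real.norm_eq_abs, Real.norm_eq_abs,
    abs_of_pos hε0, inv_mul_le_iff₀ hε0]
  refine (abs_sub _ _).trans ?_
  rw [abs_mul, abs_of_pos (by norm_num : (0 : ℝ) < 1 / 2)]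
  have h8 : ε * (ε * D) = 4 * miwaMoment t * (ε * C) ^ 2 / a + 1 / 2 * (ε * C) ^ 2 := by
    rw [hD]; ring
  linarith

/-- The diagonal block converges to the higher Airy kernel. -/
lemma IsMulticritical.tendsto_kernel_neg {p : ℕ} {a : ℝ} {t : ℕ →₀ ℝ}
    (ht : IsMulticritical p a t) (x y : ℝ) :
    Tendsto (fun ε : ℝ => (ε : ℂ)⁻¹ * ((-1 : ℂ) ^ (edgeSite p a ε y) *
      shiftedSchurKernel (edgeMiwa p t ε) (edgeSite p a ε x) (-edgeSite p a ε y)))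
      (𝓝[>] 0) (𝓝 (higherAiryKernel p x y : ℂ)) := by
  have hf := ht.isEdgePhase
  have hx := tendsto_edgeCoord p a x
  have hy := tendsto_edgeCoord p a y
  have h1 := hf.tendsto_tsum_approxAiry hx hy
  have hε : Tendsto (fun ε : ℝ => ε) (𝓝[>] 0) (𝓝 0) :=
    (tendsto_id (x := 𝓝 (0 : ℝ))).mono_left nhdsWithin_le_nhds
  have h2 := hε.mul (((hf.tendsto_approxAiry hx).mul (hf.tendsto_approxAiry hy)).const_mul (1 / 2))
  have h3 := h1.sub h2
  rw [zero_mul, sub_zero] at h3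
  refine ((Complex.continuous_ofReal.tendsto _).comp h3).congr' ?_
  filter_upwards [self_mem_nhdsWithin] with ε hε
  have hε0 : 0 < ε := hε
  rw [zpow_mul_shiftedSchurKernel_neg (edgeMiwa_odd ht.odd_of_ne_zero ε), Function.comp_apply,
    ← Complex.ofReal_inv, ← Complex.ofReal_mul]
  congr 1
  simp only [waveCoeff_edgeMiwa p t a hε0, edgeCoord_add, Int.cast_natCast]
  rw [← mul_right_inj' hε0.ne', mul_inv_cancel_left₀ hε0.ne', mul_sub, ← mul_assoc,
    ← tsum_mul_left]
  congr 1
  · refine tsum_congr fun d => ?_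
    ring
  · ring

theorem theorem5p2 (p : ℕ) (a : ℝ) (t : ℕ →₀ ℝ) (ht : IsMulticritical p a t) :
    -- the integrals defining the limit objects converge
    (∀ x : ℝ, Tendsto (higherAiryTruncated p x) atTop (𝓝 (higherAiry p x))) ∧
    (∀ x y : ℝ, IntegrableOn (fun z => higherAiry p (x + z) * higherAiry p (y + z))
      (Set.Ioi (0 : ℝ))) ∧
    -- the three blocks of the rescaled kernel
    (∀ x y : ℝ,
      Tendsto (fun ε : ℝ => (ε : ℂ)⁻¹ *
          shiftedSchurKernel (edgeMiwa p t ε) (edgeSite p a ε x) (edgeSite p a ε y))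
        (𝓝[>] 0) (𝓝 0) ∧
      Tendsto (fun ε : ℝ => (ε : ℂ)⁻¹ * ((-1 : ℂ) ^ (edgeSite p a ε y) *
          shiftedSchurKernel (edgeMiwa p t ε) (edgeSite p a ε x) (-edgeSite p a ε y)))
        (𝓝[>] 0) (𝓝 (higherAiryKernel p x y : ℂ)) ∧
      Tendsto (fun ε : ℝ => (ε : ℂ)⁻¹ * ((-1 : ℂ) ^ (edgeSite p a ε x + edgeSite p a ε y) *
          shiftedSchurKernel (edgeMiwa p t ε) (-edgeSite p a ε x) (-edgeSite p a ε y)))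
        (𝓝[>] 0) (𝓝 0)) ∧
    -- the Pfaffian becomes a determinant
    (∀ (N : ℕ) (k : Fin N → ℝ),
      Tendsto (fun ε : ℝ => ((ε : ℂ) ^ N)⁻¹ *
          pfaffian (correlationMatrix (edgeMiwa p t ε) fun i => edgeSite p a ε (k i)))
        (𝓝[>] 0)
        (𝓝 (Matrix.det (Matrix.of fun i j : Fin N => (higherAiryKernel p (k i) (k j) : ℂ))))) := by
  have hneg : ∀ x y : ℝ, Tendsto (fun ε : ℝ => (ε : ℂ)⁻¹ *
      ((-1 : ℂ) ^ (edgeSite p a ε x + edgeSite p a ε y) *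
        shiftedSchurKernel (edgeMiwa p t ε) (-edgeSite p a ε x) (-edgeSite p a ε y)))
      (𝓝[>] 0) (𝓝 0) := fun x y => by
    simp only [zpow_mul_shiftedSchurKernel_neg_neg (edgeMiwa_odd ht.odd_of_ne_zero _)]
    exact ht.tendsto_kernel y x
  refine ⟨tendsto_higherAiryTruncated ht.order_pos, ht.isEdgePhase.integrableOn_higherAiry_mul,
    fun x y => ⟨ht.tendsto_kernel x y, ht.tendsto_kernel_neg x y, hneg x y⟩, fun N k => ?_⟩
  refine tendsto_pfaffian _ _ (fun i j => ?_) fun i j hij h => ?_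
  · have h1 : (⟨i.val, by omega⟩ : Fin (2 * N)) < ⟨2 * N - 1 - j.val, by omega⟩ := by
      rw [Fin.mk_lt_mk]; omega
    have h2 : ¬ (2 * N - 1 - j.val < N) := by omega
    have h3 : 2 * N - 1 - (2 * N - 1 - j.val) = j.val := by omega
    simp only [correlationMatrix, if_pos h1, correlationEntry, dif_neg h2, dif_pos i.2, h3,
      Matrix.of_apply]
    exact ht.tendsto_kernel_neg (k i) (k j)
  · simp only [correlationMatrix, if_pos hij, correlationEntry]
    by_cases hj : j.val < N
    · have hi : i.val < N := lt_trans hij hj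
      simp only [dif_pos hj, dif_pos hi]
      exact ht.tendsto_kernel _ _
    · have hi : ¬ i.val < N := fun hi => h ⟨hi, not_lt.1 hj⟩
      simp only [dif_neg hj, dif_neg hi]
      exact hneg _ _

end
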